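/- **Setting.** Let $\mathbf n,\mathbf k\in\mathbb R^3$ be linearly independent, $|\mathbf n|=1$, $k=|\mathbf k|$, $\hat{\mathbf k}=\mathbf k/k$, and $\hat{\mathbf e}^\pm(\mathbf k)=\frac{\mathbf n-(\mathbf n\cdot\hat{\mathbf k})\hat{\mathbf k}\pm i\,\hat{\mathbf k}\times\mathbf n}{\sqrt{2[1-(\mathbf n\cdot\hat{\mathbf k})^2]}}$. Given a mode function $\sigma(\eta)$ of conformal time, continued holomorphically from $\eta<0$ to $\mathrm{Re}\,\eta<0$, put $\sigma^*(\eta)=\overline{\sigma(\bar\eta)}$, and for two times on a common ray from $0$ (the later time being the one of smaller modulus) let $$G=[\sigma(\eta_1)\sigma^*(\eta_2)\theta(\eta_1-\eta_2)+(\eta_1\leftrightarrow\eta_2)]-\tfrac{\sigma(\eta_0)}{\sigma^*(\eta_0)}\sigma^*(\eta_1)\sigma^*(\eta_2)$$ be the bulk-bulk propagator with late-time cut-off $\eta_0<0$. For a constant $\mathcal A$ let $$C=[\sigma(\eta_1)\sigma^*(\eta_2)\theta(\eta_1-\eta_2)+(\eta_1\leftrightarrow\eta_2)]+\mathcal A\,\sigma^*(\eta_1)\sigma^*(\eta_2),\qquad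 F=G-C .$$ *Wick rotation*: $\tilde C(\chi_1,\chi_2)=\lim_{\epsilon\to0^+}C(ie^{i\epsilon}\chi_1,ie^{i\epsilon}\chi_2)$ for $\chi_1,\chi_2>0$. *Vanishing in the far past*: for all $\epsilon,r_0>0$ there are $B$, $b>0$ and $p\in\mathbb N$ with $|C(\eta_1,\eta_2)|\le B\,(r_1r_2)^p\,e^{-b|r_1-r_2|}$ for all $\eta_a=-r_a(1-i\epsilon)$, $r_a\ge r_0$; in particular $C\to0$ exponentially when one time is sent to $-\infty(1-i\epsilon)$ and the other is fixed. **CCM.** Spin $S\ge0$, Hubble rate $H>0$, mass $m$, chemical potential $\kappa$, sound-speed parameters $c,\delta c^2$ (real) with $c_{h,S}^2=c^2+\frac{S^2-h^2}{S(2S-1)}\delta c^2>0$ for $|h|\le S$ ($c_{h,0}=|c|$ if $S=0$). Put $c_{h,S}>0$, $\nu=\sqrt{9/4-m^2/H^2}$, $\tilde\kappa=h\kappa/(c_{h,S}H)$ and $$\sigma_h(\eta)=e^{-\pi\tilde\kappa/2}\frac{-H\eta}{\sqrt{2c_{h,S}k}}\,W_{i\tilde\kappa,\nu}(2ic_{h,S}k\eta),$$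 $W$ being Whittaker's function. The indexed propagators are $\sum_{|h|\le S}(\cdot)^{(h)}\,\mathrm e^{(h)}_{i_1\dots i_S}(\mathbf k)\,\mathrm e^{(h)}_{j_1\dots j_S}(-\mathbf k)$, with the symmetric traceless helicity tensors built from $\hat{\mathbf k},\hat{\mathbf e}^\pm$ and satisfying $[\mathrm e^{(h)}(\mathbf k)]^*=\mathrm e^{(h)}(-\mathbf k)$, $\mathrm e^{(h)}(\mathbf k)\cdot\mathrm e^{(h')}(-\mathbf k)=S!\,\delta_{hh'}$. 1. *Heavy fields* ($m\ge\frac32H$, $\nu=i\mu$, $\mu\geq 0$). Take $$\mathcal A_h=\frac{i\pi\,\mathrm{sech}(\pi\tilde\kappa)}{\Gamma(\frac12-i\tilde\kappa-i\mu)\,\Gamma(\frac12-i\tilde\kappa+i\mu)}.$$ Then each $C^{(h)}$, and the indexed $C$, vanish in the far past; the Wick rotations exist; $[\tilde C^{(h)}]^*=\tilde C^{(-h)}$; and every component of the indexed $\tilde C$ is real. 2. *Light fields* ($0\le m<\frac32H$). Take $\mathcal A_h=e^{i\pi(\nu+1/2)}\frac{\Gamma(\frac12+\nu+i\tilde\kappa)}{\Gamma(\frac12+\nu-i\tilde\kappa)}$.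 Then, as $\eta_0\to0^-$, $G^{(h)}\to C^{(h)}$ and $F^{(h)}\to0$, and the indexed $G$ tends to the indexed $C$; that is, $C=G$ and $F=0$ for the $\eta_0$-independent bulk-bulk propagator. All the conclusions of 1 hold for this $C=G$. **CC.** Spin $S\ge0$, $H>0$, mass $m$, $\nu_S=\sqrt{(S-\frac12)^2-m^2/H^2}$. For $|h|\le n\le S$ the mode functions of $\Phi_{\eta\dots\eta i_1\dots i_n}$ are $\Phi^h_{|h|,S}=e^{i\pi(\nu_S+1/2)/2}Z^h_S(-k\eta)^{3/2-|h|}H^{(1)}_{\nu_S}(-k\eta)$, where $Z^h_S>0$ and $$(Z^h_S)^2=\frac{\pi}{4k}\Big(\frac kH\Big)^{2S-2}\frac{[(2|h|-1)!!]^2S!(S-|h|)!}{(2S-1)!!(S+|h|)!}\,\frac{\Gamma(\frac12+|h|+\nu_S)\Gamma(\frac12+|h|-\nu_S)}{\Gamma(\frac12+S+\nu_S)\Gamma(\frac12+S-\nu_S)},$$ and, recursively, $\Phi^h_{n+1,S}=-\frac ik(\Phi^{h\,\prime}_{n,S}-\frac2\eta\Phi^h_{n,S})+\sum_{m=|h|}^nB_{m,n+1}\Phi^h_{m,S}$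 with $B_{m,n}=\frac{2^nn!}{m!(n-m)!(2n-1)!!}\frac{\Gamma(\frac12(1+m+n))}{\Gamma(\frac12(1+m-n))}$. The components with $n$ spatial indices in each group are $\sum_h(\cdot)^h_{n,S}\,\mathfrak e^{(h)}_{i_1\dots i_n}(\mathbf k)[\mathfrak e^{(h)}_{j_1\dots j_n}(\mathbf k)]^*$, with symmetric traceless helicity tensors satisfying $[\mathfrak e^{(h)}]^*=\mathfrak e^{(-h)}$ and $\mathfrak e^{(h)}\cdot[\mathfrak e^{(h)}]^*=\frac{(2n-1)!!(n+|h|)!}{[(2|h|-1)!!]^2n!(n-|h|)!}$; the sum is over $|h|\le n$ (for the discrete series below, over the propagating helicities $T\le|h|\le n$). For all $0\le n\le S$: 3. *Heavy fields* ($m^2\ge H^2(S-\frac12)^2$, $\nu_S=i\mu_S$, $\mu_S\ge 0$). With $\mathcal A_{h,n}=(-1)^{n-|h|}\,i\cosh(\pi\mu_S)$, each $C^h_{n,S}$ and each component $C_{i_1\dots i_nj_1\dots j_n}$ vanishes in the far past, and its Wick rotation exists and is real. 4. *Light fields* (complementary series $S(S-1)<m^2/H^2<(S-\frac12)^2$,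 or discrete series $m^2/H^2=S(S-1)-T(T-1)$, $1\le T\le S$). With $\mathcal A_{h,n}=(-1)^{n-|h|}e^{i\pi(\nu_S+1/2)}$, as $\eta_0\to0^-$ one has $G^h_{n,S}\to C^h_{n,S}$ and $F^h_{n,S}\to0$, and $G_{i_1\dots i_nj_1\dots j_n}\to C_{i_1\dots i_nj_1\dots j_n}$; and all the conclusions of 3 hold for this $C=G$. -/

import Mathlib

open Filter Topology
open scoped ComplexConjugate

namespace DeSitterPropagators

/-! ## Special functions -/

/-- Whittaker's function `W_{κ,μ}(z)` on the principal sheet `|arg z| < π`, by the classical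
formula of Whittaker and Watson
`W_{κ,μ}(z) = e^{-z/2} z^κ / Γ(1/2+μ-κ) ∫₀^∞ e^{-t} t^{μ-κ-1/2} (1+t/z)^{μ+κ-1/2} dt`,
valid for `Re (μ - κ) > -1/2` (below `Re κ = 0` and `Re μ ≥ 0` always). -/
noncomputable def whittakerW (κ μ z : ℂ) : ℂ :=
  Complex.exp (-z / 2) * z ^ κ / Complex.Gamma (1 / 2 + μ - κ) *
    ∫ t in Set.Ioi (0 : ℝ),
      Complex.exp (-(t : ℂ)) * (t : ℂ) ^ (μ - κ - 1 / 2) * (1 + (t : ℂ) / z) ^ (μ + κ - 1 / 2)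

/-- The Hankel function `H^{(1)}_ν(z)`, by Hankel's integral
`(2/(πz))^{1/2} e^{i(z - νπ/2 - π/4)} / Γ(ν+1/2) ∫₀^∞ e^{-t} t^{ν-1/2} (1 + it/(2z))^{ν-1/2} dt`,
valid for `Re ν > -1/2` and `-π/2 < arg z < π`. -/
noncomputable def hankelOne (ν z : ℂ) : ℂ :=
  (2 / (Real.pi * z)) ^ (1 / 2 : ℂ) *
    Complex.exp (Complex.I * (z - ν * Real.pi / 2 - Real.pi / 4)) / Complex.Gamma (ν + 1 / 2) *
    ∫ t in Set.Ioi (0 : ℝ),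
      Complex.exp (-(t : ℂ)) * (t : ℂ) ^ (ν - 1 / 2) *
        (1 + Complex.I * (t : ℂ) / (2 * z)) ^ (ν - 1 / 2)

/-! ## Propagators built from a mode function

A mode function is given as a function of complex conformal time, holomorphic where `Re η < 0`.
Physical times are the negative reals. -/

/-- The holomorphic function of `η` that equals the complex conjugate of the mode function
`σ` at real times (Schwarz reflection). -/
noncomputable def conjMode (σ : ℂ → ℂ) (η : ℂ) : ℂ := conj (σ (conj η))

/-- The Feynman propagator `σ(η₁) σ*(η₂) θ(η₁-η₂) + (η₁ ↔ η₂)` for two times on a common ray from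
the origin. The later time is the one closer to `η = 0`; for negative real times this is the
usual time ordering, and the two orderings agree at equal times. -/
noncomputable def feynman (σ : ℂ → ℂ) (η₁ η₂ : ℂ) : ℂ :=
  if ‖η₁‖ ≤ ‖η₂‖ then σ η₁ * conjMode σ η₂ else σ η₂ * conjMode σ η₁

/-- The bulk-bulk propagator with Dirichlet condition at the late-time cut-off `η₀ < 0`. -/
noncomputable def bulkBulk (σ : ℂ → ℂ) (η₀ : ℝ) (η₁ η₂ : ℂ) : ℂ :=
  feynman σ η₁ η₂ - σ η₀ / conjMode σ η₀ * (conjMode σ η₁ * conjMode σ η₂)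

/-- The connected part `C` of the bulk-bulk propagator, with `ΔG = A σ*(η₁) σ*(η₂)`. -/
noncomputable def connected (σ : ℂ → ℂ) (A : ℂ) (η₁ η₂ : ℂ) : ℂ :=
  feynman σ η₁ η₂ + A * (conjMode σ η₁ * conjMode σ η₂)

/-- The factorised part `F` of the bulk-bulk propagator, so that `bulkBulk = C + F`. -/
noncomputable def factorised (σ : ℂ → ℂ) (A : ℂ) (η₀ : ℝ) (η₁ η₂ : ℂ) : ℂ :=
  -(σ η₀ / conjMode σ η₀) * (conjMode σ η₁ * conjMode σ η₂)
    - A * (conjMode σ η₁ * conjMode σ η₂)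

/-- `Ct(χ₁,χ₂)` is the Wick rotation `η = i e^{iε} χ`, `ε → 0⁺`, of `C(η₁,η₂)`. -/
def IsWickRotation (C : ℂ → ℂ → ℂ) (Ct : ℝ → ℝ → ℂ) : Prop :=
  ∀ χ₁ χ₂ : ℝ, 0 < χ₁ → 0 < χ₂ →
    Tendsto (fun ε : ℝ => C (Complex.I * Complex.exp (Complex.I * ε) * χ₁)
        (Complex.I * Complex.exp (Complex.I * ε) * χ₂)) (𝓝[>] 0) (𝓝 (Ct χ₁ χ₂))

/-- The Wick rotation exists and is real. -/
def RealAfterWick (C : ℂ → ℂ → ℂ) : Prop :=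
  ∃ Ct : ℝ → ℝ → ℂ, IsWickRotation C Ct ∧ ∀ χ₁ χ₂ : ℝ, 0 < χ₁ → 0 < χ₂ → conj (Ct χ₁ χ₂) = Ct χ₁ χ₂

/-- The Wick rotations of all helicity components `|h| ≤ S` exist, and complex conjugation
acts on them as the helicity flip `h → -h`. -/
def HelicallyReal (S : ℕ) (C : ℤ → ℂ → ℂ → ℂ) : Prop :=
  ∃ Ct : ℤ → ℝ → ℝ → ℂ, ∀ h : ℤ, |h| ≤ (S : ℤ) →
    IsWickRotation (C h) (Ct h) ∧
      ∀ χ₁ χ₂ : ℝ, 0 < χ₁ → 0 < χ₂ → conj (Ct h χ₁ χ₂) = Ct (-h) χ₁ χ₂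

/-- Vanishing in the far past along the tilted contours `η = -r (1 - iε)`, `r → ∞`:
exponential decay in the separation of the two times, up to a power, uniformly as long as both
stay away from `η = 0`. -/
def VanishesInFarPast (C : ℂ → ℂ → ℂ) : Prop :=
  ∀ ε : ℝ, 0 < ε → ∀ r₀ : ℝ, 0 < r₀ → ∃ (B b : ℝ) (p : ℕ), 0 < b ∧
    ∀ r₁ ≥ r₀, ∀ r₂ ≥ r₀,
      ‖C (-(r₁ : ℂ) * (1 - Complex.I * ε)) (-(r₂ : ℂ) * (1 - Complex.I * ε))‖
        ≤ B * (r₁ * r₂) ^ p * Real.exp (-b * |r₁ - r₂|)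

/-- The `η₀ → 0⁻` limit of a propagator that depends on the late-time cut-off `η₀`. -/
def HasLateLimit (G : ℝ → ℂ → ℂ → ℂ) (C : ℂ → ℂ → ℂ) : Prop :=
  ∀ η₁ η₂ : ℂ, Tendsto (fun η₀ : ℝ => G η₀ η₁ η₂) (𝓝[<] 0) (𝓝 (C η₁ η₂))

/-! ## Polarisation tensors -/

/-- Momenta and directions in three-dimensional Euclidean space. -/
abbrev Vec3 := EuclideanSpace ℝ (Fin 3)

/-- The unit vector along `k`. -/
noncomputable def unitVec (k : Vec3) : Vec3 := ‖k‖⁻¹ • k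

/-- The polarisation directions
`ê^± = (n - (n·k̂) k̂ ± i k̂ × n) / √(2 [1 - (n·k̂)²])`, for `s = ±1`. -/
noncomputable def polDirection (n k : Vec3) (s : ℤ) (i : Fin 3) : ℂ :=
  (((n i - inner ℝ n (unitVec k) * unitVec k i : ℝ) : ℂ) +
      (s : ℂ) * Complex.I * ((crossProduct (unitVec k).ofLp n.ofLp i : ℝ) : ℂ)) /
    ((Real.sqrt (2 * (1 - inner ℝ n (unitVec k) ^ 2)) : ℝ) : ℂ)

/-- The vectors `ê^+`, `√2 i k̂`, `ê^-`, for `s = 1, 0, -1`. The combination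
`ê^- + t √2 i k̂ + t² ê^+` is null for every `t`, so the coefficients of `t` in its tensor powers
are symmetric and traceless. -/
noncomputable def helicityVec (n k : Vec3) (s : ℤ) (i : Fin 3) : ℂ :=
  if s = 0 then (Real.sqrt 2 : ℂ) * Complex.I * (unitVec k i : ℂ) else polDirection n k s i

/-- The symmetric traceless rank-`S` tensor of helicity `h` and unit norm,
`T_{i₁…i_S} T*_{i₁…i_S} = 1`. It is the coefficient of `t^{S+h}` in the `S`-th tensor power of
`ê^- + t √2 i k̂ + t² ê^+`, divided by its norm `√(2S choose S+h)`. -/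
noncomputable def unitPol (n k : Vec3) (S : ℕ) (h : ℤ) (i : Fin S → Fin 3) : ℂ :=
  (∑ s ∈ (Fintype.piFinset fun _ : Fin S => ({-1, 0, 1} : Finset ℤ)) with ∑ a, s a = h,
      ∏ a, helicityVec n k (s a) (i a)) /
    ((Real.sqrt ((2 * S).choose ((S : ℤ) + h).toNat) : ℝ) : ℂ)

/-- The polarisation tensors `e^{(h)}_{i₁…i_S}(k)` of cosmological condensed matter physics:
`e^{(h)}(k)* = e^{(h)}(-k)` and `e^{(h)}(k) · e^{(h')}(-k) = S! δ_{hh'}`. The sign gives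
`i k̂_i` for `S = 1, h = 0` and `√3 (k̂_i k̂_j - δ_ij/3)` for `S = 2, h = 0`. -/
noncomputable def ccmPol (n k : Vec3) (S : ℕ) (h : ℤ) (i : Fin S → Fin 3) : ℂ :=
  (-1) ^ ((S - h.natAbs) / 2) * ((Real.sqrt S.factorial : ℝ) : ℂ) * unitPol n k S h i

/-- The polarisation tensors `𝔢^{(h)}_{i₁…i_n}(k)` of cosmological collider physics, with real
coefficients: `𝔢^{(h)}* = 𝔢^{(-h)}`, squared norm
`(2r-1)!! (r+|h|)! / ([(2|h|-1)!!]² r! (r-|h|)!)` in rank `r`, and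
`𝔢^{(h)} = 2^{|h|/2} ê^h ⋯ ê^h` in rank `|h|`. -/
noncomputable def ccPol (n k : Vec3) (r : ℕ) (h : ℤ) (i : Fin r → Fin 3) : ℂ :=
  (-Complex.I) ^ (r - h.natAbs) *
    ((Real.sqrt ((Nat.doubleFactorial (2 * r - 1) : ℝ) * (r + h.natAbs).factorial /
      ((Nat.doubleFactorial (2 * h.natAbs - 1) : ℝ) ^ 2 * r.factorial *
        (r - h.natAbs).factorial)) : ℝ) : ℂ) * unitPol n k r h i

/-! ## Cosmological condensed matter physics (CCM) -/

/-- The parameters of a free massive spinning field classified by spatial rotations: spin, Hubble rate, mass, chemical potential,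
and the sound-speed parameters `c` and `δc²`. -/
structure CCMField where
  spin : ℕ
  hubble : ℝ
  mass : ℝ
  chemPot : ℝ
  c : ℝ
  deltaCSq : ℝ

namespace CCMField

/-- `c_{h,S}² = c² + (S² - h²) / (S (2S - 1)) δc²` (and `c²` for `S = 0`). -/
noncomputable def cSq (p : CCMField) (h : ℤ) : ℝ :=
  p.c ^ 2 + ((p.spin : ℝ) ^ 2 - (h : ℝ) ^ 2) / (p.spin * (2 * p.spin - 1)) * p.deltaCSq

/-- The speed of sound `c_{h,S}` of the helicity-`h` mode. -/
noncomputable def cs (p : CCMField) (h : ℤ) : ℝ := Real.sqrt (p.cSq h)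

/-- `κ̃ = h κ / (c_{h,S} H)`. -/
noncomputable def kt (p : CCMField) (h : ℤ) : ℝ := h * p.chemPot / (p.cs h * p.hubble)

/-- `ν = √(9/4 - m²/H²)`, the principal root: `ν ≥ 0`, or `ν = iμ` with `μ > 0`. -/
noncomputable def nu (p : CCMField) : ℂ :=
  ((9 / 4 - p.mass ^ 2 / p.hubble ^ 2 : ℝ) : ℂ) ^ (1 / 2 : ℂ)

/-- `μ = √(m²/H² - 9/4)`, for heavy fields. -/
noncomputable def mu (p : CCMField) : ℝ := Real.sqrt (p.mass ^ 2 / p.hubble ^ 2 - 9 / 4)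

/-- Heavy fields: `ν` is imaginary (or zero). -/
def IsHeavy (p : CCMField) : Prop := 9 / 4 * p.hubble ^ 2 ≤ p.mass ^ 2

/-- Light fields: `ν` is real and positive. -/
def IsLight (p : CCMField) : Prop := p.mass ^ 2 < 9 / 4 * p.hubble ^ 2

/-- The Bunch-Davies mode function
`σ_h(η,k) = e^{-πκ̃/2} (-Hη) / √(2 c_{h,S} k) W_{iκ̃,ν}(2 i c_{h,S} k η)`. -/
noncomputable def mode (p : CCMField) (k : ℝ) (h : ℤ) (η : ℂ) : ℂ :=
  ((Real.exp (-Real.pi * p.kt h / 2) : ℝ) : ℂ) *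
    (-(p.hubble : ℂ) * η / ((Real.sqrt (2 * p.cs h * k) : ℝ) : ℂ)) *
    whittakerW (Complex.I * p.kt h) p.nu (2 * Complex.I * p.cs h * k * η)

/-- `A_h = iπ sech(πκ̃) / [Γ(1/2 - iκ̃ - iμ) Γ(1/2 - iκ̃ + iμ)]`, for heavy fields. -/
noncomputable def heavyCoeff (p : CCMField) (h : ℤ) : ℂ :=
  Complex.I * Real.pi * ((1 / Real.cosh (Real.pi * p.kt h) : ℝ) : ℂ) /
    (Complex.Gamma (1 / 2 - Complex.I * p.kt h - Complex.I * p.mu) *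
      Complex.Gamma (1 / 2 - Complex.I * p.kt h + Complex.I * p.mu))

/-- `e^{iπ(ν+1/2)} Γ(1/2 + ν + iκ̃) / Γ(1/2 + ν - iκ̃)`, for light fields. -/
noncomputable def lightCoeff (p : CCMField) (h : ℤ) : ℂ :=
  Complex.exp (Complex.I * Real.pi * (p.nu + 1 / 2)) *
    Complex.Gamma (1 / 2 + p.nu + Complex.I * p.kt h) /
      Complex.Gamma (1 / 2 + p.nu - Complex.I * p.kt h)

/-- The helical bulk-bulk propagator `G^{(h)}` with late-time cut-off `η₀`. -/
noncomputable def G (p : CCMField) (k η₀ : ℝ) (h : ℤ) : ℂ → ℂ → ℂ :=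
  bulkBulk (p.mode k h) η₀

/-- The helical connected propagator `C^{(h)}` of a heavy field. -/
noncomputable def heavyC (p : CCMField) (k : ℝ) (h : ℤ) : ℂ → ℂ → ℂ :=
  connected (p.mode k h) (p.heavyCoeff h)

/-- The helical connected propagator `C^{(h)}` of a light field. -/
noncomputable def lightC (p : CCMField) (k : ℝ) (h : ℤ) : ℂ → ℂ → ℂ :=
  connected (p.mode k h) (p.lightCoeff h)

/-- The helical factorised part `F^{(h)} = G^{(h)} - C^{(h)}` of a light field. -/
noncomputable def lightF (p : CCMField) (k η₀ : ℝ) (h : ℤ) : ℂ → ℂ → ℂ :=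
  factorised (p.mode k h) (p.lightCoeff h) η₀

/-- The indexed propagator `∑_h D^{(h)}(η₁,η₂) e^{(h)}_{i₁…i_S}(k) e^{(h)}_{j₁…j_S}(-k)` made from
helical propagators `D^{(h)}`. -/
noncomputable def indexed (p : CCMField) (n k : Vec3) (D : ℤ → ℂ → ℂ → ℂ)
    (i j : Fin p.spin → Fin 3) (η₁ η₂ : ℂ) : ℂ :=
  ∑ h ∈ Finset.Icc (-(p.spin : ℤ)) p.spin,
    D h η₁ η₂ * (ccmPol n k p.spin h i * ccmPol n (-k) p.spin h j)

end CCMField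

/-! ## Cosmological collider physics (CC) -/

/-- The parameters of a free massive field in de Sitter space: spin, Hubble rate and mass. -/
structure CCField where
  spin : ℕ
  hubble : ℝ
  mass : ℝ

namespace CCField

/-- `ν_S = √((S - 1/2)² - m²/H²)`, the principal root: `ν_S ≥ 0`, or `ν_S = iμ_S` with
`μ_S > 0`. -/
noncomputable def nu (p : CCField) : ℂ :=
  ((((p.spin : ℝ) - 1 / 2) ^ 2 - p.mass ^ 2 / p.hubble ^ 2 : ℝ) : ℂ) ^ (1 / 2 : ℂ)

/-- `μ_S = √(m²/H² - (S - 1/2)²)`, for heavy fields. -/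
noncomputable def mu (p : CCField) : ℝ :=
  Real.sqrt (p.mass ^ 2 / p.hubble ^ 2 - ((p.spin : ℝ) - 1 / 2) ^ 2)

/-- Heavy fields: the principal series. -/
def IsHeavy (p : CCField) : Prop :=
  p.hubble ^ 2 * ((p.spin : ℝ) - 1 / 2) ^ 2 ≤ p.mass ^ 2

/-- Light fields: the complementary series `S(S-1) < m²/H² < (S-1/2)²`, and the discrete series
`m²/H² = S(S-1) - T(T-1)`, `1 ≤ T ≤ S`, of partially massless fields. -/
def IsLight (p : CCField) : Prop :=
  ((p.spin : ℝ) * (p.spin - 1) < p.mass ^ 2 / p.hubble ^ 2 ∧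
      p.mass ^ 2 / p.hubble ^ 2 < ((p.spin : ℝ) - 1 / 2) ^ 2) ∨
    ∃ T : ℕ, 1 ≤ T ∧ T ≤ p.spin ∧
      p.mass ^ 2 / p.hubble ^ 2 = (p.spin : ℝ) * (p.spin - 1) - (T : ℝ) * (T - 1)

/-- The propagating helicities of the components with `r` spatial indices: all `|h| ≤ r` in the
principal and complementary series (where `0 ≤ Re ν_S < 1/2`); in the discrete series, where
`ν_S = T - 1/2`, the pure gauge modes `|h| < T` are left out. -/
noncomputable def helicities (p : CCField) (r : ℕ) : Finset ℤ :=
  {h ∈ Finset.Icc (-(r : ℤ)) r | p.nu.re < (h.natAbs : ℝ) + 1 / 2}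

/-- The normalisation constant `Z_S^h > 0`, the root of
`(Z_S^h)² = π/(4k) (k/H)^{2S-2} [(2|h|-1)!!]² S! (S-|h|)! / ((2S-1)!! (S+|h|)!) ×
Γ(1/2+|h|+ν_S) Γ(1/2+|h|-ν_S) / (Γ(1/2+S+ν_S) Γ(1/2+S-ν_S))`, in which the ratio of `Γ`-functions
is a positive real number for `ν_S` real or imaginary and `h` propagating. -/
noncomputable def Z (p : CCField) (k : ℝ) (h : ℤ) : ℝ :=
  Real.sqrt (Real.pi / 4 * (1 / k) * (k / p.hubble) ^ (2 * (p.spin : ℤ) - 2) *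
    ((Nat.doubleFactorial (2 * h.natAbs - 1) : ℝ) ^ 2 * p.spin.factorial *
        (p.spin - h.natAbs).factorial /
      ((Nat.doubleFactorial (2 * p.spin - 1) : ℝ) * (p.spin + h.natAbs).factorial)) *
    (Complex.Gamma (1 / 2 + h.natAbs + p.nu) * Complex.Gamma (1 / 2 + h.natAbs - p.nu) /
      (Complex.Gamma (1 / 2 + p.spin + p.nu) * Complex.Gamma (1 / 2 + p.spin - p.nu))).re)

/-- `B_{m,r} = 2^r r! / (m! (r-m)! (2r-1)!!) × Γ((1+m+r)/2) / Γ((1+m-r)/2)`, for `m ≤ r`. It is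
zero when `r - m` is odd: then `Γ` has a pole in the denominator, `Real.Gamma` is `0` there, and
so is the quotient. -/
noncomputable def B (m r : ℕ) : ℝ :=
  2 ^ r * r.factorial / (m.factorial * (r - m).factorial * Nat.doubleFactorial (2 * r - 1)) *
    (Real.Gamma ((1 + m + r) / 2) / Real.Gamma ((1 + m - r) / 2))

/-- The mode function of the components with `|h| + N` spatial indices. For `N = 0` it is
`Φ = e^{iπ(ν_S+1/2)/2} Z_S^h (-kη)^{3/2-|h|} H^{(1)}_{ν_S}(-kη)`; the others follow from
`Φ_{r+1} = -(i/k) (Φ_r' - (2/η) Φ_r) + ∑_{m=|h|}^{r} B_{m,r+1} Φ_m`. -/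
noncomputable def modeAux (p : CCField) (k : ℝ) (h : ℤ) : ℕ → ℂ → ℂ
  | 0 => fun η =>
      Complex.exp (Complex.I * Real.pi * (p.nu + 1 / 2) / 2) * (p.Z k h : ℂ) *
        (-(k : ℂ) * η) ^ (3 / 2 - (h.natAbs : ℂ)) * hankelOne p.nu (-(k : ℂ) * η)
  | N + 1 => fun η =>
      -(Complex.I / k) * (deriv (modeAux p k h N) η - 2 / η * modeAux p k h N η) +
        ∑ m : Fin (N + 1),
          (B (h.natAbs + m) (h.natAbs + N + 1) : ℂ) * modeAux p k h m η
  termination_by N => N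
  decreasing_by all_goals omega

/-- The mode function `Φ^h_{r,S}(η,k)` of helicity `h` in the components `Φ_{η…η i₁…i_r}`,
for `|h| ≤ r ≤ S`. -/
noncomputable def mode (p : CCField) (k : ℝ) (r : ℕ) (h : ℤ) : ℂ → ℂ :=
  p.modeAux k h (r - h.natAbs)

/-- `A_{h,r} = (-1)^{r-|h|} i cosh(πμ_S)`, for heavy fields. -/
noncomputable def heavyCoeff (p : CCField) (r : ℕ) (h : ℤ) : ℂ :=
  (-1) ^ (r - h.natAbs) * Complex.I * ((Real.cosh (Real.pi * p.mu) : ℝ) : ℂ)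

/-- `(-1)^{r-|h|} e^{iπ(ν_S+1/2)}`, for light fields. -/
noncomputable def lightCoeff (p : CCField) (r : ℕ) (h : ℤ) : ℂ :=
  (-1) ^ (r - h.natAbs) * Complex.exp (Complex.I * Real.pi * (p.nu + 1 / 2))

/-- The helical bulk-bulk propagator `G^h_{r,S}` with late-time cut-off `η₀`. -/
noncomputable def G (p : CCField) (k : ℝ) (r : ℕ) (η₀ : ℝ) (h : ℤ) : ℂ → ℂ → ℂ :=
  bulkBulk (p.mode k r h) η₀

/-- The helical connected propagator `C^h_{r,S}` of a heavy field. -/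
noncomputable def heavyC (p : CCField) (k : ℝ) (r : ℕ) (h : ℤ) : ℂ → ℂ → ℂ :=
  connected (p.mode k r h) (p.heavyCoeff r h)

/-- The helical connected propagator `C^h_{r,S}` of a light field. -/
noncomputable def lightC (p : CCField) (k : ℝ) (r : ℕ) (h : ℤ) : ℂ → ℂ → ℂ :=
  connected (p.mode k r h) (p.lightCoeff r h)

/-- The helical factorised part `F^h_{r,S} = G^h_{r,S} - C^h_{r,S}` of a light field. -/
noncomputable def lightF (p : CCField) (k : ℝ) (r : ℕ) (η₀ : ℝ) (h : ℤ) : ℂ → ℂ → ℂ :=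
  factorised (p.mode k r h) (p.lightCoeff r h) η₀

/-- The components `D_{η…η i₁…i_r η…η j₁…j_r} = ∑_h D^h(η₁,η₂) 𝔢^{(h)}_{i₁…i_r}(k)
[𝔢^{(h)}_{j₁…j_r}(k)]*` of the propagator with helical parts `D^h`. -/
noncomputable def indexed (p : CCField) (n k : Vec3) (r : ℕ) (D : ℤ → ℂ → ℂ → ℂ)
    (i j : Fin r → Fin 3) (η₁ η₂ : ℂ) : ℂ :=
  ∑ h ∈ p.helicities r, D h η₁ η₂ * (ccPol n k r h i * conj (ccPol n k r h j))

end CCField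

end DeSitterPropagators

open DeSitterPropagators

namespace DeSitterPropagators

open MeasureTheory Set

/-! All mode functions are elementary factors times the Laplace integral `tricomiInt`, or are built
from it by differentiation, at z = 2ikη (the sound speed being absorbed in k). The conclusions
concern this integral in three regions: rays to infinity, the real axis, and the origin.

Reality. Wick rotation carries z to the negative axis from below, while the reflected mode σ* is
governed by the positive axis. On the cut σ is not real: beyond the branch point t = x the integrand
has the phase e^{iπq}, so conjugation adds a multiple of an integral over that tail, and a shift of
variable turns the tail into the decaying solution, that is σ* up to constants
(`conj_tricomiInt_neg`). The homogeneous term A σ*σ* changes the coefficient of the same product, so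
reality becomes one scalar equation for A: the jump has to equal A − conj A up to a sign
(`conj_wickConnected_bessel`), or, when conjugation also flips the helicity, its twisted form
`IsWickReal`. For heavy condensed-matter fields this equation is Euler's reflection formula; in the
other cases it is an identity between exponentials. For imaginary ν conjugation replaces ν by −ν,
which is harmless because W is even in its index; `tricomiInt_symm` proves this by exchanging the
order of a double integral.

Far past. On a non-real ray the integral is bounded, so e^{−z/2} alone decides: σ grows and σ*
decays at the same rate, and time ordering puts σ* at the earlier time
(`vanishesInFarPast_connected`).

Late times. For ν > 0 the leading power z^{1/2−ν} has a nonzero coefficient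
(`tendsto_cpow_mul_tricomiInt`). Real factors cancel in σ/σ*, so the ratio tends to a computable
number, which is −A for the light coefficients. Hence C is the limit of G and F tends to 0.

Collider components with n > |h|. The recursion preserves the form z^e (P(z²) W + Q(z²) zW') with
real P and Q (`exists_isBesselMode_modeAux`). The functions W and zW' have the same jump factor, the
even polynomials do not see the sign of z, and each step lowers e by one; this is the source of the
sign (−1)^{n−|h|}. The leading late-time coefficient is multiplied by a nonzero number at each step.

Indexed propagators. Conjugating the polarisation tensors flips h up to signs that cancel in the
product of two tensors, so reindexing h → −h in the sum gives reality. -/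

/-- The integrand of `tricomiInt`. -/
noncomputable def tricomiKernel (p q z : ℂ) (t : ℝ) : ℂ :=
  Complex.exp (-(t : ℂ)) * (t : ℂ) ^ p * (1 + (t : ℂ) / z) ^ q

/-- The Laplace integral `∫₀^∞ e^{-t} t^p (1 + t/z)^q dt` common to Whittaker's and Hankel's
functions. -/
noncomputable def tricomiInt (p q z : ℂ) : ℂ := ∫ t in Ioi (0 : ℝ), tricomiKernel p q z t

/-! ### Exponential bounds for complex powers. -/

lemma norm_cpow_le_rpow_mul (w q : ℂ) :
    ‖w ^ q‖ ≤ ‖w‖ ^ q.re * Real.exp (Real.pi * |q.im|) := by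
  refine (Complex.norm_cpow_le w q).trans ?_
  rw [div_eq_mul_inv, ← Real.exp_neg]
  gcongr
  calc -(w.arg * q.im) ≤ |w.arg * q.im| := neg_le_abs _
    _ = |w.arg| * |q.im| := abs_mul _ _
    _ ≤ _ := by gcongr; exact Complex.abs_arg_le_pi w

lemma one_add_rpow_le_exp (s : ℝ) : ∃ M : ℝ, 0 ≤ M ∧ ∀ t : ℝ, 0 ≤ t →
    (1 + t) ^ s ≤ M * Real.exp (t / 2) := by
  -- The shift by one keeps r positive at s = 0. The bound (1+t)/(2r) ≤ exp((1+t)/(2r)), raised to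
  -- the power r, costs e^{t/2}: half of the decay available from e^{−t}.
  set r := |s| + 1
  have hr0 : 0 < r := by positivity
  refine ⟨(2 * r) ^ r * Real.exp (1 / 2), by positivity, fun t ht => ?_⟩
  have h1 : (1 + t) ^ s ≤ (1 + t) ^ r :=
    Real.rpow_le_rpow_of_exponent_le (by linarith) (by linarith [le_abs_self s])
  have h2 : (1 + t) ^ r = (2 * r) ^ r * ((1 + t) / (2 * r)) ^ r := by
    rw [← Real.mul_rpow (by positivity) (by positivity)]
    congr 1
    field_simp
  have h3 : ((1 + t) / (2 * r)) ^ r ≤ Real.exp ((1 + t) / 2) := by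
    calc ((1 + t) / (2 * r)) ^ r ≤ (Real.exp ((1 + t) / (2 * r))) ^ r := by
          gcongr
          linarith [Real.add_one_le_exp ((1 + t) / (2 * r))]
      _ = _ := by
          rw [← Real.exp_mul]
          congr 1
          field_simp
  calc (1 + t) ^ s ≤ (2 * r) ^ r * ((1 + t) / (2 * r)) ^ r := h1.trans h2.le
    _ ≤ (2 * r) ^ r * Real.exp ((1 + t) / 2) := by gcongr
    _ = _ := by rw [mul_assoc, ← Real.exp_add]; ring_nf

lemma exists_norm_cpow_le_exp (q : ℂ) {δ C : ℝ} (hδ : 0 < δ) (hC : 0 ≤ C) :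
    ∃ M : ℝ, 0 ≤ M ∧ ∀ (w : ℂ) (t : ℝ), 0 ≤ t → δ ≤ ‖w‖ → ‖w‖ ≤ C * (1 + t) →
      ‖w ^ q‖ ≤ M * Real.exp (t / 2) := by
  obtain ⟨M, hM, h⟩ := one_add_rpow_le_exp q.re
  refine ⟨(C ^ q.re * M + δ ^ q.re) * Real.exp (Real.pi * |q.im|), by positivity,
    fun w t ht h1 h2 => ?_⟩
  have key : ‖w‖ ^ q.re ≤ (C ^ q.re * M + δ ^ q.re) * Real.exp (t / 2) := by
    rw [add_mul]
    rcases le_or_gt 0 q.re with hq | hq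
    · calc ‖w‖ ^ q.re ≤ (C * (1 + t)) ^ q.re := by gcongr
        _ = C ^ q.re * (1 + t) ^ q.re := Real.mul_rpow hC (by linarith)
        _ ≤ C ^ q.re * (M * Real.exp (t / 2)) := by gcongr; exact h t ht
        _ ≤ _ := by rw [← mul_assoc]; linarith [show 0 ≤ δ ^ q.re * Real.exp (t / 2) by positivity]
    · calc ‖w‖ ^ q.re ≤ δ ^ q.re := Real.rpow_le_rpow_of_nonpos hδ h1 hq.le
        _ ≤ δ ^ q.re * Real.exp (t / 2) :=
          le_mul_of_one_le_right (by positivity) (Real.one_le_exp (by linarith))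
        _ ≤ _ := by linarith [show 0 ≤ C ^ q.re * M * Real.exp (t / 2) by positivity]
  calc ‖w ^ q‖ ≤ ‖w‖ ^ q.re * Real.exp (Real.pi * |q.im|) := norm_cpow_le_rpow_mul w q
    _ ≤ ((C ^ q.re * M + δ ^ q.re) * Real.exp (t / 2)) * Real.exp (Real.pi * |q.im|) := by gcongr
    _ = _ := by ring

/-! ### Convergence, derivative and contiguity relations of the Laplace integral. -/

lemma integrableOn_exp_neg_mul_rpow {a b : ℝ} (ha : -1 < a) (hb : 0 < b) :
    IntegrableOn (fun t : ℝ => Real.exp (-(b * t)) * t ^ a) (Ioi 0) := by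
  have := integrableOn_rpow_mul_exp_neg_mul_rpow (p := 1) ha one_pos hb
  simpa [mul_comm] using this

lemma measurable_tricomiKernel (p q z : ℂ) : Measurable (tricomiKernel p q z) := by
  unfold tricomiKernel
  fun_prop

lemma norm_tricomiKernel {t : ℝ} (ht : 0 < t) (p q z : ℂ) :
    ‖tricomiKernel p q z t‖ = Real.exp (-t) * t ^ p.re * ‖(1 + (t : ℂ) / z) ^ q‖ := by
  rw [tricomiKernel, norm_mul, norm_mul, Complex.norm_cpow_eq_rpow_re_of_pos ht,
    ← Complex.ofReal_neg, ← Complex.ofReal_exp, Complex.norm_real,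
    Real.norm_of_nonneg (Real.exp_pos _).le]

/-- A uniform integrable bound on the integrand, where `1 + t/z` stays away from zero. -/
lemma exists_norm_tricomiKernel_le (p q : ℂ) {δ C : ℝ} (hδ : 0 < δ) (hC : 0 ≤ C) :
    ∃ M : ℝ, 0 ≤ M ∧ ∀ (z : ℂ) (t : ℝ), 0 < t → δ ≤ ‖1 + (t : ℂ) / z‖ →
      ‖1 + (t : ℂ) / z‖ ≤ C * (1 + t) →
      ‖tricomiKernel p q z t‖ ≤ M * (Real.exp (-(1 / 2 * t)) * t ^ p.re) := by
  obtain ⟨M, hM, h⟩ := exists_norm_cpow_le_exp q hδ hC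
  refine ⟨M, hM, fun z t ht h1 h2 => ?_⟩
  rw [norm_tricomiKernel ht]
  calc _ ≤ Real.exp (-t) * t ^ p.re * (M * Real.exp (t / 2)) := by
        gcongr
        exact h _ t ht.le h1 h2
    _ = M * (Real.exp (-t) * Real.exp (t / 2) * t ^ p.re) := by ring
    _ = _ := by rw [← Real.exp_add]; ring_nf

lemma exists_le_norm_add_of_mem_slitPlane {z : ℂ} (hz : z ∈ Complex.slitPlane) :
    ∃ δ : ℝ, 0 < δ ∧ ∀ t : ℝ, 0 ≤ t → δ ≤ ‖z + t‖ := by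
  rcases Complex.mem_slitPlane_iff.1 hz with h | h
  · refine ⟨z.re, h, fun t ht => ?_⟩
    calc z.re ≤ (z + t).re := by simp [ht]
      _ ≤ _ := Complex.re_le_norm _
  · refine ⟨|z.im|, abs_pos.2 h, fun t ht => ?_⟩
    calc |z.im| = |(z + t).im| := by simp
      _ ≤ _ := Complex.abs_im_le_norm _

/-- Locally uniform bounds on `1 + t/z` in the slit plane. -/
lemma exists_ball_bounds {z : ℂ} (hz : z ∈ Complex.slitPlane) :
    ∃ ρ δ C : ℝ, 0 < ρ ∧ 0 < δ ∧ 0 ≤ C ∧ ∀ w ∈ Metric.ball z ρ, w ∈ Complex.slitPlane ∧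
      C⁻¹ ≤ ‖w‖ ∧ 0 < C ∧
      ∀ t : ℝ, 0 < t → δ ≤ ‖1 + (t : ℂ) / w‖ ∧ ‖1 + (t : ℂ) / w‖ ≤ C * (1 + t) := by
  obtain ⟨δ, hδ, h⟩ := exists_le_norm_add_of_mem_slitPlane hz
  obtain ⟨ρ, hρ, hρ'⟩ := Metric.isOpen_iff.1 Complex.isOpen_slitPlane z hz
  -- Half of the bound δ on ‖z + t‖ survives a displacement of z by less than δ/2, and dividing by
  -- ‖w‖ ≤ ‖z‖ + δ gives the lower constant. Since ‖w‖⁻¹ ≤ 2/δ, the same C serves for both remaining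
  -- estimates.
  refine ⟨min ρ (δ / 2), (δ / 2) / (‖z‖ + δ), 1 + 2 / δ, by positivity, by positivity,
    by positivity, fun w hw => ?_⟩
  have hw1 : w ∈ Complex.slitPlane := hρ' (Metric.ball_subset_ball (min_le_left _ _) hw)
  have hw2 : ‖z - w‖ < δ / 2 := by
    have := Metric.mem_ball.1 hw
    rw [dist_comm, dist_eq_norm] at this
    exact this.trans_le (min_le_right _ _)
  have hw0 : w ≠ 0 := Complex.slitPlane_ne_zero hw1
  have hlow : ∀ t : ℝ, 0 ≤ t → δ / 2 ≤ ‖w + t‖ := fun t ht => by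
    have h1 := h t ht
    have h2 : ‖z + t‖ ≤ ‖w + t‖ + ‖z - w‖ := by
      calc ‖z + t‖ = ‖(w + t) + (z - w)‖ := by ring_nf
        _ ≤ _ := norm_add_le _ _
    linarith
  have hwn : δ / 2 ≤ ‖w‖ := by simpa using hlow 0 le_rfl
  have hwp : 0 < ‖w‖ := norm_pos_iff.2 hw0
  refine ⟨hw1, ?_, by positivity, fun t ht => ⟨?_, ?_⟩⟩
  · refine le_trans ?_ hwn
    rw [inv_le_comm₀ (by positivity) (by positivity), inv_div]
    linarith
  · have : (1 : ℂ) + t / w = (w + t) / w := by field_simp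
    rw [this, norm_div, div_le_div_iff₀ (by positivity) hwp]
    have h1 := hlow t ht.le
    have h3 : ‖w‖ ≤ ‖z‖ + δ := by
      calc ‖w‖ = ‖z - (z - w)‖ := by ring_nf
        _ ≤ ‖z‖ + ‖z - w‖ := norm_sub_le _ _
        _ ≤ _ := by linarith
    gcongr
  · calc ‖(1 : ℂ) + t / w‖ ≤ ‖(1 : ℂ)‖ + ‖(t : ℂ) / w‖ := norm_add_le _ _
      _ = 1 + t / ‖w‖ := by simp [abs_of_pos ht]
      _ ≤ 1 + t / (δ / 2) := by gcongr
      _ ≤ _ := by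
        have : t / (δ / 2) = 2 / δ * t := by field_simp
        rw [this]
        nlinarith [show 0 < 2 / δ by positivity]

lemma one_add_div_mem_slitPlane {z : ℂ} (hz : z ∈ Complex.slitPlane) {t : ℝ} (ht : 0 ≤ t) :
    1 + (t : ℂ) / z ∈ Complex.slitPlane := by
  rcases ht.eq_or_lt with rfl | ht
  · simp
  have hn : 0 < Complex.normSq z := Complex.normSq_pos.2 (Complex.slitPlane_ne_zero hz)
  rw [Complex.mem_slitPlane_iff] at hz ⊢
  simp only [Complex.add_re, Complex.one_re, Complex.div_re, Complex.ofReal_re, Complex.ofReal_im,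
    Complex.add_im, Complex.one_im, Complex.div_im, zero_mul, zero_div, add_zero, zero_add,
    zero_sub]
  rcases hz with h | h
  · left; positivity
  · right
    exact neg_ne_zero.2 (by positivity)

lemma integrableOn_tricomiKernel {p : ℂ} (hp : -1 < p.re) (q : ℂ) {z : ℂ}
    (hz : z ∈ Complex.slitPlane) : IntegrableOn (tricomiKernel p q z) (Ioi 0) := by
  obtain ⟨ρ, δ, C, hρ, hδ, hC, h⟩ := exists_ball_bounds hz
  obtain ⟨M, hM, hb⟩ := exists_norm_tricomiKernel_le p q hδ hC
  refine Integrable.mono'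
    ((integrableOn_exp_neg_mul_rpow hp (by norm_num : (0:ℝ) < 1/2)).const_mul M)
    (measurable_tricomiKernel p q z).aestronglyMeasurable ?_
  refine (ae_restrict_iff' measurableSet_Ioi).2 (Eventually.of_forall fun t ht => ?_)
  have := (h z (Metric.mem_ball_self hρ)).2.2.2 t ht
  exact hb z t ht this.1 this.2

/-- Differentiation under the integral sign, dominated on a small disc. The factor t produced by
∂_z(t/z) raises p while the power rule lowers q. -/
lemma hasDerivAt_tricomiInt {p : ℂ} (hp : -1 < p.re) (q : ℂ) {z : ℂ}
    (hz : z ∈ Complex.slitPlane) :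
    HasDerivAt (tricomiInt p q) (-q / z ^ 2 * tricomiInt (p + 1) (q - 1) z) z := by
  obtain ⟨ρ, δ, C, hρ, hδ, hC, h⟩ := exists_ball_bounds hz
  obtain ⟨M, hM, hb⟩ := exists_norm_tricomiKernel_le (p + 1) (q - 1) hδ hC
  have hp1 : -1 < (p + 1).re := by simp; linarith
  have key := hasDerivAt_integral_of_dominated_loc_of_deriv_le (μ := volume.restrict (Ioi (0 : ℝ)))
    (F := fun w t => tricomiKernel p q w t)
    (F' := fun w t => -q / w ^ 2 * tricomiKernel (p + 1) (q - 1) w t) (x₀ := z)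
    (bound := fun t => ‖q‖ * C ^ 2 * (M * (Real.exp (-(1 / 2 * t)) * t ^ (p + 1).re)))
    (Metric.ball_mem_nhds z hρ)
    (Eventually.of_forall fun w => (measurable_tricomiKernel p q w).aestronglyMeasurable)
    (integrableOn_tricomiKernel hp q hz)
    (((measurable_tricomiKernel (p + 1) (q - 1) z).const_mul _).aestronglyMeasurable) ?_ ?_ ?_
  · have h2 := key.2
    rw [integral_const_mul] at h2
    exact h2
  · refine (ae_restrict_iff' measurableSet_Ioi).2 (Eventually.of_forall fun t ht w hw => ?_)
    obtain ⟨hw1, hw2, hC0, hw3⟩ := h w hw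
    rw [norm_mul, norm_div, norm_neg, norm_pow]
    gcongr
    · rw [div_eq_mul_inv, ← inv_pow]
      have : ‖w‖⁻¹ ≤ C := by
        rw [inv_le_comm₀ (norm_pos_iff.2 (Complex.slitPlane_ne_zero hw1)) hC0]
        exact hw2
      gcongr
    · exact hb w t ht (hw3 t ht).1 (hw3 t ht).2
  · exact ((integrableOn_exp_neg_mul_rpow hp1 (by norm_num : (0:ℝ) < 1/2)).const_mul M).const_mul _
  · refine (ae_restrict_iff' measurableSet_Ioi).2 (Eventually.of_forall fun t ht w hw => ?_)
    have hw1 := (h w hw).1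
    have hw0 := Complex.slitPlane_ne_zero hw1
    have ht0 : (t : ℂ) ≠ 0 := by exact_mod_cast (ne_of_gt ht)
    have h1 : HasDerivAt (fun w : ℂ => 1 + (t : ℂ) / w) (-(t : ℂ) / w ^ 2) w := by
      have := ((hasDerivAt_inv hw0).const_mul (t : ℂ)).const_add 1
      simp only [div_eq_mul_inv]
      convert! this using 1
      ring
    have h2 := h1.cpow_const (c := q) (one_add_div_mem_slitPlane hw1 (le_of_lt ht))
    have h3 := h2.const_mul (Complex.exp (-(t : ℂ)) * (t : ℂ) ^ p)
    convert! h3 using 1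
    rw [tricomiKernel, Complex.cpow_add _ _ ht0, Complex.cpow_one]
    ring

/-- One factor 1 + t/z is split off from the power and expanded. -/
lemma tricomiInt_eq_add {p : ℂ} (hp : -1 < p.re) (q : ℂ) {z : ℂ} (hz : z ∈ Complex.slitPlane) :
    tricomiInt p q z = tricomiInt p (q - 1) z + tricomiInt (p + 1) (q - 1) z / z := by
  have hp1 : -1 < (p + 1).re := by simp; linarith
  rw [tricomiInt, tricomiInt, tricomiInt, div_eq_mul_inv, mul_comm _ z⁻¹, ← integral_const_mul,
    ← integral_add (integrableOn_tricomiKernel hp _ hz)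
      ((integrableOn_tricomiKernel hp1 _ hz).const_mul _)]
  refine setIntegral_congr_fun measurableSet_Ioi fun t ht => ?_
  have ht0 : (t : ℂ) ≠ 0 := by exact_mod_cast (ne_of_gt ht)
  have h1 := Complex.slitPlane_ne_zero (one_add_div_mem_slitPlane hz (le_of_lt ht))
  simp only [tricomiKernel, Complex.cpow_add _ _ ht0, Complex.cpow_one]
  nth_rewrite 1 [show q = (q - 1) + 1 by ring]
  rw [Complex.cpow_add _ _ h1, Complex.cpow_one]
  ring

/-- The t-derivative of the kernel integrates to zero: Re p > 0 removes the boundary term at 0 and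
e^{−t} the one at infinity. -/
lemma tricomiInt_integration_by_parts {p : ℂ} (hp : 0 < p.re) (q : ℂ) {z : ℂ}
    (hz : z ∈ Complex.slitPlane) :
    tricomiInt p q z = p * tricomiInt (p - 1) q z + q / z * tricomiInt p (q - 1) z := by
  have hp1 : -1 < (p - 1).re := by simp; linarith
  have hp0 : -1 < p.re := by linarith
  have i1 := integrableOn_tricomiKernel hp0 q hz
  have i2 := (integrableOn_tricomiKernel hp1 q hz).const_mul p
  have i3 := (integrableOn_tricomiKernel hp0 (q - 1) hz).const_mul (q / z)
  have i4 : IntegrableOn (fun t => p * tricomiKernel (p - 1) q z t +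
      q / z * tricomiKernel p (q - 1) z t) (Ioi 0) := i2.add i3
  have hd : ∀ t ∈ Ioi (0 : ℝ), HasDerivAt (tricomiKernel p q z)
      ((p * tricomiKernel (p - 1) q z t + q / z * tricomiKernel p (q - 1) z t)
        - tricomiKernel p q z t) t := fun t ht => by
    have hts : (t : ℂ) ∈ Complex.slitPlane := Complex.ofReal_mem_slitPlane.2 ht
    have hid := hasDerivAt_id (t : ℂ)
    have e1 := (hid.neg).cexp
    have e2 := hid.cpow_const (c := p) hts
    have e3 := ((hid.div_const z).const_add 1).cpow_const (c := q)
      (by simpa using one_add_div_mem_slitPlane hz (le_of_lt ht))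
    have := ((e1.mul e2).mul e3).comp_ofReal
    convert! this using 1
    simp only [tricomiKernel, id, Pi.neg_apply, Pi.mul_apply]
    ring
  have hbd : ∃ M : ℝ, ∀ t : ℝ, 0 < t →
      ‖tricomiKernel p q z t‖ ≤ M * (Real.exp (-(1 / 2 * t)) * t ^ p.re) := by
    obtain ⟨ρ, δ, C, hρ, hδ, hC, h⟩ := exists_ball_bounds hz
    obtain ⟨M, hM, hb⟩ := exists_norm_tricomiKernel_le p q hδ hC
    refine ⟨M, fun t ht => ?_⟩
    have := (h z (Metric.mem_ball_self hρ)).2.2.2 t ht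
    exact hb z t ht this.1 this.2
  obtain ⟨M, hM⟩ := hbd
  have h0 : Tendsto (tricomiKernel p q z) (𝓝[>] 0) (𝓝 0) := by
    have : Tendsto (fun t : ℝ => M * (Real.exp (-(1 / 2 * t)) * t ^ p.re)) (𝓝[>] 0) (𝓝 0) := by
      have hc : ContinuousAt (fun t : ℝ => M * (Real.exp (-(1 / 2 * t)) * t ^ p.re)) 0 := by
        have := Real.continuousAt_rpow_const 0 p.re (Or.inr hp.le)
        fun_prop
      have := hc.tendsto
      simp only [Real.zero_rpow hp.ne', mul_zero] at this
      exact this.mono_left nhdsWithin_le_nhds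
    exact squeeze_zero_norm' (eventually_nhdsWithin_of_forall fun t ht => hM t ht) this
  have hinf : Tendsto (tricomiKernel p q z) atTop (𝓝 0) := by
    have : Tendsto (fun t : ℝ => M * (Real.exp (-(1 / 2 * t)) * t ^ p.re)) atTop (𝓝 0) := by
      have := (tendsto_rpow_mul_exp_neg_mul_atTop_nhds_zero p.re (1 / 2) (by norm_num)).const_mul M
      simpa [mul_comm] using this
    exact squeeze_zero_norm' ((eventually_gt_atTop 0).mono fun t ht => hM t ht) this
  -- Prescribing the limit 0 as the value at t = 0 makes the antiderivative continuous at the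
  -- endpoint without changing it on t > 0.
  have key := integral_Ioi_of_hasDerivAt_of_tendsto
    (f := Function.update (tricomiKernel p q z) 0 0) (a := 0) (m := 0)
    (f' := fun t => (p * tricomiKernel (p - 1) q z t + q / z * tricomiKernel p (q - 1) z t)
        - tricomiKernel p q z t)
    (continuousWithinAt_update_same.2 (by simpa using h0)) (fun t ht => ?_) (i4.sub i1) ?_
  · rw [integral_sub i4 i1, integral_add i2 i3, integral_const_mul,
      integral_const_mul] at key
    simp only [Function.update_self, sub_zero] at key
    rw [sub_eq_zero] at key
    exact key.symm
  · refine (hd t ht).congr_of_eventuallyEq ?_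
    filter_upwards [eventually_ne_nhds (ne_of_gt ht)] with y hy
    exact Function.update_of_ne hy _ _
  · refine hinf.congr' ?_
    filter_upwards [eventually_ne_atTop 0] with y hy
    exact (Function.update_of_ne hy _ _).symm

/-- On a non-real ray ‖1 + t/(ru)‖ ≥ |Im u|/‖u‖ independently of r and t, so a single dominating
function serves all r ≥ r₀. -/
lemma exists_norm_tricomiInt_ray_le {p : ℂ} (hp : -1 < p.re) (q : ℂ) {u : ℂ} (hu : u.im ≠ 0)
    {r₀ : ℝ} (hr₀ : 0 < r₀) :
    ∃ B : ℝ, ∀ r : ℝ, r₀ ≤ r → ‖tricomiInt p q (r * u)‖ ≤ B := by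
  have hu0 : u ≠ 0 := fun h => hu (by simp [h])
  have hun : 0 < ‖u‖ := norm_pos_iff.2 hu0
  have hδ : 0 < |u.im| / ‖u‖ := by positivity
  obtain ⟨M, hM, hb⟩ := exists_norm_tricomiKernel_le p q hδ
    (show 0 ≤ 1 + 1 / (r₀ * ‖u‖) by positivity)
  refine ⟨_, fun r hr => norm_integral_le_of_norm_le
    ((integrableOn_exp_neg_mul_rpow hp (by norm_num : (0:ℝ) < 1/2)).const_mul M)
    ((ae_restrict_iff' measurableSet_Ioi).2 (Eventually.of_forall fun t ht => ?_))⟩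
  have ht : 0 < t := ht
  have hr0 : 0 < r := hr₀.trans_le hr
  have hrc : (r : ℂ) ≠ 0 := by exact_mod_cast hr0.ne'
  refine hb _ t ht ?_ ?_
  · have : (1 : ℂ) + t / (r * u) = (r * u + t) / (r * u) := by field_simp
    rw [this, norm_div, norm_mul, Complex.norm_real, Real.norm_of_nonneg hr0.le,
      div_le_div_iff₀ hun (by positivity)]
    have h1 : r * |u.im| ≤ ‖(r : ℂ) * u + t‖ := by
      calc r * |u.im| = |((r : ℂ) * u + t).im| := by simp [abs_mul, abs_of_pos hr0]
        _ ≤ _ := Complex.abs_im_le_norm _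
    nlinarith
  · calc ‖(1 : ℂ) + t / (r * u)‖ ≤ ‖(1 : ℂ)‖ + ‖(t : ℂ) / (r * u)‖ := norm_add_le _ _
      _ = 1 + t / (r * ‖u‖) := by simp [abs_of_pos ht, abs_of_pos hr0]
      _ ≤ 1 + t / (r₀ * ‖u‖) := by gcongr
      _ ≤ _ := by
        have : t / (r₀ * ‖u‖) = 1 / (r₀ * ‖u‖) * t := by field_simp
        rw [this]
        nlinarith [show 0 < 1 / (r₀ * ‖u‖) by positivity]

/-! ### Boundary values on the branch cut -/

/-- The substitution s = 1 − t/x maps (0, 2x) to (−1, 1) and turns the singularity at t = x into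
|s|^b. -/
lemma integrableOn_rpow_abs_one_sub_div {b x : ℝ} (hb : -1 < b) (hx : 0 < x) :
    IntegrableOn (fun t : ℝ => |1 - t / x| ^ b) (Ioc 0 (2 * x)) := by
  have h1 : IntervalIntegrable (fun s : ℝ => (s : ℂ) ^ (b : ℂ)) volume 1 (-1) :=
    intervalIntegral.intervalIntegrable_cpow' (by simpa using hb)
  have h2 : IntervalIntegrable (fun s : ℝ => |s| ^ b) volume 1 (-1) := by
    refine h1.norm.congr ?_
    intro s _
    simp [Complex.norm_cpow_real]
  have h3 := (h2.comp_sub_left 1).comp_mul_left (c := x⁻¹)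
  rw [sub_self, zero_div, show (1 - -1) / x⁻¹ = 2 * x by field_simp; norm_num,
    intervalIntegrable_iff, uIoc_of_le (by positivity)] at h3
  simpa only [div_eq_inv_mul] using h3

/-- The dominating function for the approach to the cut. Away from t = x the singular factor is
bounded because b ≤ 0; near t = x the other factors are bounded and the singularity is integrable
because b > −1. -/
lemma integrableOn_boundary_bound {a b x M : ℝ} (ha : -1 < a) (hb : -1 < b) (hb0 : b ≤ 0)
    (hx : 0 < x) :
    IntegrableOn (fun t : ℝ => Real.exp (-t) * t ^ a * (|1 - t / x| ^ b + M * Real.exp (t / 2)))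
      (Ioi 0) := by
  have i1 : IntegrableOn (fun t : ℝ => Real.exp (-t) * t ^ a) (Ioi 0) := by
    simpa using integrableOn_exp_neg_mul_rpow ha one_pos
  have i2 := integrableOn_exp_neg_mul_rpow ha (by norm_num : (0:ℝ) < 1/2)
  have i3 : IntegrableOn (fun t : ℝ => (Ioc 0 (2 * x)).indicator (fun t => |1 - t / x| ^ b) t)
      (Ioi 0) :=
    ((integrableOn_rpow_abs_one_sub_div hb hx).integrable_indicator measurableSet_Ioc).integrableOn
  -- Near t = x one has x/2 < t < 2x, so t^a is bounded by one of the two summands, according to the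
  -- sign of a.
  set K : ℝ := (x / 2) ^ a + (2 * x) ^ a
  have hK0 : 0 ≤ K := by positivity
  have i4 : IntegrableOn (fun t : ℝ => Real.exp (-t) * t ^ a * |1 - t / x| ^ b) (Ioi 0) := by
    refine Integrable.mono' ((i1.const_mul ((1 / 2) ^ b)).add (i3.const_mul K))
      (by fun_prop) ?_
    refine (ae_restrict_iff' measurableSet_Ioi).2 (Eventually.of_forall fun t ht => ?_)
    have ht : 0 < t := ht
    rw [Real.norm_of_nonneg (by positivity)]
    simp only [Pi.add_apply]
    have hind : 0 ≤ (Ioc 0 (2 * x)).indicator (fun t => |1 - t / x| ^ b) t :=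
      indicator_nonneg (fun s _ => by positivity) _
    by_cases hc : 1 / 2 ≤ |1 - t / x|
    · have : |1 - t / x| ^ b ≤ (1 / 2) ^ b := Real.rpow_le_rpow_of_nonpos (by norm_num) hc hb0
      have h5 : Real.exp (-t) * t ^ a * |1 - t / x| ^ b ≤ Real.exp (-t) * t ^ a * (1 / 2) ^ b := by
        gcongr
      have := mul_nonneg hK0 hind
      linarith
    · have hc' := abs_lt.1 (not_le.1 hc)
      have e1 : t / x < 3 / 2 := by linarith [hc'.1]
      have e2 : 1 / 2 < t / x := by linarith [hc'.2]
      rw [div_lt_iff₀ hx] at e1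
      rw [lt_div_iff₀ hx] at e2
      rw [indicator_of_mem (by constructor <;> linarith)]
      have h6 : t ^ a ≤ K := by
        rcases le_or_gt 0 a with h | h
        · have : t ^ a ≤ (2 * x) ^ a := by gcongr; linarith
          linarith [show 0 ≤ (x / 2) ^ a by positivity]
        · have : t ^ a ≤ (x / 2) ^ a :=
            Real.rpow_le_rpow_of_nonpos (by positivity) (by linarith) h.le
          linarith [show 0 ≤ (2 * x) ^ a by positivity]
      have h7 : Real.exp (-t) ≤ 1 := Real.exp_le_one_iff.2 (by linarith)
      have h8 : Real.exp (-t) * t ^ a * |1 - t / x| ^ b ≤ 1 * K * |1 - t / x| ^ b := by gcongr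
      have : 0 ≤ (1 / 2 : ℝ) ^ b * (Real.exp (-t) * t ^ a) := by positivity
      linarith
  refine (i4.add (i2.const_mul M)).congr (Eventually.of_forall fun t => ?_)
  simp only [Pi.add_apply]
  have : Real.exp (-(1 / 2 * t)) = Real.exp (-t) * Real.exp (t / 2) := by
    rw [← Real.exp_add]; ring_nf
  rw [this]
  ring

/-- The modulus of 1 − (t/x)e^{−iε} lies between |1 − t/x| and 1 + t/x whatever ε is, so a bound in
these terms is uniform in the rotation. Only a negative Re q is singular at t = x, hence `min q.re
0`. -/
lemma exists_norm_cpow_le_boundary (q : ℂ) {x : ℝ} (hx : 0 < x) :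
    ∃ M K : ℝ, 0 ≤ K ∧ ∀ (w : ℂ) (t : ℝ), 0 < t → t ≠ x → |1 - t / x| ≤ ‖w‖ → ‖w‖ ≤ 1 + t / x →
      ‖w ^ q‖ ≤ K * (|1 - t / x| ^ (min q.re 0) + M * Real.exp (t / 2)) := by
  obtain ⟨M, hM, h⟩ := one_add_rpow_le_exp q.re
  refine ⟨(1 + 1 / x) ^ q.re * M, Real.exp (Real.pi * |q.im|), (Real.exp_pos _).le,
    fun w t ht htx h1 h2 => ?_⟩
  have hpos : 0 < |1 - t / x| := by
    refine abs_pos.2 fun h0 => htx ?_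
    field_simp at h0
    linarith
  refine (norm_cpow_le_rpow_mul w q).trans ?_
  rw [mul_comm]
  gcongr
  rcases le_or_gt 0 q.re with hq | hq
  · calc ‖w‖ ^ q.re ≤ ((1 + 1 / x) * (1 + t)) ^ q.re := by
          gcongr
          refine h2.trans ?_
          have : t / x = 1 / x * t := by ring
          nlinarith [show 0 < 1 / x by positivity]
      _ = (1 + 1 / x) ^ q.re * (1 + t) ^ q.re := Real.mul_rpow (by positivity) (by positivity)
      _ ≤ (1 + 1 / x) ^ q.re * (M * Real.exp (t / 2)) := by gcongr; exact h t ht.le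
      _ ≤ _ := by
        rw [← mul_assoc]
        linarith [show 0 ≤ |1 - t / x| ^ (min q.re 0) by positivity]
  · rw [min_eq_left hq.le]
    have := Real.rpow_le_rpow_of_nonpos hpos h1 hq.le
    linarith [show 0 ≤ (1 + 1 / x) ^ q.re * M * Real.exp (t / 2) by positivity]

lemma ae_ne_Ioi (x : ℝ) {P : ℝ → Prop} (h : ∀ t, 0 < t → t ≠ x → P t) :
    ∀ᵐ t ∂(volume.restrict (Ioi (0 : ℝ))), P t := by
  refine (ae_restrict_iff' measurableSet_Ioi).2 ?_
  filter_upwards [Measure.ae_ne volume x] with t htx ht using h t ht htx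

lemma integrableOn_tricomiKernel_neg {p q : ℂ} (hp : -1 < p.re) (hq : -1 < q.re) {x : ℝ}
    (hx : 0 < x) : IntegrableOn (tricomiKernel p q (-x)) (Ioi 0) := by
  obtain ⟨M, K, hK, hb⟩ := exists_norm_cpow_le_boundary q hx
  refine Integrable.mono' ((integrableOn_boundary_bound (M := M) hp
    (lt_min hq (by norm_num)) (min_le_right q.re 0) hx).const_mul K)
    (measurable_tricomiKernel p q _).aestronglyMeasurable (ae_ne_Ioi x fun t ht htx => ?_)
  rw [norm_tricomiKernel ht, mul_left_comm]
  gcongr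
  have e : (1 : ℂ) + t / (-x) = ((1 - t / x : ℝ) : ℂ) := by push_cast; ring
  refine hb _ t ht htx ?_ ?_
  · rw [e, Complex.norm_real, Real.norm_eq_abs]
  · rw [e, Complex.norm_real, Real.norm_eq_abs]
    have := show 0 < t / x by positivity
    exact abs_le.2 ⟨by linarith, by linarith⟩

/-- The integral is continuous from below up to the cut, where it takes its principal value. -/
lemma tendsto_tricomiInt_neg {p q : ℂ} (hp : -1 < p.re) (hq : -1 < q.re) {x : ℝ} (hx : 0 < x) :
    Tendsto (fun ε : ℝ => tricomiInt p q (-(x * Complex.exp (Complex.I * ε)))) (𝓝[>] 0)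
      (𝓝 (tricomiInt p q (-x))) := by
  obtain ⟨M, K, hK, hb⟩ := exists_norm_cpow_le_boundary q hx
  have hε : ∀ᶠ ε : ℝ in 𝓝[>] 0, ε ∈ Ioo 0 Real.pi := Ioo_mem_nhdsGT Real.pi_pos
  have hform : ∀ (ε t : ℝ), (1 : ℂ) + t / (-(x * Complex.exp (Complex.I * ε))) =
      1 - ((t / x : ℝ) : ℂ) * Complex.exp (-(Complex.I * ε)) := fun ε t => by
    rw [Complex.exp_neg]
    push_cast
    have := Complex.exp_ne_zero (Complex.I * ε)
    field_simp
    ring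
  have hnorm : ∀ ε : ℝ, ‖Complex.exp (-(Complex.I * ε))‖ = 1 := fun ε => by
    rw [Complex.norm_exp]; simp
  refine tendsto_integral_filter_of_dominated_convergence _
    (Eventually.of_forall fun ε => (measurable_tricomiKernel p q _).aestronglyMeasurable)
    (Eventually.of_forall fun ε => ae_ne_Ioi x fun t ht htx => ?_)
    ((integrableOn_boundary_bound (M := M) hp
    (lt_min hq (by norm_num)) (min_le_right q.re 0) hx).const_mul K)
    (ae_ne_Ioi x fun t ht htx => ?_)
  · rw [norm_tricomiKernel ht, mul_left_comm]
    gcongr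
    have htx0 : 0 < t / x := by positivity
    have hn2 : ‖((t / x : ℝ) : ℂ) * Complex.exp (-(Complex.I * ε))‖ = t / x := by
      rw [norm_mul, hnorm, mul_one, Complex.norm_real, Real.norm_of_nonneg htx0.le]
    refine hb _ t ht htx ?_ ?_
    · rw [hform]
      have := abs_norm_sub_norm_le (1 : ℂ) (((t / x : ℝ) : ℂ) * Complex.exp (-(Complex.I * ε)))
      rwa [hn2, norm_one] at this
    · rw [hform]
      have := norm_sub_le (1 : ℂ) (((t / x : ℝ) : ℂ) * Complex.exp (-(Complex.I * ε)))
      rwa [hn2, norm_one] at this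
  · unfold tricomiKernel
    refine Tendsto.const_mul _ ?_
    have e : (1 : ℂ) + t / (-x) = 1 - ((t / x : ℝ) : ℂ) := by push_cast; ring
    have htx0 : 0 < t / x := by positivity
    have hw : Tendsto (fun ε : ℝ => (1 : ℂ) + t / (-(x * Complex.exp (Complex.I * ε)))) (𝓝[>] 0)
        (𝓝 (1 + t / (-x))) := by
      simp only [hform, e]
      have : Continuous (fun ε : ℝ => 1 - ((t / x : ℝ) : ℂ) * Complex.exp (-(Complex.I * ε))) := by
        fun_prop
      have := this.tendsto 0
      simp only [Complex.ofReal_zero, mul_zero, neg_zero, Complex.exp_zero, mul_one] at this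
      exact this.mono_left nhdsWithin_le_nhds
    -- The imaginary part is (t/x) sin ε. As z reaches the cut from below, the base 1 + t/z reaches
    -- the negative axis from above, the side on which the principal logarithm is continuous.
    have hwim : ∀ᶠ ε : ℝ in 𝓝[>] 0,
        0 ≤ ((1 : ℂ) + t / (-(x * Complex.exp (Complex.I * ε)))).im := by
      filter_upwards [hε] with ε hε'
      rw [hform, Complex.sub_im, Complex.im_ofReal_mul, Complex.exp_im]
      have := Real.sin_nonneg_of_mem_Icc ⟨hε'.1.le, hε'.2.le⟩
      simp
      positivity
    have hne : (1 : ℂ) + t / (-x) ≠ 0 := by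
      rw [e]
      intro h0
      have : 1 - t / x = 0 := by exact_mod_cast h0
      field_simp at this
      exact htx (by linarith)
    rcases lt_or_gt_of_ne htx with h | h
    · have hs : (1 : ℂ) + t / (-x) ∈ Complex.slitPlane := by
        rw [e, ← Complex.ofReal_one, ← Complex.ofReal_sub, Complex.ofReal_mem_slitPlane, sub_pos,
          div_lt_one hx]
        exact h
      exact (continuousAt_cpow_const hs).tendsto.comp hw
    · have hlog := Complex.continuousWithinAt_log_of_re_neg_of_im_zero
        (z := (1 : ℂ) + t / (-x)) (by
          rw [e, ← Complex.ofReal_one, ← Complex.ofReal_sub, Complex.ofReal_re, sub_neg,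
            one_lt_div hx]
          exact h) (by
          rw [e, ← Complex.ofReal_one, ← Complex.ofReal_sub, Complex.ofReal_im])
      have h1 := hlog.tendsto.comp (tendsto_nhdsWithin_iff.2 ⟨hw, hwim⟩)
      have h2 := (Complex.continuous_exp.tendsto _).comp (h1.mul_const q)
      rw [Complex.cpow_def_of_ne_zero hne]
      refine h2.congr' ?_
      filter_upwards [hw.eventually_ne hne] with ε h3
      simp [Complex.cpow_def_of_ne_zero h3]

lemma conj_ofReal_cpow {t : ℝ} (ht : 0 < t) (p : ℂ) :
    conj ((t : ℂ) ^ p) = (t : ℂ) ^ (conj p) := by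
  have := Complex.conj_cpow (t : ℂ) (conj p)
    (Complex.slitPlane_arg_ne_pi (Complex.ofReal_mem_slitPlane.2 ht))
  simpa using this.symm

lemma conj_tricomiInt (p q : ℂ) {z : ℂ} (hz : z ∈ Complex.slitPlane) :
    conj (tricomiInt p q z) = tricomiInt (conj p) (conj q) (conj z) := by
  rw [tricomiInt, tricomiInt, ← integral_conj]
  refine setIntegral_congr_fun measurableSet_Ioi fun t ht => ?_
  have h1 := Complex.conj_cpow (1 + (t : ℂ) / z) (conj q)
    (Complex.slitPlane_arg_ne_pi (one_add_div_mem_slitPlane hz (le_of_lt ht)))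
  simp only [Complex.conj_conj, map_add, map_one, map_div₀, Complex.conj_ofReal] at h1
  simp only [tricomiKernel, map_mul, ← h1, conj_ofReal_cpow ht, ← Complex.exp_conj, map_neg,
    Complex.conj_ofReal]

lemma neg_ofReal_cpow {s : ℝ} (hs : 0 < s) (q : ℂ) :
    (-(s : ℂ)) ^ q = (s : ℂ) ^ q * Complex.exp (Complex.I * Real.pi * q) := by
  have hs0 : (s : ℂ) ≠ 0 := by exact_mod_cast hs.ne'
  rw [Complex.cpow_def_of_ne_zero (neg_ne_zero.2 hs0), Complex.cpow_def_of_ne_zero hs0,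
    ← Complex.exp_add, Complex.log, Complex.log, norm_neg, ← Complex.ofReal_neg,
    Complex.arg_ofReal_of_neg (by linarith), Complex.arg_ofReal_of_nonneg hs.le]
  congr 1
  push_cast
  ring

/-- The part of the integral beyond the branch point is again a Laplace integral. -/
lemma setIntegral_Ioi_tricomi (p q : ℂ) {x : ℝ} (hx : 0 < x) :
    ∫ t in Ioi x, Complex.exp (-(t : ℂ)) * (t : ℂ) ^ p * ((t / x - 1 : ℝ) : ℂ) ^ q =
      (x : ℂ) ^ (p - q) * Complex.exp (-x) * tricomiInt q p x := by
  have h := (measurePreserving_add_right volume x).setIntegral_preimage_emb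
    (measurableEmbedding_addRight x)
    (fun t : ℝ => Complex.exp (-(t : ℂ)) * (t : ℂ) ^ p * ((t / x - 1 : ℝ) : ℂ) ^ q) (Ioi x)
  rw [← h, preimage_add_const_Ioi, sub_self, tricomiInt, ← integral_const_mul]
  refine setIntegral_congr_fun measurableSet_Ioi fun s hs => ?_
  have hs : 0 < s := hs
  have hx0 : (x : ℂ) ≠ 0 := by exact_mod_cast hx.ne'
  have e1 : ((s + x : ℝ) : ℂ) ^ p = (x : ℂ) ^ p * (1 + (s : ℂ) / x) ^ p := by
    have : s + x = x * (1 + s / x) := by field_simp; ring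
    rw [this, Complex.ofReal_mul, Complex.mul_cpow_ofReal_nonneg hx.le (by positivity)]
    push_cast
    rfl
  have e2 : (((s + x) / x - 1 : ℝ) : ℂ) ^ q = (s : ℂ) ^ q / (x : ℂ) ^ q := by
    have : (s + x) / x - 1 = s * x⁻¹ := by field_simp; ring
    rw [this, Complex.ofReal_mul, Complex.mul_cpow_ofReal_nonneg hs.le (by positivity),
      Complex.ofReal_inv, Complex.inv_cpow _ _
        (Complex.slitPlane_arg_ne_pi (Complex.ofReal_mem_slitPlane.2 hx)), div_eq_mul_inv]
  simp only [tricomiKernel]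
  rw [e1, e2, Complex.cpow_sub _ _ hx0]
  push_cast
  rw [neg_add, Complex.exp_add]
  ring

/-- The discontinuity across the cut. -/
lemma conj_tricomiInt_neg {p q : ℂ} (hp : -1 < p.re) (hq : -1 < q.re) {x : ℝ} (hx : 0 < x) :
    conj (tricomiInt p q (-x)) = tricomiInt (conj p) (conj q) (-x) +
      (Complex.exp (-(Complex.I * Real.pi * conj q)) - Complex.exp (Complex.I * Real.pi * conj q)) *
        ((x : ℂ) ^ (conj p - conj q) * Complex.exp (-x) * tricomiInt (conj q) (conj p) x) := by
  rw [← setIntegral_Ioi_tricomi _ _ hx, ← integral_const_mul,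
    ← inter_eq_self_of_subset_right (Ioi_subset_Ioi hx.le),
    ← setIntegral_indicator measurableSet_Ioi, ← sub_eq_iff_eq_add']
  have i1 : IntegrableOn (fun t => conj (tricomiKernel p q (-x) t)) (Ioi 0) :=
    (LinearIsometryEquiv.integrable_comp_iff
      (Complex.conjLIE)).2 (integrableOn_tricomiKernel_neg hp hq hx)
  have i2 := integrableOn_tricomiKernel_neg (p := conj p) (q := conj q) (by simpa using hp)
    (by simpa using hq) hx
  rw [tricomiInt, tricomiInt, ← integral_conj, ← integral_sub i1 i2]
  refine integral_congr_ae (ae_ne_Ioi x fun t ht htx => ?_)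
  have hc : conj (tricomiKernel p q (-x) t) = Complex.exp (-(t : ℂ)) * (t : ℂ) ^ (conj p) *
      conj ((1 + (t : ℂ) / (-x)) ^ q) := by
    simp only [tricomiKernel, map_mul, conj_ofReal_cpow ht, ← Complex.exp_conj, map_neg,
      Complex.conj_ofReal]
  simp only [hc]
  -- For t < x the base is positive and conjugation only acts on the exponents. For t > x the base
  -- is negative: the phase e^{iπq} is conjugated to e^{−iπ conj q}, whereas the integral with
  -- conjugated exponents has e^{iπ conj q}.
  rcases lt_or_gt_of_ne htx with h | h
  · have e : (1 : ℂ) + t / (-x) = ((1 - t / x : ℝ) : ℂ) := by push_cast; ring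
    have hp : 0 < 1 - t / x := by rw [sub_pos, div_lt_one hx]; exact h
    rw [indicator_of_notMem (by simpa using h.le), tricomiKernel, e, conj_ofReal_cpow hp, sub_self]
  · have e : (1 : ℂ) + t / (-x) = -((t / x - 1 : ℝ) : ℂ) := by push_cast; ring
    have hp : 0 < t / x - 1 := by rw [sub_pos, one_lt_div hx]; exact h
    rw [indicator_of_mem (by simpa using h), tricomiKernel, e, neg_ofReal_cpow hp,
      neg_ofReal_cpow hp, map_mul, conj_ofReal_cpow hp, ← Complex.exp_conj]
    simp only [map_mul, Complex.conj_I, Complex.conj_ofReal]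
    ring_nf

/-! ### Symmetry in the index -/

/-- Writing Γ(β+1)(1+t/x)^{−β−1} as an integral over s gives the double integral of e^{−t−s−st/x}
t^α s^β, which is symmetric under exchanging (t, α) with (s, β). Fubini applies because e^{−st/x} ≤
1. -/
lemma tricomiInt_symm_of_pos {α β : ℂ} (hα : -1 < α.re) (hβ : -1 < β.re) {x : ℝ} (hx : 0 < x) :
    Complex.Gamma (β + 1) * tricomiInt α (-β - 1) x =
      Complex.Gamma (α + 1) * tricomiInt β (-α - 1) x := by
  have key : ∀ {α β : ℂ}, -1 < β.re →
      Complex.Gamma (β + 1) * tricomiInt α (-β - 1) x =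
        ∫ t in Ioi (0 : ℝ), ∫ s in Ioi (0 : ℝ), Complex.exp (-(t : ℂ)) * (t : ℂ) ^ α *
          (Complex.exp (-(s : ℂ)) * (s : ℂ) ^ β) * Complex.exp (-(s * t / x : ℂ)) := by
    intro α β hβ
    rw [tricomiInt, ← integral_const_mul]
    refine setIntegral_congr_fun measurableSet_Ioi fun t ht => ?_
    have ht : 0 < t := ht
    have hr : 0 < 1 + t / x := by positivity
    have h1 := Complex.integral_cpow_mul_exp_neg_mul_Ioi (a := β + 1) (r := 1 + t / x)
      (by simp; linarith) hr
    have h2 : (∫ s in Ioi (0 : ℝ), Complex.exp (-(t : ℂ)) * (t : ℂ) ^ α *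
          (Complex.exp (-(s : ℂ)) * (s : ℂ) ^ β) * Complex.exp (-(s * t / x : ℂ))) =
        Complex.exp (-(t : ℂ)) * (t : ℂ) ^ α *
          ∫ s in Ioi (0 : ℝ), (s : ℂ) ^ (β + 1 - 1) *
            Complex.exp (-(((1 + t / x : ℝ) : ℂ) * s)) := by
      rw [← integral_const_mul]
      refine setIntegral_congr_fun measurableSet_Ioi fun s _ => ?_
      have : Complex.exp (-(((1 + t / x : ℝ) : ℂ) * s)) =
          Complex.exp (-(s : ℂ)) * Complex.exp (-(s * t / x : ℂ)) := by
        rw [← Complex.exp_add]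
        congr 1
        push_cast
        ring
      simp only [this, add_sub_cancel_right]
      ring
    simp only [h2, h1, tricomiKernel]
    have h3 : (1 / ((1 + t / x : ℝ) : ℂ)) ^ (β + 1) = (1 + (t : ℂ) / x) ^ (-β - 1) := by
      rw [one_div, Complex.inv_cpow _ _
        (Complex.slitPlane_arg_ne_pi (Complex.ofReal_mem_slitPlane.2 hr)), ← Complex.cpow_neg]
      push_cast
      ring_nf
    rw [h3]
    ring
  rw [key hβ, key hα, integral_integral_swap]
  · refine setIntegral_congr_fun measurableSet_Ioi fun s _ =>
      setIntegral_congr_fun measurableSet_Ioi fun t _ => ?_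
    rw [mul_comm (s : ℂ) t]
    ring
  · have hi : ∀ {α : ℂ}, -1 < α.re →
        IntegrableOn (fun t : ℝ => Complex.exp (-(t : ℂ)) * (t : ℂ) ^ α) (Ioi 0) := by
      intro α hα
      have := integrableOn_tricomiKernel hα 0 Complex.one_mem_slitPlane
      refine this.congr (Eventually.of_forall fun t => ?_)
      simp [tricomiKernel]
    have hprod := (hi hα).mul_prod (hi hβ)
    refine hprod.norm.mono' (by unfold Function.uncurry; fun_prop) ?_
    rw [Measure.prod_restrict]
    refine (ae_restrict_iff' (measurableSet_Ioi.prod measurableSet_Ioi)).2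
      (Eventually.of_forall fun ⟨t, s⟩ ⟨ht, hs⟩ => ?_)
    have ht : 0 < t := ht
    have hs : 0 < s := hs
    simp only [Function.uncurry, norm_mul]
    refine mul_le_of_le_one_right (by positivity) ?_
    rw [Complex.norm_exp, Real.exp_le_one_iff]
    have : (-((s : ℂ) * t / x)).re = -(s * t / x) := by
      rw [← Complex.ofReal_mul, ← Complex.ofReal_div, ← Complex.ofReal_neg, Complex.ofReal_re]
    rw [this]
    have : 0 < s * t / x := by positivity
    linarith

lemma differentiableOn_tricomiInt {p : ℂ} (hp : -1 < p.re) (q : ℂ) :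
    DifferentiableOn ℂ (tricomiInt p q) Complex.slitPlane := fun _ hz =>
  (hasDerivAt_tricomiInt hp q hz).differentiableAt.differentiableWithinAt

/-- Both sides are analytic on the connected slit plane and agree on positive reals accumulating at
1. -/
lemma tricomiInt_symm {α β : ℂ} (hα : -1 < α.re) (hβ : -1 < β.re) {z : ℂ}
    (hz : z ∈ Complex.slitPlane) :
    Complex.Gamma (β + 1) * tricomiInt α (-β - 1) z =
      Complex.Gamma (α + 1) * tricomiInt β (-α - 1) z := by
  have h1 := ((differentiableOn_tricomiInt hα (-β - 1)).const_mul
    (Complex.Gamma (β + 1))).analyticOnNhd Complex.isOpen_slitPlane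
  have h2 := ((differentiableOn_tricomiInt hβ (-α - 1)).const_mul
    (Complex.Gamma (α + 1))).analyticOnNhd Complex.isOpen_slitPlane
  refine h1.eqOn_of_preconnected_of_frequently_eq h2
    (Complex.starConvex_one_slitPlane.isPathConnected
      Complex.one_mem_slitPlane).isConnected.isPreconnected Complex.one_mem_slitPlane ?_ hz
  have ht : Tendsto (fun ε : ℝ => (1 : ℂ) + ε) (𝓝[>] 0) (𝓝[≠] 1) := by
    refine tendsto_nhdsWithin_iff.2 ⟨?_, ?_⟩
    · have : Continuous (fun ε : ℝ => (1 : ℂ) + ε) := by fun_prop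
      have := this.tendsto 0
      simp only [Complex.ofReal_zero, add_zero] at this
      exact this.mono_left nhdsWithin_le_nhds
    · filter_upwards [self_mem_nhdsWithin] with ε hε
      simpa using (ne_of_gt hε)
  refine ht.frequently (Eventually.frequently ?_)
  filter_upwards [self_mem_nhdsWithin] with ε hε
  have hε : 0 < ε := hε
  have := tricomiInt_symm_of_pos hα hβ (show 0 < 1 + ε by linarith)
  simpa using this

lemma neg_mul_exp_mem_slitPlane {x : ℝ} (hx : 0 < x) :
    ∀ᶠ ε : ℝ in 𝓝[>] 0, -((x : ℂ) * Complex.exp (Complex.I * ε)) ∈ Complex.slitPlane := by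
  filter_upwards [Ioo_mem_nhdsGT Real.pi_pos] with ε hε
  refine Complex.mem_slitPlane_iff.2 (Or.inr ?_)
  have := Real.sin_pos_of_mem_Ioo hε
  simp only [Complex.neg_im, Complex.im_ofReal_mul, Complex.exp_im]
  simp
  exact ⟨hx.ne', this.ne'⟩

/-- The symmetry passes to the limit on the cut; negative real parts of α and β put −β−1 and −α−1 in
the range where the limit exists. -/
lemma tricomiInt_symm_neg {α β : ℂ} (hα : -1 < α.re) (hβ : -1 < β.re) (hα0 : α.re < 0)
    (hβ0 : β.re < 0) {x : ℝ} (hx : 0 < x) :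
    Complex.Gamma (β + 1) * tricomiInt α (-β - 1) (-x) =
      Complex.Gamma (α + 1) * tricomiInt β (-α - 1) (-x) := by
  have t1 := (tendsto_tricomiInt_neg (q := -β - 1) hα (by simp; linarith) hx).const_mul
    (Complex.Gamma (β + 1))
  have t2 := (tendsto_tricomiInt_neg (q := -α - 1) hβ (by simp; linarith) hx).const_mul
    (Complex.Gamma (α + 1))
  refine tendsto_nhds_unique t1 (t2.congr' ?_)
  filter_upwards [neg_mul_exp_mem_slitPlane hx] with ε hε
  exact (tricomiInt_symm hα hβ hε).symm

/-! ### Behaviour at the origin -/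

/-- The arguments of z and 1 + t/z are at most π/2 and strictly less than π/2 in modulus, so their
sum stays on the principal branch. -/
lemma mul_cpow_one_add_div {z : ℂ} (hz : 0 ≤ z.re) (hz0 : z ≠ 0) {t : ℝ} (ht : 0 < t) (q : ℂ) :
    z ^ q * (1 + (t : ℂ) / z) ^ q = (z + t) ^ q := by
  have hn : 0 < Complex.normSq z := Complex.normSq_pos.2 hz0
  have h1 : 0 < (1 + (t : ℂ) / z).re := by
    simp only [Complex.add_re, Complex.one_re, Complex.div_re, Complex.ofReal_re,
      Complex.ofReal_im, zero_mul, zero_div, add_zero]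
    positivity
  have h10 : (1 + (t : ℂ) / z) ≠ 0 := fun h => by simp [h] at h1
  have a1 := abs_le.1 (Complex.abs_arg_le_pi_div_two_iff.2 hz)
  have a2 := abs_lt.1 (Complex.abs_arg_lt_pi_div_two_iff.2 (Or.inl h1))
  have hz1 : z + t = z * (1 + t / z) := by field_simp
  have hzt : z + t ≠ 0 := by rw [hz1]; exact mul_ne_zero hz0 h10
  rw [Complex.cpow_def_of_ne_zero hz0, Complex.cpow_def_of_ne_zero h10,
    Complex.cpow_def_of_ne_zero hzt, ← Complex.exp_add, hz1,
    Complex.log_mul hz0 h10 ⟨by linarith, by linarith⟩, add_mul]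

/-- After absorbing z^q the integrand is e^{−t} t^p (z+t)^q, which tends to that of Γ(p+q+1). In the
closed right half-plane ‖z + t‖ ≥ t, and this dominates the case Re q < 0. -/
lemma tendsto_cpow_mul_tricomiInt {p q : ℂ} (hp : -1 < p.re) (hpq : -1 < (p + q).re) :
    Tendsto (fun z => z ^ q * tricomiInt p q z) (𝓝[{z | 0 ≤ z.re ∧ z ≠ 0}] 0)
      (𝓝 (Complex.Gamma (p + q + 1))) := by
  obtain ⟨M, hM, hb⟩ := one_add_rpow_le_exp q.re
  have hΓ : Complex.Gamma (p + q + 1) =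
      ∫ t in Ioi (0 : ℝ), Complex.exp (-(t : ℂ)) * (t : ℂ) ^ p * (t : ℂ) ^ q := by
    rw [Complex.Gamma_eq_integral (by simp at hpq ⊢; linarith), Complex.GammaIntegral]
    refine setIntegral_congr_fun measurableSet_Ioi fun t ht => ?_
    have ht0 : (t : ℂ) ≠ 0 := by exact_mod_cast (ne_of_gt ht)
    simp only [add_sub_cancel_right, Complex.cpow_add _ _ ht0]
    push_cast
    ring
  have e : ∀ z ∈ {z : ℂ | 0 ≤ z.re ∧ z ≠ 0}, z ^ q * tricomiInt p q z =
      ∫ t in Ioi (0 : ℝ), Complex.exp (-(t : ℂ)) * (t : ℂ) ^ p * (z + t) ^ q := fun z hz => by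
    rw [tricomiInt, ← integral_const_mul]
    refine setIntegral_congr_fun measurableSet_Ioi fun t ht => ?_
    simp only [← mul_cpow_one_add_div hz.1 hz.2 ht, tricomiKernel]
    ring
  rw [hΓ]
  refine Tendsto.congr' (eventually_nhdsWithin_of_forall fun z hz => (e z hz).symm) ?_
  have i1 : IntegrableOn (fun t : ℝ => Real.exp (-(1 * t)) * t ^ (p + q).re) (Ioi 0) :=
    integrableOn_exp_neg_mul_rpow hpq one_pos
  have i2 := integrableOn_exp_neg_mul_rpow hp (by norm_num : (0:ℝ) < 1/2)
  refine tendsto_integral_filter_of_dominated_convergence _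
    (Eventually.of_forall fun z => by fun_prop)
    ?_ ((i1.add (i2.const_mul M)).const_mul (Real.exp (Real.pi * |q.im|))) ?_
  · have hball : ∀ᶠ z : ℂ in 𝓝[{z | 0 ≤ z.re ∧ z ≠ 0}] 0, ‖z‖ ≤ 1 := by
      refine nhdsWithin_le_nhds ?_
      filter_upwards [Metric.ball_mem_nhds (0 : ℂ) one_pos] with z hz
      simpa using (Metric.mem_ball.1 hz).le
    filter_upwards [hball, self_mem_nhdsWithin] with z hz1 hz2
    refine (ae_restrict_iff' measurableSet_Ioi).2 (Eventually.of_forall fun t ht => ?_)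
    have ht : 0 < t := ht
    have n1 : t ≤ ‖z + t‖ := by
      calc t ≤ (z + t).re := by simpa using hz2.1
        _ ≤ _ := Complex.re_le_norm _
    have n2 : ‖z + t‖ ≤ 1 + t := by
      calc ‖z + t‖ ≤ ‖z‖ + ‖(t : ℂ)‖ := norm_add_le _ _
        _ ≤ _ := by rw [Complex.norm_real, Real.norm_of_nonneg ht.le]; gcongr
    have n3 : ‖z + t‖ ^ q.re ≤ t ^ q.re + M * Real.exp (t / 2) := by
      rcases le_or_gt 0 q.re with hq | hq
      · have : ‖z + t‖ ^ q.re ≤ (1 + t) ^ q.re := by gcongr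
        linarith [hb t ht.le, show 0 ≤ t ^ q.re by positivity]
      · have := Real.rpow_le_rpow_of_nonpos ht n1 hq.le
        linarith [show 0 ≤ M * Real.exp (t / 2) by positivity]
    have n4 : ‖Complex.exp (-(t : ℂ)) * (t : ℂ) ^ p‖ = Real.exp (-t) * t ^ p.re := by
      rw [norm_mul, Complex.norm_cpow_eq_rpow_re_of_pos ht,
        ← Complex.ofReal_neg, ← Complex.ofReal_exp, Complex.norm_real,
        Real.norm_of_nonneg (Real.exp_pos _).le]
    rw [norm_mul, n4]
    calc _ ≤ Real.exp (-t) * t ^ p.re * ((t ^ q.re + M * Real.exp (t / 2)) *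
          Real.exp (Real.pi * |q.im|)) := by
          gcongr
          refine (norm_cpow_le_rpow_mul _ q).trans ?_
          gcongr
      _ = _ := by
        simp only [Pi.add_apply]
        rw [Complex.add_re, Real.rpow_add ht]
        have : Real.exp (-(1 / 2 * t)) = Real.exp (-t) * Real.exp (t / 2) := by
          rw [← Real.exp_add]; ring_nf
        rw [this, one_mul]
        ring
  · refine (ae_restrict_iff' measurableSet_Ioi).2 (Eventually.of_forall fun t ht => ?_)
    refine Tendsto.const_mul _ ?_
    have hc : ContinuousAt (fun z : ℂ => (z + t) ^ q) 0 := by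
      refine ContinuousAt.comp (f := fun z : ℂ => z + t) (g := fun w => w ^ q) ?_ (by fun_prop)
      exact continuousAt_cpow_const (by simpa using ht)
    have := hc.tendsto
    simp only [zero_add] at this
    exact this.mono_left nhdsWithin_le_nhds

/-! ### Propagators of a general mode function -/

/-- Exponential growth of `σ` along `η = -r (1 - iε)` and decay of its reflection. -/
def HasFarPastGrowth (σ : ℂ → ℂ) : Prop :=
  ∀ ε : ℝ, 0 < ε → ∀ r₀ : ℝ, 0 < r₀ → ∃ (B b : ℝ) (p : ℕ), 0 ≤ B ∧ 0 < b ∧ ∀ r : ℝ, r₀ ≤ r →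
    ‖σ (-(r : ℂ) * (1 - Complex.I * ε))‖ ≤ B * r ^ p * Real.exp (b * r) ∧
    ‖σ (-(r : ℂ) * (1 + Complex.I * ε))‖ ≤ B * r ^ p * Real.exp (-(b * r))

lemma norm_neg_mul_le_iff {r₁ r₂ : ℝ} (h₁ : 0 < r₁) (h₂ : 0 < r₂) (ε : ℝ) :
    ‖-(r₁ : ℂ) * (1 - Complex.I * ε)‖ ≤ ‖-(r₂ : ℂ) * (1 - Complex.I * ε)‖ ↔ r₁ ≤ r₂ := by
  have hpos : 0 < ‖1 - Complex.I * (ε : ℂ)‖ := by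
    refine norm_pos_iff.2 fun h => ?_
    have := congrArg Complex.re h
    simp at this
  rw [norm_mul, norm_mul, mul_le_mul_iff_left₀ hpos, norm_neg, norm_neg, Complex.norm_real,
    Complex.norm_real, Real.norm_of_nonneg h₁.le, Real.norm_of_nonneg h₂.le]

/-- In the Feynman part the earlier time sits in σ*, so growth and decay combine to e^{−b|r₁−r₂|};
the homogeneous part decays as e^{−b(r₁+r₂)}, which is smaller. Reflection reverses the tilt of the
contour, so `HasFarPastGrowth` controls σ on both tilts. -/
lemma vanishesInFarPast_connected {σ : ℂ → ℂ} (hσ : HasFarPastGrowth σ) (A : ℂ) :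
    VanishesInFarPast (connected σ A) := by
  intro ε hε r₀ hr₀
  obtain ⟨B, b, p, hB, hb, h⟩ := hσ ε hε r₀ hr₀
  have hconj : ∀ r : ℝ, conj (-(r : ℂ) * (1 - Complex.I * ε)) = -(r : ℂ) * (1 + Complex.I * ε) := by
    intro r
    simp only [map_mul, map_neg, map_sub, map_one, Complex.conj_ofReal, Complex.conj_I]
    ring
  have hc : ∀ r : ℝ, r₀ ≤ r → ‖conjMode σ (-(r : ℂ) * (1 - Complex.I * ε))‖ ≤
      B * r ^ p * Real.exp (-(b * r)) := fun r hr => by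
    rw [conjMode, Complex.norm_conj, hconj]
    exact (h r hr).2
  have hF : ∀ s t : ℝ, r₀ ≤ s → r₀ ≤ t → s ≤ t →
      ‖σ (-(s : ℂ) * (1 - Complex.I * ε)) * conjMode σ (-(t : ℂ) * (1 - Complex.I * ε))‖ ≤
        B ^ 2 * (s * t) ^ p * Real.exp (-(b * |s - t|)) := fun s t hs ht hst => by
    have h1 := (h s hs).1
    have h2 := hc t ht
    have hs0 : 0 < s := hr₀.trans_le hs
    rw [norm_mul]
    calc _ ≤ (B * s ^ p * Real.exp (b * s)) * (B * t ^ p * Real.exp (-(b * t))) := by gcongr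
      _ = B ^ 2 * (s * t) ^ p * (Real.exp (b * s) * Real.exp (-(b * t))) := by ring
      _ = _ := by
        rw [← Real.exp_add, abs_of_nonpos (by linarith)]
        ring_nf
  refine ⟨B ^ 2 + ‖A‖ * B ^ 2, b, p, hb, fun r₁ h₁ r₂ h₂ => ?_⟩
  have hr₁ : 0 < r₁ := hr₀.trans_le h₁
  have hr₂ : 0 < r₂ := hr₀.trans_le h₂
  rw [connected]
  refine (norm_add_le _ _).trans ?_
  rw [add_mul, add_mul]
  refine add_le_add ?_ ?_
  · rw [feynman, neg_mul b]
    split_ifs with hle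
    · exact hF r₁ r₂ h₁ h₂ ((norm_neg_mul_le_iff hr₁ hr₂ ε).1 hle)
    · have hlt : r₂ ≤ r₁ := by
        by_contra hcon
        exact hle ((norm_neg_mul_le_iff hr₁ hr₂ ε).2 (le_of_not_ge hcon))
      have := hF r₂ r₁ h₂ h₁ hlt
      rwa [mul_comm r₂, abs_sub_comm] at this
  · rw [norm_mul, norm_mul]
    have e1 := hc r₁ h₁
    have e2 := hc r₂ h₂
    calc _ ≤ ‖A‖ * ((B * r₁ ^ p * Real.exp (-(b * r₁))) * (B * r₂ ^ p * Real.exp (-(b * r₂)))) := by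
          gcongr
      _ = ‖A‖ * B ^ 2 * (r₁ * r₂) ^ p * (Real.exp (-(b * r₁)) * Real.exp (-(b * r₂))) := by ring
      _ ≤ _ := by
        rw [← Real.exp_add]
        gcongr
        have : |r₁ - r₂| ≤ r₁ + r₂ := abs_le.2 ⟨by linarith, by linarith⟩
        nlinarith

lemma VanishesInFarPast.mul_const {C : ℂ → ℂ → ℂ} (hC : VanishesInFarPast C) (c : ℂ) :
    VanishesInFarPast fun η₁ η₂ => C η₁ η₂ * c := by
  intro ε hε r₀ hr₀
  obtain ⟨B, b, p, hb, h⟩ := hC ε hε r₀ hr₀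
  refine ⟨B * ‖c‖, b, p, hb, fun r₁ h₁ r₂ h₂ => ?_⟩
  rw [norm_mul]
  calc _ ≤ (B * (r₁ * r₂) ^ p * Real.exp (-b * |r₁ - r₂|)) * ‖c‖ := by
        gcongr
        exact h r₁ h₁ r₂ h₂
    _ = _ := by ring

lemma VanishesInFarPast.add {C D : ℂ → ℂ → ℂ} (hC : VanishesInFarPast C)
    (hD : VanishesInFarPast D) : VanishesInFarPast fun η₁ η₂ => C η₁ η₂ + D η₁ η₂ := by
  intro ε hε r₀ hr₀
  obtain ⟨B, b, p, hb, h⟩ := hC ε hε r₀ hr₀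
  obtain ⟨B', b', p', hb', h'⟩ := hD ε hε r₀ hr₀
  -- Since r₁r₂ ≥ r₀², either power may be raised to p + p' at the price of a power of r₀².
  refine ⟨|B| / (r₀ * r₀) ^ p' + |B'| / (r₀ * r₀) ^ p, min b b', p + p', lt_min hb hb',
    fun r₁ h₁ r₂ h₂ => ?_⟩
  have hr₁ : 0 < r₁ := hr₀.trans_le h₁
  have hr₂ : 0 < r₂ := hr₀.trans_le h₂
  have key : ∀ (E a : ℝ) (m n : ℕ), min b b' ≤ a →
      E * (r₁ * r₂) ^ m * Real.exp (-a * |r₁ - r₂|) ≤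
        |E| / (r₀ * r₀) ^ n * (r₁ * r₂) ^ (m + n) * Real.exp (-min b b' * |r₁ - r₂|) := by
    intro E a m n ha
    have h1 : 1 ≤ (r₁ * r₂) ^ n / (r₀ * r₀) ^ n := by
      rw [one_le_div (by positivity)]
      gcongr
    calc E * (r₁ * r₂) ^ m * Real.exp (-a * |r₁ - r₂|)
        ≤ |E| * (r₁ * r₂) ^ m * Real.exp (-min b b' * |r₁ - r₂|) := by
          gcongr
          exact le_abs_self E
      _ ≤ (|E| * (r₁ * r₂) ^ m * Real.exp (-min b b' * |r₁ - r₂|)) *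
            ((r₁ * r₂) ^ n / (r₀ * r₀) ^ n) := le_mul_of_one_le_right (by positivity) h1
      _ = _ := by rw [pow_add]; ring
  have k1 := key B b p p' (min_le_left _ _)
  have k2 := key B' b' p' p (min_le_right _ _)
  rw [add_comm p' p] at k2
  rw [add_mul, add_mul]
  exact (norm_add_le _ _).trans
    (add_le_add ((h r₁ h₁ r₂ h₂).trans k1) ((h' r₁ h₁ r₂ h₂).trans k2))

lemma vanishesInFarPast_sum {ι : Type*} (s : Finset ι) (D : ι → ℂ → ℂ → ℂ) (c : ι → ℂ)
    (h : ∀ i ∈ s, VanishesInFarPast (D i)) :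
    VanishesInFarPast fun η₁ η₂ => ∑ i ∈ s, D i η₁ η₂ * c i := by
  classical
  induction s using Finset.induction_on with
  | empty =>
    intro ε hε r₀ hr₀
    exact ⟨0, 1, 0, one_pos, fun r₁ _ r₂ _ => by simp⟩
  | insert a s ha ih =>
    simp only [Finset.sum_insert ha]
    exact ((h a (by simp)).mul_const _).add (ih fun i hi => h i (by simp [hi]))

/-- The Wick rotation of a connected propagator from the boundary values `s`, `s'` of the mode
function and of its reflection. -/
noncomputable def wickConnected (s s' : ℝ → ℂ) (A : ℂ) (χ₁ χ₂ : ℝ) : ℂ :=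
  if χ₁ ≤ χ₂ then (s χ₁ + A * s' χ₁) * s' χ₂ else (s χ₂ + A * s' χ₂) * s' χ₁

lemma isWickRotation_connected {σ : ℂ → ℂ} {s s' : ℝ → ℂ}
    (hs : ∀ χ : ℝ, 0 < χ → Tendsto (fun ε : ℝ => σ (Complex.I * Complex.exp (Complex.I * ε) * χ))
      (𝓝[>] 0) (𝓝 (s χ)))
    (hs' : ∀ χ : ℝ, 0 < χ →
      Tendsto (fun ε : ℝ => conjMode σ (Complex.I * Complex.exp (Complex.I * ε) * χ))
        (𝓝[>] 0) (𝓝 (s' χ))) (A : ℂ) :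
    IsWickRotation (connected σ A) (wickConnected s s' A) := by
  intro χ₁ χ₂ h₁ h₂
  have hn : ∀ (χ : ℝ), 0 < χ → ∀ ε : ℝ,
      ‖Complex.I * Complex.exp (Complex.I * ε) * χ‖ = χ := fun χ hχ ε => by
    simp [Complex.norm_exp, hχ.le]
  simp only [connected, feynman, hn _ h₁, hn _ h₂, wickConnected]
  split_ifs
  · have := ((hs _ h₁).mul (hs' _ h₂)).add (((hs' _ h₁).mul (hs' _ h₂)).const_mul A)
    convert! this using 2
    ring
  · have := ((hs _ h₂).mul (hs' _ h₁)).add (((hs' _ h₁).mul (hs' _ h₂)).const_mul A)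
    convert! this using 2
    ring

lemma conj_wickConnected {s s' t t' : ℝ → ℂ} {A A' : ℂ}
    (h : ∀ χ₁ χ₂ : ℝ, 0 < χ₁ → 0 < χ₂ →
      conj ((s χ₁ + A * s' χ₁) * s' χ₂) = (t χ₁ + A' * t' χ₁) * t' χ₂)
    {χ₁ χ₂ : ℝ} (h₁ : 0 < χ₁) (h₂ : 0 < χ₂) :
    conj (wickConnected s s' A χ₁ χ₂) = wickConnected t t' A' χ₁ χ₂ := by
  unfold wickConnected
  split_ifs
  exacts [h χ₁ χ₂ h₁ h₂, h χ₂ χ₁ h₂ h₁]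

lemma isWickRotation_sum {ι : Type*} (s : Finset ι) {D : ι → ℂ → ℂ → ℂ} {Dt : ι → ℝ → ℝ → ℂ}
    (c : ι → ℂ) (h : ∀ i ∈ s, IsWickRotation (D i) (Dt i)) :
    IsWickRotation (fun η₁ η₂ => ∑ i ∈ s, D i η₁ η₂ * c i)
      (fun χ₁ χ₂ => ∑ i ∈ s, Dt i χ₁ χ₂ * c i) := fun χ₁ χ₂ h₁ h₂ =>
  tendsto_finsetSum _ fun i hi => (h i hi χ₁ χ₂ h₁ h₂).mul_const _

lemma hasLateLimit_bulkBulk {σ : ℂ → ℂ} {A : ℂ}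
    (h : Tendsto (fun η₀ : ℝ => σ η₀ / conjMode σ η₀) (𝓝[<] 0) (𝓝 (-A))) :
    HasLateLimit (fun η₀ => bulkBulk σ η₀) (connected σ A) := by
  intro η₁ η₂
  have := (h.mul_const (conjMode σ η₁ * conjMode σ η₂)).const_sub (feynman σ η₁ η₂)
  rwa [neg_mul, sub_neg_eq_add] at this

lemma hasLateLimit_factorised {σ : ℂ → ℂ} {A : ℂ}
    (h : Tendsto (fun η₀ : ℝ => σ η₀ / conjMode σ η₀) (𝓝[<] 0) (𝓝 (-A))) :
    HasLateLimit (fun η₀ => factorised σ A η₀) 0 := by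
  intro η₁ η₂
  have := (h.neg.mul_const (conjMode σ η₁ * conjMode σ η₂)).sub_const
    (A * (conjMode σ η₁ * conjMode σ η₂))
  rwa [neg_neg, sub_self] at this

lemma hasLateLimit_sum {ι : Type*} (s : Finset ι) {G : ℝ → ι → ℂ → ℂ → ℂ} {C : ι → ℂ → ℂ → ℂ}
    (c : ι → ℂ) (h : ∀ i ∈ s, HasLateLimit (fun η₀ => G η₀ i) (C i)) :
    HasLateLimit (fun η₀ η₁ η₂ => ∑ i ∈ s, G η₀ i η₁ η₂ * c i)
      (fun η₁ η₂ => ∑ i ∈ s, C i η₁ η₂ * c i) := fun η₁ η₂ =>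
  tendsto_finsetSum _ fun i hi => (h i hi η₁ η₂).mul_const _

/-! ### Polarisation tensors -/

lemma unitVec_neg (k : Vec3) : unitVec (-k) = -unitVec k := by
  simp [unitVec]

/-- The transverse part of n is even in k while k̂ × n and k̂ are odd: reversing k exchanges ê^+
with ê^- and changes the sign of the longitudinal vector. -/
lemma helicityVec_neg (n k : Vec3) (s : ℤ) (i : Fin 3) :
    helicityVec n (-k) s i = (if s = 0 then -1 else 1) * helicityVec n k (-s) i := by
  unfold helicityVec
  by_cases hs : s = 0
  · simp [hs, unitVec_neg]
  · simp [hs, polDirection, unitVec_neg]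

lemma conj_helicityVec (n k : Vec3) (s : ℤ) (i : Fin 3) :
    conj (helicityVec n k s i) = helicityVec n (-k) s i := by
  rw [helicityVec_neg]
  unfold helicityVec
  by_cases hs : s = 0
  · simp [hs]
  · simp [hs, polDirection]

lemma conj_unitPol (n k : Vec3) (S : ℕ) (h : ℤ) (i : Fin S → Fin 3) :
    conj (unitPol n k S h i) = unitPol n (-k) S h i := by
  simp only [unitPol, map_div₀, map_sum, map_prod, conj_helicityVec, Complex.conj_ofReal]

/-- The number 1 − s is odd exactly for longitudinal slots, so the parity of their number is read
off from the total helicity. -/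
lemma prod_ite_zero_eq {S : ℕ} {s : Fin S → ℤ} (hs : ∀ a, s a ∈ ({-1, 0, 1} : Finset ℤ)) :
    (∏ a, (if s a = 0 then -1 else 1 : ℂ)) = (-1) ^ ((S : ℤ) - ∑ a, s a) := by
  have : ∀ a, (if s a = 0 then -1 else 1 : ℂ) = (-1) ^ (1 - s a) := fun a => by
    have := hs a
    simp only [Finset.mem_insert, Finset.mem_singleton] at this
    rcases this with h | h | h <;> simp [h]
  simp only [this]
  have h2 : (S : ℤ) - ∑ a, s a = ∑ a, (1 - s a) := by simp
  rw [h2]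
  clear this hs h2
  induction (Finset.univ : Finset (Fin S)) using Finset.induction_on with
  | empty => simp
  | insert a t ha ih =>
    rw [Finset.prod_insert ha, Finset.sum_insert ha, zpow_add₀ (by norm_num), ih]

lemma unitPol_neg (n k : Vec3) (S : ℕ) {h : ℤ} (hh : |h| ≤ (S : ℤ)) (i : Fin S → Fin 3) :
    unitPol n (-k) S h i = (-1) ^ ((S : ℤ) - h) * unitPol n k S (-h) i := by
  have hc : ((2 * S).choose ((S : ℤ) + h).toNat) = ((2 * S).choose ((S : ℤ) + -h).toNat) := by
    have := abs_le.1 hh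
    rw [← Nat.choose_symm (by omega)]
    congr 1
    omega
  rw [unitPol, unitPol, hc, mul_div_assoc', Finset.mul_sum]
  congr 1
  refine Finset.sum_bij' (fun s _ a => -s a) (fun s _ a => -s a) ?_ ?_ ?_ ?_ ?_
  · intro s hs
    simp only [Finset.mem_filter, Fintype.mem_piFinset, Finset.mem_insert,
      Finset.mem_singleton] at hs ⊢
    refine ⟨fun a => ?_, by simp [hs.2]⟩
    have := hs.1 a
    omega
  · intro s hs
    simp only [Finset.mem_filter, Fintype.mem_piFinset, Finset.mem_insert,
      Finset.mem_singleton] at hs ⊢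
    refine ⟨fun a => ?_, by simp [hs.2]⟩
    have := hs.1 a
    omega
  · intro s _
    simp
  · intro s _
    simp
  · intro s hs
    simp only [Finset.mem_filter, Fintype.mem_piFinset] at hs
    simp only [helicityVec_neg, Finset.prod_mul_distrib, prod_ite_zero_eq hs.1, hs.2]

lemma conj_ccmPol (n k : Vec3) (S : ℕ) (h : ℤ) (i : Fin S → Fin 3) :
    conj (ccmPol n k S h i) = ccmPol n (-k) S h i := by
  simp only [ccmPol, map_mul, map_pow, map_neg, map_one, Complex.conj_ofReal, conj_unitPol]

lemma ccmPol_neg (n k : Vec3) (S : ℕ) {h : ℤ} (hh : |h| ≤ (S : ℤ)) (i : Fin S → Fin 3) :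
    ccmPol n (-k) S h i = (-1) ^ ((S : ℤ) - h) * ccmPol n k S (-h) i := by
  simp only [ccmPol, unitPol_neg n k S hh, Int.natAbs_neg]
  ring

lemma neg_one_zpow_mul_self (m : ℤ) : ((-1 : ℂ) ^ m) * (-1) ^ m = 1 := by
  rw [← mul_zpow]
  simp

/-- Conjugating the prefactor (−i)^{r−|h|} yields the sign (−1)^{r−|h|}, which cancels the sign
(−1)^{r−h} of `unitPol_neg` because h and |h| have the same parity. -/
lemma conj_ccPol (n k : Vec3) (r : ℕ) {h : ℤ} (hh : |h| ≤ (r : ℤ)) (i : Fin r → Fin 3) :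
    conj (ccPol n k r h i) = ccPol n k r (-h) i := by
  have hpow : Complex.I ^ (r - h.natAbs) * (-1) ^ ((r : ℤ) - h) =
      (-Complex.I) ^ (r - h.natAbs) := by
    have e : ((-1 : ℂ) ^ ((r : ℤ) - h)) = (-1) ^ (r - h.natAbs) := by
      rw [← zpow_natCast]
      have h1 : ((r - h.natAbs : ℕ) : ℤ) = r - |h| := by
        have := Int.natCast_natAbs h
        omega
      rw [h1]
      rcases abs_choice h with h2 | h2
      · rw [h2]
      · rw [h2, show (r : ℤ) - -h = (r - h) + 2 * h by ring, zpow_add₀ (by norm_num),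
          zpow_mul]
        simp
    rw [e, ← mul_pow]
    simp
  have hI : conj ((-Complex.I) ^ (r - h.natAbs)) = Complex.I ^ (r - h.natAbs) := by simp
  rw [ccPol, ccPol, map_mul, map_mul, hI, Complex.conj_ofReal, conj_unitPol, unitPol_neg n k r hh,
    Int.natAbs_neg, ← hpow]
  ring

/-! ### Kinematics of the contours -/

lemma tendsto_rotated_neg (x : ℝ) :
    Tendsto (fun ε : ℝ => -((x : ℂ) * Complex.exp (Complex.I * ε))) (𝓝[>] 0) (𝓝 (-x)) := by
  have : Continuous fun ε : ℝ => -((x : ℂ) * Complex.exp (Complex.I * ε)) := by fun_prop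
  have := this.tendsto 0
  simp only [Complex.ofReal_zero, mul_zero, Complex.exp_zero, mul_one] at this
  exact this.mono_left nhdsWithin_le_nhds

lemma two_I_mul_wick (a χ ε : ℝ) :
    2 * Complex.I * a * (Complex.I * Complex.exp (Complex.I * ε) * χ) =
      -(((2 * a * χ : ℝ) : ℂ) * Complex.exp (Complex.I * ε)) := by
  push_cast
  linear_combination 2 * (a : ℂ) * Complex.exp (Complex.I * ε) * χ * Complex.I_sq

lemma tendsto_conj_wick (χ : ℝ) :
    Tendsto (fun ε : ℝ => conj (Complex.I * Complex.exp (Complex.I * ε) * χ)) (𝓝[>] 0)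
      (𝓝 (-Complex.I * χ)) := by
  have : Continuous fun ε : ℝ => conj (Complex.I * Complex.exp (Complex.I * ε) * χ) := by fun_prop
  have := this.tendsto 0
  simp only [Complex.ofReal_zero, mul_zero, Complex.exp_zero, mul_one, map_mul, Complex.conj_I,
    Complex.conj_ofReal] at this
  simpa only [map_mul, Complex.conj_I, Complex.conj_ofReal] using this.mono_left nhdsWithin_le_nhds

lemma tendsto_conj_wick_arg (a χ : ℝ) :
    Tendsto (fun ε : ℝ => 2 * Complex.I * a * conj (Complex.I * Complex.exp (Complex.I * ε) * χ))
      (𝓝[>] 0) (𝓝 ((2 * a * χ : ℝ) : ℂ)) := by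
  have := (tendsto_conj_wick χ).const_mul (2 * Complex.I * a)
  convert! this using 2
  push_cast
  linear_combination 2 * (a : ℂ) * χ * Complex.I_sq

/-- The rotated point lies below the cut, so its argument tends to −π and not to the principal value
π at −x. For this reason powers of z are treated apart from the Laplace integral. -/
lemma tendsto_log_cut {x : ℝ} (hx : 0 < x) :
    Tendsto (fun ε : ℝ => Complex.log (-((x : ℂ) * Complex.exp (Complex.I * ε)))) (𝓝[>] 0)
      (𝓝 (Complex.log x - Real.pi * Complex.I)) := by
  have h := Complex.tendsto_log_nhdsWithin_im_neg_of_re_neg_of_im_zero (z := -(x : ℂ))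
    (by simpa using hx) (by simp)
  rw [norm_neg, Complex.norm_real, Real.norm_of_nonneg hx.le, Complex.ofReal_log hx.le] at h
  refine h.comp (tendsto_nhdsWithin_iff.2 ⟨tendsto_rotated_neg x, ?_⟩)
  filter_upwards [Ioo_mem_nhdsGT Real.pi_pos] with ε hε
  have := Real.sin_pos_of_mem_Ioo hε
  have hi : (-((x : ℂ) * Complex.exp (Complex.I * ε))).im = -(x * Real.sin ε) := by
    rw [Complex.neg_im, Complex.im_ofReal_mul, Complex.exp_im]
    simp
  simp only [hi]
  have := mul_pos hx this
  linarith

lemma tendsto_cpow_cut {x : ℝ} (hx : 0 < x) (w : ℂ) :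
    Tendsto (fun ε : ℝ => (-((x : ℂ) * Complex.exp (Complex.I * ε))) ^ w) (𝓝[>] 0)
      (𝓝 ((x : ℂ) ^ w * Complex.exp (-(Complex.I * Real.pi * w)))) := by
  have hx0 : (x : ℂ) ≠ 0 := by exact_mod_cast hx.ne'
  have h := (Complex.continuous_exp.tendsto _).comp ((tendsto_log_cut hx).mul_const w)
  have e : Complex.exp ((Complex.log x - Real.pi * Complex.I) * w) =
      (x : ℂ) ^ w * Complex.exp (-(Complex.I * Real.pi * w)) := by
    rw [Complex.cpow_def_of_ne_zero hx0, ← Complex.exp_add]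
    ring_nf
  rw [e] at h
  refine h.congr fun ε => ?_
  have : -((x : ℂ) * Complex.exp (Complex.I * ε)) ≠ 0 :=
    neg_ne_zero.2 (mul_ne_zero hx0 (Complex.exp_ne_zero _))
  simp [Complex.cpow_def_of_ne_zero this]

lemma tendsto_late_arg {a : ℝ} (ha : 0 < a) :
    Tendsto (fun y : ℝ => ((a * y : ℝ) : ℂ) * -Complex.I) (𝓝[>] 0)
      (𝓝[{z | 0 ≤ z.re ∧ z ≠ 0}] 0) := by
  refine tendsto_nhdsWithin_iff.2 ⟨?_, ?_⟩
  · have : Continuous fun y : ℝ => ((a * y : ℝ) : ℂ) * -Complex.I := by fun_prop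
    have := this.tendsto 0
    simp only [mul_zero, Complex.ofReal_zero, zero_mul] at this
    exact this.mono_left nhdsWithin_le_nhds
  · filter_upwards [self_mem_nhdsWithin] with y hy
    have hy : 0 < y := hy
    refine ⟨by simp, ?_⟩
    have : ((a * y : ℝ) : ℂ) ≠ 0 := by exact_mod_cast (mul_pos ha hy).ne'
    exact mul_ne_zero this (by simp)

lemma ofReal_mul_neg_I_cpow {x : ℝ} (hx : 0 < x) (w : ℂ) :
    ((x : ℂ) * -Complex.I) ^ w = (x : ℂ) ^ w * Complex.exp (-(Complex.I * (Real.pi / 2) * w)) := by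
  have hx0 : (x : ℂ) ≠ 0 := by exact_mod_cast hx.ne'
  rw [Complex.cpow_def_of_ne_zero (mul_ne_zero hx0 (by simp)), Complex.log_ofReal_mul hx (by simp),
    Complex.log_neg_I, Complex.cpow_def_of_ne_zero hx0, ← Complex.exp_add, Complex.ofReal_log hx.le]
  ring_nf

/-- A real factor, which may vanish or diverge at late times, cancels between σ and σ*; only the
phase of the limiting coefficient survives. -/
lemma tendsto_late_ratio {σ : ℂ → ℂ} {g : ℝ → ℂ} {g₀ : ℂ} (hg : Tendsto g (𝓝[>] 0) (𝓝 g₀))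
    (hg₀ : g₀ ≠ 0) (ρ : ℝ → ℝ) (hρ : ∀ y, 0 < y → ρ y ≠ 0 ∧ σ (-(y : ℂ)) = ρ y * g y) :
    Tendsto (fun η₀ : ℝ => σ η₀ / conjMode σ η₀) (𝓝[<] 0) (𝓝 (g₀ / conj g₀)) := by
  have h1 : Tendsto (fun y => g y / conj (g y)) (𝓝[>] 0) (𝓝 (g₀ / conj g₀)) :=
    hg.div ((Complex.continuous_conj.tendsto _).comp hg) (by simpa using hg₀)
  have h2 : Tendsto (fun η : ℝ => -η) (𝓝[<] 0) (𝓝[>] 0) := by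
    have := tendsto_neg_nhdsLT (a := (0 : ℝ))
    simpa using this
  refine (h1.comp h2).congr' ?_
  filter_upwards [self_mem_nhdsWithin] with η hη
  have hη : η < 0 := hη
  obtain ⟨e1, e2⟩ := hρ (-η) (by linarith)
  have e3 : (ρ (-η) : ℂ) ≠ 0 := by exact_mod_cast e1
  simp only [Complex.ofReal_neg, neg_neg] at e2
  rw [conjMode, Complex.conj_ofReal, e2, map_mul, Complex.conj_ofReal, mul_div_mul_left _ _ e3]
  rfl

/-! ### Whittaker's function on the rays, on the cut and at the origin -/

/-- Whittaker's function without its elementary prefactor `e^{-z/2} z^κ`. -/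
noncomputable def tricomiU (κ μ z : ℂ) : ℂ :=
  tricomiInt (μ - κ - 1 / 2) (μ + κ - 1 / 2) z / Complex.Gamma (1 / 2 + μ - κ)

lemma whittakerW_eq (κ μ z : ℂ) :
    whittakerW κ μ z = Complex.exp (-z / 2) * z ^ κ * tricomiU κ μ z := by
  simp only [whittakerW, tricomiU, tricomiInt, tricomiKernel]
  ring

lemma conj_one_half : conj (1 / 2 : ℂ) = 1 / 2 := by
  rw [map_div₀, map_one, map_ofNat]

lemma conj_tricomiU (κ μ : ℂ) {z : ℂ} (hz : z ∈ Complex.slitPlane) :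
    conj (tricomiU κ μ z) = tricomiU (conj κ) (conj μ) (conj z) := by
  have h2 := conj_one_half
  rw [tricomiU, tricomiU, map_div₀, conj_tricomiInt _ _ hz, ← Complex.Gamma_conj]
  simp only [map_sub, map_add, h2]

/-- The index is real or imaginary, with nonnegative real part. -/
def RealOrImaginary (ν : ℂ) : Prop := (0 ≤ ν.re ∧ conj ν = ν) ∨ (ν.re = 0 ∧ conj ν = -ν)

lemma RealOrImaginary.re_nonneg {ν : ℂ} (h : RealOrImaginary ν) : 0 ≤ ν.re := by
  rcases h with h | h
  exacts [h.1, h.1.ge]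

/-- This is the exchange symmetry with α = μ−κ−1/2 and β = −μ−κ−1/2. Both have real part −1/2, so
the symmetry holds on the cut too. -/
lemma tricomiU_neg_index {κ μ : ℂ} (hκ : κ.re = 0) (hμ : μ.re = 0) {z : ℂ}
    (hz : z ∈ Complex.slitPlane ∨ ∃ x : ℝ, 0 < x ∧ z = -x) :
    tricomiU κ (-μ) z = tricomiU κ μ z := by
  have hα : (μ - κ - 1 / 2).re = -(1 / 2) := by
    rw [Complex.sub_re, Complex.sub_re, hκ, hμ]; norm_num
  have hβ : (-μ - κ - 1 / 2).re = -(1 / 2) := by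
    rw [Complex.sub_re, Complex.sub_re, Complex.neg_re, hκ, hμ]; norm_num
  have key : Complex.Gamma (-μ - κ - 1 / 2 + 1) *
        tricomiInt (μ - κ - 1 / 2) (-(-μ - κ - 1 / 2) - 1) z =
      Complex.Gamma (μ - κ - 1 / 2 + 1) *
        tricomiInt (-μ - κ - 1 / 2) (-(μ - κ - 1 / 2) - 1) z := by
    rcases hz with hz | ⟨x, hx, rfl⟩
    · exact tricomiInt_symm (by rw [hα]; norm_num) (by rw [hβ]; norm_num) hz
    · exact tricomiInt_symm_neg (by rw [hα]; norm_num) (by rw [hβ]; norm_num)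
        (by rw [hα]; norm_num) (by rw [hβ]; norm_num) hx
  rw [show -(-μ - κ - 1 / 2) - 1 = μ + κ - 1 / 2 by ring,
    show -(μ - κ - 1 / 2) - 1 = -μ + κ - 1 / 2 by ring,
    show -μ - κ - 1 / 2 + 1 = 1 / 2 + -μ - κ by ring,
    show μ - κ - 1 / 2 + 1 = 1 / 2 + μ - κ by ring] at key
  have g1 : Complex.Gamma (1 / 2 + -μ - κ) ≠ 0 := Complex.Gamma_ne_zero_of_re_pos (by
    simp [hκ, hμ])
  have g2 : Complex.Gamma (1 / 2 + μ - κ) ≠ 0 := Complex.Gamma_ne_zero_of_re_pos (by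
    simp [hκ, hμ])
  rw [tricomiU, tricomiU, div_eq_div_iff g1 g2]
  linear_combination -key

lemma tricomiU_conj_index {κ ν : ℂ} (hκ : κ.re = 0) (hν : RealOrImaginary ν) {z : ℂ}
    (hz : z ∈ Complex.slitPlane ∨ ∃ x : ℝ, 0 < x ∧ z = -x) :
    tricomiU κ (conj ν) z = tricomiU κ ν z := by
  rcases hν with ⟨_, h⟩ | ⟨h0, h⟩
  · rw [h]
  · rw [h, tricomiU_neg_index hκ h0 hz]

lemma conj_eq_neg_of_re {κ : ℂ} (hκ : κ.re = 0) : conj κ = -κ :=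
  Complex.ext (by simp [hκ]) (by simp)

/-- The discontinuity of `tricomiU` across the cut. -/
lemma conj_tricomiU_neg {κ ν : ℂ} (hκ : κ.re = 0) (hν : RealOrImaginary ν) {x : ℝ} (hx : 0 < x) :
    conj (tricomiU κ ν (-x)) = tricomiU (-κ) ν (-x) +
      (Complex.exp (-(Complex.I * Real.pi * (conj ν - κ - 1 / 2))) -
          Complex.exp (Complex.I * Real.pi * (conj ν - κ - 1 / 2))) *
        (Complex.Gamma (1 / 2 + conj ν - κ) / Complex.Gamma (1 / 2 + conj ν + κ)) *
        ((x : ℂ) ^ (2 * κ) * Complex.exp (-x) * tricomiU κ ν x) := by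
  have hν0 := hν.re_nonneg
  have h2 := conj_one_half
  have hκc := conj_eq_neg_of_re hκ
  have e1 : conj (ν - κ - 1 / 2) = conj ν - -κ - 1 / 2 := by rw [map_sub, map_sub, h2, hκc]
  have e2 : conj (ν + κ - 1 / 2) = conj ν + -κ - 1 / 2 := by rw [map_sub, map_add, h2, hκc]
  have g1 : Complex.Gamma (1 / 2 + conj ν - κ) ≠ 0 := Complex.Gamma_ne_zero_of_re_pos (by
    simp [hκ]; linarith)
  -- Conjugation sends κ to −κ and the exchange of exponents in the tail integral sends it back to
  -- κ; the Gamma quotient accounts for the different normalisation.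
  rw [← tricomiU_conj_index (κ := -κ) (by simpa using hκ) hν (Or.inr ⟨x, hx, rfl⟩),
    ← tricomiU_conj_index hκ hν (Or.inl (Complex.ofReal_mem_slitPlane.2 hx)),
    tricomiU, map_div₀, conj_tricomiInt_neg (by simp [hκ]; linarith) (by simp [hκ]; linarith) hx,
    ← Complex.Gamma_conj, e1, e2, tricomiU, tricomiU,
    show conj (1 / 2 + ν - κ) = 1 / 2 + conj ν + κ by rw [map_sub, map_add, h2, hκc]; ring,
    show conj ν - -κ - 1 / 2 - (conj ν + -κ - 1 / 2) = 2 * κ by ring,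
    show conj ν + -κ - 1 / 2 = conj ν - κ - 1 / 2 by ring,
    show conj ν - -κ - 1 / 2 = conj ν + κ - 1 / 2 by ring,
    show 1 / 2 + conj ν - -κ = 1 / 2 + conj ν + κ by ring]
  generalize Complex.Gamma (1 / 2 + conj ν - κ) = G at g1 ⊢
  field_simp

lemma tendsto_tricomiU_neg {κ ν : ℂ} (hκ : κ.re = 0) (hν : 0 ≤ ν.re) {x : ℝ} (hx : 0 < x) :
    Tendsto (fun ε : ℝ => tricomiU κ ν (-(x * Complex.exp (Complex.I * ε)))) (𝓝[>] 0)
      (𝓝 (tricomiU κ ν (-x))) :=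
  (tendsto_tricomiInt_neg (by simp [hκ]; linarith) (by simp [hκ]; linarith) hx).div_const _

lemma continuousAt_tricomiU {κ ν : ℂ} (hκ : κ.re = 0) (hν : 0 ≤ ν.re) {z : ℂ}
    (hz : z ∈ Complex.slitPlane) : ContinuousAt (tricomiU κ ν) z :=
  (hasDerivAt_tricomiInt (by simp [hκ]; linarith) _ hz).continuousAt.div_const _

lemma exists_norm_exp_mul_le {f : ℂ → ℂ} {u : ℂ} {r₀ : ℝ}
    (hf : ∃ B : ℝ, ∀ r : ℝ, r₀ ≤ r → ‖f (r * u)‖ ≤ B) :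
    ∃ B : ℝ, 0 ≤ B ∧ ∀ r : ℝ, r₀ ≤ r →
      ‖Complex.exp (-(r * u) / 2) * f (r * u)‖ ≤ B * Real.exp (-(r * u.re / 2)) := by
  obtain ⟨B, hB⟩ := hf
  refine ⟨B, (norm_nonneg _).trans (hB r₀ le_rfl), fun r hr => ?_⟩
  have : ((-((r : ℂ) * u)) / 2).re = -(r * u.re / 2) := by
    rw [show -((r : ℂ) * u) / 2 = ((-(r / 2) : ℝ) : ℂ) * u by push_cast; ring,
      Complex.re_ofReal_mul]
    ring
  rw [norm_mul, Complex.norm_exp, this, mul_comm]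
  gcongr
  exact hB r hr

/-- For imaginary κ the factor z^κ is bounded, so the growth is that of e^{−z/2}. -/
lemma exists_norm_whittakerW_ray_le {κ ν : ℂ} (hκ : κ.re = 0) (hν : 0 ≤ ν.re) {u : ℂ}
    (hu : u.im ≠ 0) {r₀ : ℝ} (hr₀ : 0 < r₀) :
    ∃ B : ℝ, 0 ≤ B ∧ ∀ r : ℝ, r₀ ≤ r →
      ‖whittakerW κ ν (r * u)‖ ≤ B * Real.exp (-(r * u.re / 2)) := by
  have h : ∃ B : ℝ, ∀ r : ℝ, r₀ ≤ r → ‖(fun z => z ^ κ * tricomiU κ ν z) (r * u)‖ ≤ B := by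
    obtain ⟨B, hB⟩ := exists_norm_tricomiInt_ray_le (p := ν - κ - 1 / 2) (by simp [hκ]; linarith)
      (ν + κ - 1 / 2) hu hr₀
    refine ⟨Real.exp (Real.pi * |κ.im|) * (B / ‖Complex.Gamma (1 / 2 + ν - κ)‖), fun r hr => ?_⟩
    simp only [norm_mul, tricomiU, norm_div]
    gcongr
    · have := norm_cpow_le_rpow_mul (r * u) κ
      rwa [hκ, Real.rpow_zero, one_mul] at this
    · exact hB r hr
  obtain ⟨B, hB, hb⟩ := exists_norm_exp_mul_le (f := fun z => z ^ κ * tricomiU κ ν z) h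
  refine ⟨B, hB, fun r hr => ?_⟩
  rw [whittakerW_eq, mul_assoc]
  exact hb r hr

/-! ### Whittaker mode functions -/

lemma two_I_mul_neg_mul_one_sub (a r ε : ℝ) :
    2 * Complex.I * a * (-(r : ℂ) * (1 - Complex.I * ε)) =
      r * (((-(2 * a * ε) : ℝ) : ℂ) + ((-(2 * a) : ℝ) : ℂ) * Complex.I) := by
  push_cast
  linear_combination 2 * (a : ℂ) * r * ε * Complex.I_sq

lemma two_I_mul_neg_mul_one_add (a r ε : ℝ) :
    2 * Complex.I * a * (-(r : ℂ) * (1 + Complex.I * ε)) =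
      r * (((2 * a * ε : ℝ) : ℂ) + ((-(2 * a) : ℝ) : ℂ) * Complex.I) := by
  push_cast
  linear_combination -2 * (a : ℂ) * r * ε * Complex.I_sq

/-- The mode function `N η W_{κ,ν}(2iaη)`. -/
noncomputable def whittakerMode (N a : ℝ) (κ ν η : ℂ) : ℂ :=
  N * η * whittakerW κ ν (2 * Complex.I * a * η)

section WhittakerMode

variable {N a : ℝ} {κ ν : ℂ}

lemma hasFarPastGrowth_whittakerMode (N : ℝ) (ha : 0 < a) (hκ : κ.re = 0) (hν : 0 ≤ ν.re) :
    HasFarPastGrowth (whittakerMode N a κ ν) := by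
  intro ε hε r₀ hr₀
  have him : ∀ s : ℝ, ((s : ℂ) + ((-(2 * a) : ℝ) : ℂ) * Complex.I).im ≠ 0 := fun s => by
    simp [ha.ne']
  have hre : ∀ s : ℝ, ((s : ℂ) + ((-(2 * a) : ℝ) : ℂ) * Complex.I).re = s := fun s => by simp
  obtain ⟨B₁, hB₁, h₁⟩ := exists_norm_whittakerW_ray_le hκ hν (him (-(2 * a * ε))) hr₀
  obtain ⟨B₂, hB₂, h₂⟩ := exists_norm_whittakerW_ray_le hκ hν (him (2 * a * ε)) hr₀
  refine ⟨|N| * (‖1 - Complex.I * ε‖ * B₁ + ‖1 + Complex.I * ε‖ * B₂), a * ε, 1, by positivity,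
    by positivity, fun r hr => ?_⟩
  have hr0 : 0 < r := hr₀.trans_le hr
  have e₁ := h₁ r hr
  have e₂ := h₂ r hr
  rw [hre] at e₁ e₂
  constructor
  · rw [whittakerMode, two_I_mul_neg_mul_one_sub, norm_mul, norm_mul, norm_mul, norm_neg,
      Complex.norm_real, Complex.norm_real, Real.norm_eq_abs, Real.norm_of_nonneg hr0.le]
    calc _ ≤ |N| * (r * ‖1 - Complex.I * ε‖) * (B₁ * Real.exp (-(r * -(2 * a * ε) / 2))) := by
          gcongr
      _ = |N| * (‖1 - Complex.I * ε‖ * B₁) * r ^ 1 * Real.exp (a * ε * r) := by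
          rw [show -(r * -(2 * a * ε) / 2) = a * ε * r by ring]; ring
      _ ≤ _ := by
          gcongr
          linarith [show 0 ≤ ‖1 + Complex.I * ε‖ * B₂ by positivity]
  · rw [whittakerMode, two_I_mul_neg_mul_one_add, norm_mul, norm_mul, norm_mul, norm_neg,
      Complex.norm_real, Complex.norm_real, Real.norm_eq_abs, Real.norm_of_nonneg hr0.le]
    calc _ ≤ |N| * (r * ‖1 + Complex.I * ε‖) * (B₂ * Real.exp (-(r * (2 * a * ε) / 2))) := by
          gcongr
      _ = |N| * (‖1 + Complex.I * ε‖ * B₂) * r ^ 1 * Real.exp (-(a * ε * r)) := by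
          rw [show -(r * (2 * a * ε) / 2) = -(a * ε * r) by ring]; ring
      _ ≤ _ := by
          gcongr
          linarith [show 0 ≤ ‖1 - Complex.I * ε‖ * B₁ by positivity]

/-- Boundary value of `whittakerMode` at `η = iχ`. -/
noncomputable def whittakerWick (N a : ℝ) (κ ν : ℂ) (χ : ℝ) : ℂ :=
  N * Complex.I * χ * (Complex.exp ((a * χ : ℝ) : ℂ) * (((2 * a * χ : ℝ) : ℂ) ^ κ *
    Complex.exp (-(Complex.I * Real.pi * κ))) * tricomiU κ ν (-((2 * a * χ : ℝ) : ℂ)))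

/-- Boundary value of the reflected `whittakerMode` at `η = iχ`. -/
noncomputable def whittakerWickConj (N a : ℝ) (κ ν : ℂ) (χ : ℝ) : ℂ :=
  N * Complex.I * χ * (Complex.exp (-((a * χ : ℝ) : ℂ)) * ((2 * a * χ : ℝ) : ℂ) ^ (-κ) *
    tricomiU (-κ) ν ((2 * a * χ : ℝ) : ℂ))

lemma tendsto_whittakerMode_wick (N : ℝ) (ha : 0 < a) (hκ : κ.re = 0) (hν : 0 ≤ ν.re) {χ : ℝ}
    (hχ : 0 < χ) :
    Tendsto (fun ε : ℝ => whittakerMode N a κ ν (Complex.I * Complex.exp (Complex.I * ε) * χ))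
      (𝓝[>] 0) (𝓝 (whittakerWick N a κ ν χ)) := by
  have hx : 0 < 2 * a * χ := by positivity
  simp only [whittakerMode, two_I_mul_wick, whittakerW_eq]
  unfold whittakerWick
  refine Tendsto.mul ?_ (((?_ : Tendsto _ _ _).mul (tendsto_cpow_cut hx κ)).mul
    (tendsto_tricomiU_neg hκ hν hx))
  · have : Continuous fun ε : ℝ => (N : ℂ) * (Complex.I * Complex.exp (Complex.I * ε) * χ) := by
      fun_prop
    have := this.tendsto 0
    simp only [Complex.ofReal_zero, mul_zero, Complex.exp_zero, mul_one, ← mul_assoc] at this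
    refine (this.mono_left nhdsWithin_le_nhds).congr fun ε => ?_
    ring
  · have := (Complex.continuous_exp.tendsto _).comp
      (((tendsto_rotated_neg (2 * a * χ)).neg).div_const 2)
    convert! this using 2
    push_cast
    ring_nf

lemma tendsto_conjMode_whittakerMode_wick (N : ℝ) (ha : 0 < a) (hκ : κ.re = 0)
    (hν : RealOrImaginary ν) {χ : ℝ} (hχ : 0 < χ) :
    Tendsto (fun ε : ℝ =>
        conjMode (whittakerMode N a κ ν) (Complex.I * Complex.exp (Complex.I * ε) * χ))
      (𝓝[>] 0) (𝓝 (whittakerWickConj N a κ ν χ)) := by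
  have hx : 0 < 2 * a * χ := by positivity
  have hxs := Complex.ofReal_mem_slitPlane.2 hx
  have hκ' : (-κ).re = 0 := by simpa using hκ
  have hval : whittakerWickConj N a κ ν χ = conj ((N : ℂ) * (-Complex.I * χ) *
      (Complex.exp (-((2 * a * χ : ℝ) : ℂ) / 2) * ((2 * a * χ : ℝ) : ℂ) ^ κ *
        tricomiU κ ν ((2 * a * χ : ℝ) : ℂ))) := by
    rw [whittakerWickConj, map_mul, map_mul, map_mul, map_mul, map_mul, conj_ofReal_cpow hx,
      conj_tricomiU _ _ hxs, conj_eq_neg_of_re hκ, Complex.conj_ofReal, Complex.conj_ofReal,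
      Complex.conj_ofReal, tricomiU_conj_index hκ' hν (Or.inl hxs), ← Complex.exp_conj,
      map_div₀, map_neg, map_neg, Complex.conj_ofReal, Complex.conj_I, neg_neg, map_ofNat]
    push_cast
    ring_nf
  rw [hval]
  simp only [conjMode]
  refine (Complex.continuous_conj.tendsto _).comp ?_
  simp only [whittakerMode, whittakerW_eq]
  have harg := tendsto_conj_wick_arg a χ
  refine ((tendsto_conj_wick χ).const_mul _).mul ((Tendsto.mul ?_ ?_).mul ?_)
  · exact (Complex.continuous_exp.tendsto _).comp (harg.neg.div_const 2)
  · exact (continuousAt_cpow_const hxs).tendsto.comp harg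
  · exact (continuousAt_tricomiU hκ hν.re_nonneg hxs).tendsto.comp harg

/-- Complex conjugation of the Wick rotation turns `(N, κ, A)` into `(N', -κ, A')`. -/
lemma conj_wickConnected_whittaker (ha : 0 < a) (hκ : κ.re = 0) (hν : RealOrImaginary ν) {N' : ℝ}
    {A A' : ℂ} (hN : (N' : ℂ) ^ 2 = N ^ 2 * Complex.exp (-(Complex.I * Real.pi * κ)) ^ 2)
    (hA : A' * Complex.exp (-(Complex.I * Real.pi * κ)) =
      conj A * Complex.exp (Complex.I * Real.pi * κ) +
      (Complex.exp (-(Complex.I * Real.pi * (conj ν - κ - 1 / 2))) -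
          Complex.exp (Complex.I * Real.pi * (conj ν - κ - 1 / 2))) *
        (Complex.Gamma (1 / 2 + conj ν - κ) / Complex.Gamma (1 / 2 + conj ν + κ)))
    {χ₁ χ₂ : ℝ} (h₁ : 0 < χ₁) (h₂ : 0 < χ₂) :
    conj ((whittakerWick N a κ ν χ₁ + A * whittakerWickConj N a κ ν χ₁) *
        whittakerWickConj N a κ ν χ₂) =
      (whittakerWick N' a (-κ) ν χ₁ + A' * whittakerWickConj N' a (-κ) ν χ₁) *
        whittakerWickConj N' a (-κ) ν χ₂ := by
  have hx₁ : 0 < 2 * a * χ₁ := by positivity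
  have hx₂ : 0 < 2 * a * χ₂ := by positivity
  have hκ' : (-κ).re = 0 := by simpa using hκ
  have hκc := conj_eq_neg_of_re hκ
  have hs : ∀ {x : ℝ}, 0 < x → conj (tricomiU (-κ) ν x) = tricomiU κ ν x := fun {x} hx => by
    rw [conj_tricomiU _ _ (Complex.ofReal_mem_slitPlane.2 hx), map_neg, hκc, neg_neg,
      Complex.conj_ofReal, tricomiU_conj_index hκ hν (Or.inl (Complex.ofReal_mem_slitPlane.2 hx))]
  have hconjC : ∀ {χ : ℝ}, 0 < 2 * a * χ → conj (whittakerWickConj N a κ ν χ) =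
      -(N * Complex.I * χ * (Complex.exp (-((a * χ : ℝ) : ℂ)) * ((2 * a * χ : ℝ) : ℂ) ^ κ *
        tricomiU κ ν ((2 * a * χ : ℝ) : ℂ))) := fun {χ} hx => by
    simp only [whittakerWickConj, map_mul, Complex.conj_ofReal, Complex.conj_I, ← Complex.exp_conj,
      map_neg, conj_ofReal_cpow hx, hs hx, hκc, neg_neg]
    ring
  have hC' : ∀ {χ : ℝ}, whittakerWickConj N' a (-κ) ν χ =
      N' * Complex.I * χ * (Complex.exp (-((a * χ : ℝ) : ℂ)) * ((2 * a * χ : ℝ) : ℂ) ^ κ *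
        tricomiU κ ν ((2 * a * χ : ℝ) : ℂ)) := fun {χ} => by
    simp only [whittakerWickConj, neg_neg]
  have hE : Complex.exp (Complex.I * Real.pi * κ) *
      Complex.exp (-(Complex.I * Real.pi * κ)) = 1 := by
    rw [← Complex.exp_add]; simp
  have hpow : ((2 * a * χ₁ : ℝ) : ℂ) ^ (-κ) * ((2 * a * χ₁ : ℝ) : ℂ) ^ (2 * κ) =
      ((2 * a * χ₁ : ℝ) : ℂ) ^ κ := by
    rw [← Complex.cpow_add _ _ (by exact_mod_cast hx₁.ne')]
    ring_nf
  have hexp : Complex.exp ((a * χ₁ : ℝ) : ℂ) * Complex.exp (-((2 * a * χ₁ : ℝ) : ℂ)) =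
      Complex.exp (-((a * χ₁ : ℝ) : ℂ)) := by
    rw [← Complex.exp_add]
    congr 1
    push_cast
    ring
  rw [map_mul, map_add, map_mul, hconjC hx₁, hconjC hx₂, hC', hC']
  simp only [whittakerWick, map_mul, Complex.conj_ofReal, Complex.conj_I, ← Complex.exp_conj,
    map_neg, conj_ofReal_cpow hx₁, hκc, conj_tricomiU_neg hκ hν hx₁, mul_neg, neg_mul, neg_neg]
  set J := (Complex.exp (-(Complex.I * Real.pi * (conj ν - κ - 1 / 2))) -
          Complex.exp (Complex.I * Real.pi * (conj ν - κ - 1 / 2))) *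
        (Complex.Gamma (1 / 2 + conj ν - κ) / Complex.Gamma (1 / 2 + conj ν + κ)) with hJ
  rw [← hpow] at *
  set P := Complex.exp (Complex.I * Real.pi * κ)
  set P' := Complex.exp (-(Complex.I * Real.pi * κ))
  set X := ((2 * a * χ₁ : ℝ) : ℂ) ^ (-κ)
  set Y := ((2 * a * χ₁ : ℝ) : ℂ) ^ (2 * κ)
  rw [← hexp]
  set E₁ := Complex.exp ((a * χ₁ : ℝ) : ℂ)
  set E₂ := Complex.exp (-((2 * a * χ₁ : ℝ) : ℂ))
  set U₁ := tricomiU κ ν ((2 * a * χ₁ : ℝ) : ℂ)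
  set U₂ := tricomiU (-κ) ν (-((2 * a * χ₁ : ℝ) : ℂ))
  set R := Complex.exp (-((a * χ₂ : ℝ) : ℂ)) * ((2 * a * χ₂ : ℝ) : ℂ) ^ κ *
        tricomiU κ ν ((2 * a * χ₂ : ℝ) : ℂ)
  -- `hN` matches the normalisations of the two helicities, `hE` cancels the phases e^{±iπκ}, and
  -- `hA` equates the coefficients of the product of decaying solutions.
  linear_combination
    (-(Complex.I ^ 2 * χ₁ * χ₂ * R * E₁ * X) * (P * U₂ + A' * E₂ * Y * U₁)) * hN -
    (N ^ 2 * Complex.I ^ 2 * χ₁ * χ₂ * R * E₁ * X) * (P' * U₂ + E₂ * Y * U₁ * conj A) * hE -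
    (N ^ 2 * Complex.I ^ 2 * χ₁ * χ₂ * R * E₁ * X) * (E₂ * Y * U₁ * P') * hA

/-- At late times σ is a real factor times a phase times Γ(2ν)/Γ(1/2+ν−κ). Dividing by the conjugate
squares the phase and leaves a quotient of Gamma values, since Γ(2ν) is real. -/
lemma tendsto_whittakerMode_late (hN : N ≠ 0) (ha : 0 < a) (hκ : κ.re = 0) (hν : 0 < ν.re)
    (hνr : conj ν = ν) :
    Tendsto (fun η₀ : ℝ => whittakerMode N a κ ν η₀ / conjMode (whittakerMode N a κ ν) η₀)
      (𝓝[<] 0) (𝓝 (-(Complex.exp (Complex.I * Real.pi * (ν + 1 / 2)) *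
        Complex.Gamma (1 / 2 + ν + κ) / Complex.Gamma (1 / 2 + ν - κ)))) := by
  have g1 : Complex.Gamma (1 / 2 + ν - κ) ≠ 0 := Complex.Gamma_ne_zero_of_re_pos (by
    simp [hκ]; linarith)
  have g3 : Complex.Gamma (2 * ν) ≠ 0 := Complex.Gamma_ne_zero_of_re_pos (by
    simp; linarith)
  have h2a : 0 < 2 * a := by positivity
  have hνo : ((ν.re : ℝ) : ℂ) = ν := Complex.conj_eq_iff_re.1 hνr
  have hlim := (tendsto_cpow_mul_tricomiInt (p := ν - κ - 1 / 2) (q := ν + κ - 1 / 2)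
    (by simp [hκ]; linarith) (by simp [hκ]; linarith)).comp (tendsto_late_arg h2a)
  rw [show ν - κ - 1 / 2 + (ν + κ - 1 / 2) + 1 = 2 * ν by ring] at hlim
  have hexp : Tendsto (fun y : ℝ => Complex.exp (-(((2 * a * y : ℝ) : ℂ) * -Complex.I) / 2))
      (𝓝[>] 0) (𝓝 1) := by
    have : Continuous fun y : ℝ => Complex.exp (-(((2 * a * y : ℝ) : ℂ) * -Complex.I) / 2) := by
      fun_prop
    have := this.tendsto 0
    simp only [mul_zero, Complex.ofReal_zero, zero_mul, neg_zero, zero_div,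
      Complex.exp_zero] at this
    exact this.mono_left nhdsWithin_le_nhds
  have hg := (hexp.mul hlim).const_mul
    (Complex.exp (-(Complex.I * (Real.pi / 2) * (1 / 2 - ν))) / Complex.Gamma (1 / 2 + ν - κ))
  have key := tendsto_late_ratio hg (σ := whittakerMode N a κ ν)
    (by
      rw [one_mul]
      exact mul_ne_zero (div_ne_zero (Complex.exp_ne_zero _) g1) g3)
    (fun y => -N * y * (2 * a * y) ^ (1 / 2 - ν.re)) (fun y hy => ?_)
  · convert! key using 2
    rw [one_mul, map_mul, map_div₀, ← Complex.Gamma_conj, ← Complex.Gamma_conj, ← Complex.exp_conj]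
    simp only [map_mul, map_neg, map_sub, map_add, hνr, conj_eq_neg_of_re hκ,
      Complex.conj_I, map_div₀, map_one, map_ofNat, Complex.conj_ofReal]
    have e : Complex.exp (Complex.I * Real.pi * (ν + 1 / 2)) =
        -(Complex.exp (-(Complex.I * (Real.pi / 2) * (1 / 2 - ν))) *
          Complex.exp (-(Complex.I * (Real.pi / 2) * (1 / 2 - ν)))) := by
      rw [← Complex.exp_add, ← neg_one_mul, ← Complex.exp_pi_mul_I, ← Complex.exp_add]
      ring_nf
    have e' : Complex.exp (-(-Complex.I * (Real.pi / 2) * (1 / 2 - ν))) =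
        (Complex.exp (-(Complex.I * (Real.pi / 2) * (1 / 2 - ν))))⁻¹ := by
      rw [← Complex.exp_neg]
      ring_nf
    rw [e, e', sub_neg_eq_add]
    have := Complex.exp_ne_zero (-(Complex.I * (Real.pi / 2) * (1 / 2 - ν)))
    generalize Complex.Gamma (1 / 2 + ν + κ) = G₁ at *
    generalize Complex.Gamma (1 / 2 + ν - κ) = G₂ at *
    generalize Complex.exp (-(Complex.I * (Real.pi / 2) * (1 / 2 - ν))) = E at *
    field_simp
  · have hy2 : 0 < 2 * a * y := by positivity
    refine ⟨by simp [hN, hy.ne', (Real.rpow_pos_of_pos hy2 _).ne'], ?_⟩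
    have hz0 : ((2 * a * y : ℝ) : ℂ) * -Complex.I ≠ 0 :=
      mul_ne_zero (by exact_mod_cast hy2.ne') (by simp)
    have earg : 2 * Complex.I * a * (-(y : ℂ)) = ((2 * a * y : ℝ) : ℂ) * -Complex.I := by
      push_cast; ring
    -- Isolates the power that makes the Laplace integral converge at the origin; what remains is a
    -- positive real power and a constant phase.
    have epow : (((2 * a * y : ℝ) : ℂ) * -Complex.I) ^ κ =
        (((2 * a * y) ^ (1 / 2 - ν.re) : ℝ) : ℂ) *
          Complex.exp (-(Complex.I * (Real.pi / 2) * (1 / 2 - ν))) *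
          (((2 * a * y : ℝ) : ℂ) * -Complex.I) ^ (ν + κ - 1 / 2) := by
      rw [Complex.ofReal_cpow hy2.le]
      push_cast [hνo]
      have := ofReal_mul_neg_I_cpow hy2 (1 / 2 - ν)
      push_cast at this hz0
      rw [← this, ← Complex.cpow_add _ _ hz0]
      ring_nf
    rw [whittakerMode, earg, whittakerW_eq, tricomiU, epow]
    simp only [Function.comp_apply]
    push_cast
    ring

end WhittakerMode

/-! ### The principal square root of a real number as a real or imaginary index. -/

lemma ofReal_cpow_half {x : ℝ} (hx : 0 ≤ x) : ((x : ℝ) : ℂ) ^ (1 / 2 : ℂ) = (Real.sqrt x : ℝ) := by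
  rw [Real.sqrt_eq_rpow, Complex.ofReal_cpow hx]
  norm_num

lemma ofReal_cpow_half_of_nonpos {x : ℝ} (hx : x ≤ 0) :
    ((x : ℝ) : ℂ) ^ (1 / 2 : ℂ) = Complex.I * (Real.sqrt (-x) : ℝ) := by
  rcases hx.eq_or_lt with rfl | hx
  · simp
  · have h := neg_ofReal_cpow (s := -x) (by linarith) (1 / 2)
    rw [ofReal_cpow_half (by linarith)] at h
    rw [← Complex.ofReal_neg, neg_neg] at h
    rw [h, show Complex.I * Real.pi * (1 / 2) = Real.pi / 2 * Complex.I by ring,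
      Complex.exp_pi_div_two_mul_I, mul_comm]

lemma realOrImaginary_I_mul (μ : ℝ) : RealOrImaginary (Complex.I * μ) :=
  Or.inr ⟨by simp, by simp⟩

lemma realOrImaginary_ofReal {x : ℝ} (hx : 0 ≤ x) : RealOrImaginary (x : ℂ) :=
  Or.inl ⟨by simpa using hx, by simp⟩

/-! ### Condensed-matter fields: the coefficients, reality and late-time limits. -/

namespace CCMField

variable (p : CCMField) {k : ℝ} (h : ℤ)

lemma nu_of_isHeavy {p : CCMField} (hH : 0 < p.hubble) (hp : p.IsHeavy) :
    p.nu = Complex.I * p.mu := by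
  have : 9 / 4 - p.mass ^ 2 / p.hubble ^ 2 ≤ 0 := by
    rw [sub_nonpos, le_div_iff₀ (by positivity)]
    exact hp
  rw [nu, ofReal_cpow_half_of_nonpos this, mu, neg_sub]

lemma nu_of_isLight {p : CCMField} (hH : 0 < p.hubble) (hp : p.IsLight) :
    ∃ x : ℝ, 0 < x ∧ p.nu = x := by
  have : 0 < 9 / 4 - p.mass ^ 2 / p.hubble ^ 2 := by
    rw [sub_pos, div_lt_iff₀ (by positivity)]
    exact hp
  exact ⟨_, Real.sqrt_pos.2 this, ofReal_cpow_half this.le⟩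

lemma cs_neg : p.cs (-h) = p.cs h := by simp [cs, cSq]

lemma kt_neg : p.kt (-h) = -p.kt h := by
  simp only [kt, cs_neg, Int.cast_neg]
  ring

/-- The normalisation of the mode function as a Whittaker mode. -/
noncomputable def modeNorm (p : CCMField) (k : ℝ) (h : ℤ) : ℝ :=
  Real.exp (-Real.pi * p.kt h / 2) * (-p.hubble / Real.sqrt (2 * p.cs h * k))

lemma mode_eq_whittakerMode :
    p.mode k h = whittakerMode (p.modeNorm k h) (p.cs h * k) (Complex.I * p.kt h) p.nu := by
  funext η
  simp only [mode, whittakerMode, modeNorm]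
  push_cast
  ring_nf

lemma exp_neg_I_pi_mul (t : ℝ) :
    Complex.exp (-(Complex.I * Real.pi * (Complex.I * t))) = (Real.exp (Real.pi * t) : ℝ) := by
  push_cast
  congr 1
  linear_combination (-(Real.pi : ℂ) * t) * Complex.I_sq

lemma exp_I_pi_mul (t : ℝ) :
    Complex.exp (Complex.I * Real.pi * (Complex.I * t)) = (Real.exp (-(Real.pi * t)) : ℝ) := by
  push_cast
  congr 1
  linear_combination ((Real.pi : ℂ) * t) * Complex.I_sq

lemma modeNorm_neg : p.modeNorm k (-h) = p.modeNorm k h * Real.exp (Real.pi * p.kt h) := by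
  have : Real.exp (-Real.pi * -p.kt h / 2) =
      Real.exp (-Real.pi * p.kt h / 2) * Real.exp (Real.pi * p.kt h) := by
    rw [← Real.exp_add]
    ring_nf
  rw [modeNorm, modeNorm, kt_neg, cs_neg, this]
  ring

/-- Wick reality of the coefficients of the homogeneous part. -/
def IsWickReal (p : CCMField) (A : ℤ → ℂ) : Prop :=
  ∀ h, A (-h) * Real.exp (Real.pi * p.kt h) =
      conj (A h) * Real.exp (-(Real.pi * p.kt h)) +
      (Complex.exp (-(Complex.I * Real.pi * (conj p.nu - Complex.I * p.kt h - 1 / 2))) -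
          Complex.exp (Complex.I * Real.pi * (conj p.nu - Complex.I * p.kt h - 1 / 2))) *
        (Complex.Gamma (1 / 2 + conj p.nu - Complex.I * p.kt h) /
          Complex.Gamma (1 / 2 + conj p.nu + Complex.I * p.kt h))

lemma exp_I_pi_half_shift (w : ℂ) :
    Complex.exp (Complex.I * Real.pi * (w - 1 / 2)) =
      -Complex.I * Complex.exp (Complex.I * Real.pi * w) := by
  rw [show Complex.I * Real.pi * (w - 1 / 2) = -Real.pi / 2 * Complex.I + Complex.I * Real.pi * w by
    ring, Complex.exp_add, Complex.exp_neg_pi_div_two_mul_I]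

lemma exp_neg_I_pi_half_shift (w : ℂ) :
    Complex.exp (-(Complex.I * Real.pi * (w - 1 / 2))) =
      Complex.I * Complex.exp (-(Complex.I * Real.pi * w)) := by
  rw [show -(Complex.I * Real.pi * (w - 1 / 2)) =
    Real.pi / 2 * Complex.I + -(Complex.I * Real.pi * w) by ring, Complex.exp_add,
    Complex.exp_pi_div_two_mul_I]

/-- Here A(−h) = −conj A(h), so the two coefficient terms combine to A(−h) · 2cosh(πκ̃), which
removes the sech. With s = 1/2 − iμ − iκ̃ the jump is 2i sin(πs) Γ(s)/Γ(1/2 − iμ + iκ̃), and the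
reflection formula for Γ(s)Γ(1−s) identifies the two. -/
lemma isWickReal_heavyCoeff {p : CCMField} (hH : 0 < p.hubble) (hp : p.IsHeavy) :
    p.IsWickReal p.heavyCoeff := by
  intro h
  have hν := nu_of_isHeavy hH hp
  have hνc : conj p.nu = -(Complex.I * p.mu) := by rw [hν]; simp
  rw [hνc, exp_I_pi_half_shift, exp_neg_I_pi_half_shift]
  set t := p.kt h with ht
  set m := p.mu with hm
  set s : ℂ := 1 / 2 + -(Complex.I * m) - Complex.I * t with hs
  have g1 : Complex.Gamma s ≠ 0 := Complex.Gamma_ne_zero_of_re_pos (by simp [hs])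
  have g2 : Complex.Gamma (1 - s) ≠ 0 := Complex.Gamma_ne_zero_of_re_pos (by simp [hs]; norm_num)
  have g3 : Complex.Gamma (1 / 2 + -(Complex.I * m) + Complex.I * t) ≠ 0 :=
    Complex.Gamma_ne_zero_of_re_pos (by simp)
  have hrefl := Complex.Gamma_mul_Gamma_one_sub s
  have hsin0 : Complex.sin (Real.pi * s) ≠ 0 := by
    intro h0
    rw [h0, div_zero] at hrefl
    exact mul_ne_zero g1 g2 hrefl
  rw [eq_div_iff hsin0] at hrefl
  have hsin : Complex.sin (Real.pi * s) =
      (Complex.exp (Complex.I * Real.pi * (-(Complex.I * m) - Complex.I * t)) +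
        Complex.exp (-(Complex.I * Real.pi * (-(Complex.I * m) - Complex.I * t)))) / 2 := by
    rw [hs, show (Real.pi : ℂ) * (1 / 2 + -(Complex.I * m) - Complex.I * t) =
      Real.pi * (-(Complex.I * m) - Complex.I * t) + Real.pi / 2 by ring,
      Complex.sin_add_pi_div_two, Complex.cos]
    ring_nf
  rw [hsin] at hrefl
  have hcosh : ((Real.cosh (Real.pi * t) : ℝ) : ℂ) =
      ((Real.exp (Real.pi * t) : ℝ) + (Real.exp (-(Real.pi * t)) : ℝ) : ℂ) / 2 := by
    rw [Real.cosh_eq]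
    push_cast
    ring
  have hcosh0 : ((Real.cosh (Real.pi * t) : ℝ) : ℂ) ≠ 0 := by
    exact_mod_cast (Real.cosh_pos _).ne'
  have hA' : p.heavyCoeff (-h) = Complex.I * Real.pi * (Real.cosh (Real.pi * t) : ℂ)⁻¹ /
      (Complex.Gamma (1 / 2 + -(Complex.I * m) + Complex.I * t) * Complex.Gamma (1 - s)) := by
    rw [heavyCoeff, kt_neg, ← ht, ← hm, mul_neg, Real.cosh_neg, hs]
    push_cast
    ring_nf
  have hA : conj (p.heavyCoeff h) = -(Complex.I * Real.pi * (Real.cosh (Real.pi * t) : ℂ)⁻¹ /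
      (Complex.Gamma (1 / 2 + -(Complex.I * m) + Complex.I * t) * Complex.Gamma (1 - s))) := by
    rw [heavyCoeff, ← ht, ← hm, map_div₀, map_mul, map_mul, map_mul, ← Complex.Gamma_conj,
      ← Complex.Gamma_conj, Complex.conj_ofReal, Complex.conj_ofReal, Complex.conj_I]
    simp only [map_sub, map_add, conj_one_half, map_mul, Complex.conj_I, Complex.conj_ofReal, hs]
    push_cast
    ring_nf
  rw [hA', hA]
  generalize Complex.exp (Complex.I * Real.pi * (-(Complex.I * m) - Complex.I * t)) = E at *
  generalize Complex.exp (-(Complex.I * Real.pi * (-(Complex.I * m) - Complex.I * t))) = E' at *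
  generalize Complex.Gamma (1 / 2 + -(Complex.I * m) + Complex.I * t) = G₃ at *
  generalize Complex.Gamma s = G₁ at *
  generalize Complex.Gamma (1 - s) = G₂ at *
  generalize ((Real.cosh (Real.pi * t) : ℝ) : ℂ) = c at *
  generalize ((Real.exp (Real.pi * t) : ℝ) : ℂ) = e₁ at *
  generalize ((Real.exp (-(Real.pi * t)) : ℝ) : ℂ) = e₂ at *
  field_simp
  linear_combination (-2 * c) * hrefl - 2 * (Real.pi : ℂ) * hcosh

/-- For real ν the coefficients contain the same Gamma quotient as the jump, and its two
exponentials are supplied by A(−h) and conj A(h) separately. -/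
lemma isWickReal_lightCoeff {p : CCMField} (hH : 0 < p.hubble) (hp : p.IsLight) :
    p.IsWickReal p.lightCoeff := by
  intro h
  obtain ⟨x, hx, hν⟩ := nu_of_isLight hH hp
  have e1 : Complex.exp (Complex.I * Real.pi * (x + 1 / 2)) =
      Complex.I * Complex.exp (Complex.I * Real.pi * x) := by
    rw [show Complex.I * Real.pi * (x + 1 / 2 : ℂ) =
      Real.pi / 2 * Complex.I + Complex.I * Real.pi * x by ring, Complex.exp_add, Complex.exp_pi_div_two_mul_I]
  have e2 : Complex.exp (-(Complex.I * Real.pi * (x + 1 / 2))) =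
      -Complex.I * Complex.exp (-(Complex.I * Real.pi * x)) := by
    rw [show -(Complex.I * Real.pi * (x + 1 / 2 : ℂ)) =
      -Real.pi / 2 * Complex.I + -(Complex.I * Real.pi * x) by ring, Complex.exp_add,
      Complex.exp_neg_pi_div_two_mul_I]
  have hA' : p.lightCoeff (-h) = Complex.I * Complex.exp (Complex.I * Real.pi * x) *
      Complex.Gamma (1 / 2 + x - Complex.I * p.kt h) /
        Complex.Gamma (1 / 2 + x + Complex.I * p.kt h) := by
    rw [lightCoeff, kt_neg, hν, e1]
    push_cast
    ring_nf
  have hA : conj (p.lightCoeff h) = -Complex.I * Complex.exp (-(Complex.I * Real.pi * x)) *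
      Complex.Gamma (1 / 2 + x - Complex.I * p.kt h) /
        Complex.Gamma (1 / 2 + x + Complex.I * p.kt h) := by
    rw [lightCoeff, hν, map_div₀, map_mul, ← Complex.Gamma_conj, ← Complex.Gamma_conj,
      ← Complex.exp_conj, ← e2]
    simp only [map_sub, map_add, conj_one_half, map_mul, Complex.conj_I, Complex.conj_ofReal]
    ring_nf
  rw [hA', hA, hν, Complex.conj_ofReal, exp_I_pi_half_shift, exp_neg_I_pi_half_shift,
    ← exp_neg_I_pi_mul, ← exp_I_pi_mul, mul_sub, neg_sub, Complex.exp_sub, Complex.exp_sub,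
    Complex.exp_neg, Complex.exp_neg]
  field_simp
  ring

lemma vanishesInFarPast_mode {p : CCMField} (hc : ∀ h : ℤ, |h| ≤ (p.spin : ℤ) → 0 < p.cSq h)
    (hk : 0 < k) (hν : RealOrImaginary p.nu) (A : ℤ → ℂ) {h : ℤ} (hh : |h| ≤ (p.spin : ℤ)) :
    VanishesInFarPast (connected (p.mode k h) (A h)) := by
  refine vanishesInFarPast_connected ?_ _
  rw [mode_eq_whittakerMode]
  exact hasFarPastGrowth_whittakerMode _ (mul_pos (Real.sqrt_pos.2 (hc h hh)) hk) (by simp)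
    hν.re_nonneg

lemma helicallyReal_mode {p : CCMField} (hc : ∀ h : ℤ, |h| ≤ (p.spin : ℤ) → 0 < p.cSq h)
    (hk : 0 < k) (hν : RealOrImaginary p.nu)
    {A : ℤ → ℂ} (hA : p.IsWickReal A) :
    HelicallyReal p.spin fun h => connected (p.mode k h) (A h) := by
  refine ⟨fun h => wickConnected
    (whittakerWick (p.modeNorm k h) (p.cs h * k) (Complex.I * p.kt h) p.nu)
    (whittakerWickConj (p.modeNorm k h) (p.cs h * k) (Complex.I * p.kt h) p.nu) (A h),
    fun h hh => ⟨?_, fun χ₁ χ₂ h₁ h₂ => ?_⟩⟩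
  · have ha : 0 < p.cs h * k := mul_pos (Real.sqrt_pos.2 (hc h hh)) hk
    beta_reduce
    rw [mode_eq_whittakerMode]
    exact isWickRotation_connected
      (fun χ hχ => tendsto_whittakerMode_wick _ ha (by simp) hν.re_nonneg hχ)
      (fun χ hχ => tendsto_conjMode_whittakerMode_wick _ ha (by simp) hν hχ) _
  · have ha : 0 < p.cs h * k := mul_pos (Real.sqrt_pos.2 (hc h hh)) hk
    refine conj_wickConnected (fun χ₁ χ₂ h₁ h₂ => ?_) h₁ h₂
    rw [kt_neg, cs_neg, Complex.ofReal_neg, mul_neg]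
    refine conj_wickConnected_whittaker ha (by simp) hν ?_ ?_ h₁ h₂
    · rw [modeNorm_neg, exp_neg_I_pi_mul]
      push_cast
      ring
    · rw [exp_neg_I_pi_mul, exp_I_pi_mul]
      exact hA h

/-- Conjugation flips h in the propagator and reverses k in both tensors; each reversal is a
helicity flip with the sign (−1)^{S−h}, the two signs cancel, and h is reindexed. -/
lemma realAfterWick_indexed (n k : Vec3) {C : ℤ → ℂ → ℂ → ℂ} (hC : HelicallyReal p.spin C)
    (i j : Fin p.spin → Fin 3) : RealAfterWick (p.indexed n k C i j) := by
  obtain ⟨Ct, hCt⟩ := hC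
  have hmem : ∀ h ∈ Finset.Icc (-(p.spin : ℤ)) p.spin, |h| ≤ (p.spin : ℤ) := fun h hh =>
    abs_le.2 (Finset.mem_Icc.1 hh)
  refine ⟨_, isWickRotation_sum _ _ fun h hh => (hCt h (hmem h hh)).1, fun χ₁ χ₂ h₁ h₂ => ?_⟩
  rw [map_sum]
  refine Finset.sum_bij' (fun h _ => -h) (fun h _ => -h) ?_ ?_ ?_ ?_ ?_
  · intro h hh
    rw [Finset.mem_Icc] at hh ⊢
    omega
  · intro h hh
    rw [Finset.mem_Icc] at hh ⊢
    omega
  · simp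
  · simp
  · intro h hh
    have hh' := hmem h hh
    have hneg : |(-h)| ≤ (p.spin : ℤ) := by rwa [abs_neg]
    have e1 := ccmPol_neg n k p.spin hh' i
    have e2 := ccmPol_neg n k p.spin hneg j
    rw [neg_neg] at e2
    have e3 := ccmPol_neg n (-k) p.spin hh' j
    rw [neg_neg] at e3
    rw [map_mul, map_mul, (hCt h hh').2 _ _ h₁ h₂, conj_ccmPol, conj_ccmPol, neg_neg, e1, e3]
    linear_combination (Ct (-h) χ₁ χ₂ * ccmPol n k p.spin (-h) i *
      ccmPol n (-k) p.spin (-h) j) * neg_one_zpow_mul_self ((p.spin : ℤ) - h)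

lemma vanishesInFarPast_indexed (n k : Vec3) {C : ℤ → ℂ → ℂ → ℂ}
    (hC : ∀ h : ℤ, |h| ≤ (p.spin : ℤ) → VanishesInFarPast (C h)) (i j : Fin p.spin → Fin 3) :
    VanishesInFarPast (p.indexed n k C i j) :=
  vanishesInFarPast_sum _ _ _ fun h hh => hC h (abs_le.2 (Finset.mem_Icc.1 hh))

lemma tendsto_mode_late {p : CCMField} (hH : 0 < p.hubble) (hp : p.IsLight) (hk : 0 < k) {h : ℤ}
    (hc : 0 < p.cSq h) :
    Tendsto (fun η₀ : ℝ => p.mode k h η₀ / conjMode (p.mode k h) η₀) (𝓝[<] 0)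
      (𝓝 (-p.lightCoeff h)) := by
  obtain ⟨x, hx, hν⟩ := nu_of_isLight hH hp
  have hcs : 0 < p.cs h := Real.sqrt_pos.2 hc
  rw [mode_eq_whittakerMode, hν]
  have := tendsto_whittakerMode_late (N := p.modeNorm k h) (a := p.cs h * k)
    (κ := Complex.I * p.kt h) (ν := x) ?_ (mul_pos hcs hk) (by simp) (by simpa using hx) (by simp)
  · rw [lightCoeff, hν]
    exact this
  · refine mul_ne_zero (Real.exp_pos _).ne' (div_ne_zero (neg_ne_zero.2 hH.ne') ?_)
    exact (Real.sqrt_pos.2 (by positivity)).ne'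

end CCMField

open Polynomial

/-! ### Whittaker's function with vanishing first index and its derivative -/

/-- `W_{0,ν}(z)`, with its principal value on the cut. -/
noncomputable def besselW (ν z : ℂ) : ℂ := Complex.exp (-z / 2) * tricomiU 0 ν z

/-- `z ∂_z W_{0,ν}(z)`, by a formula that is valid up to the cut. -/
noncomputable def besselV (ν z : ℂ) : ℂ :=
  Complex.exp (-z / 2) * (((ν + 1 / 2 - z / 2) * tricomiInt (ν - 1 / 2) (ν - 1 / 2) z -
    tricomiInt (ν + 1 / 2) (ν - 1 / 2) z) / Complex.Gamma (ν + 1 / 2))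

lemma tricomiU_zero (ν z : ℂ) :
    tricomiU 0 ν z = tricomiInt (ν - 1 / 2) (ν - 1 / 2) z / Complex.Gamma (ν + 1 / 2) := by
  rw [tricomiU, sub_zero, add_zero, sub_zero, add_comm]

lemma hasDerivAt_exp_neg_half (z : ℂ) :
    HasDerivAt (fun z : ℂ => Complex.exp (-z / 2)) (-(1 / 2) * Complex.exp (-z / 2)) z := by
  have := ((hasDerivAt_id z).neg.div_const 2).cexp
  convert! this using 1
  simp
  ring

section Bessel

variable {ν z : ℂ}

lemma hasDerivAt_tricomiInt_diag (hν : 0 ≤ ν.re) (hz : z ∈ Complex.slitPlane) :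
    HasDerivAt (tricomiInt (ν - 1 / 2) (ν - 1 / 2))
      (((ν + 1 / 2) * tricomiInt (ν - 1 / 2) (ν - 1 / 2) z -
        tricomiInt (ν + 1 / 2) (ν - 1 / 2) z) / z) z := by
  have h1 := hasDerivAt_tricomiInt (p := ν - 1 / 2) (by simp; linarith) (ν - 1 / 2) hz
  have h2 := tricomiInt_integration_by_parts (p := ν + 1 / 2) (by simp; linarith) (ν - 1 / 2) hz
  rw [show ν - 1 / 2 + 1 = ν + 1 / 2 by ring] at h1
  rw [show ν + 1 / 2 - 1 = ν - 1 / 2 by ring] at h2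
  convert! h1 using 1
  rw [h2]
  field_simp
  ring

/-- The derivative has the exponents ν+3/2 and ν−3/2. Contiguity and integration by parts bring it
back to the span of the two integrals in `besselV`, which still converge on the cut. -/
lemma hasDerivAt_tricomiInt_succ (hν : 0 ≤ ν.re) (hz : z ∈ Complex.slitPlane) :
    HasDerivAt (tricomiInt (ν + 1 / 2) (ν - 1 / 2))
      (((z - (ν - 1 / 2)) * tricomiInt (ν + 1 / 2) (ν - 1 / 2) z -
        (ν + 1 / 2) * z * tricomiInt (ν - 1 / 2) (ν - 1 / 2) z) / z) z := by
  have hz0 := Complex.slitPlane_ne_zero hz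
  have h1 := hasDerivAt_tricomiInt (p := ν + 1 / 2) (by simp; linarith) (ν - 1 / 2) hz
  have h2 := tricomiInt_integration_by_parts (p := ν + 1 / 2 + 1) (by simp; linarith) (ν - 1 / 2) hz
  have h3 := tricomiInt_integration_by_parts (p := ν + 1 / 2) (by simp; linarith) (ν + 1 / 2) hz
  have h4 := tricomiInt_eq_add (p := ν + 1 / 2) (by simp; linarith) (ν + 1 / 2) hz
  have h5 := tricomiInt_eq_add (p := ν - 1 / 2) (by simp; linarith) (ν + 1 / 2) hz
  rw [show ν + 1 / 2 + 1 - 1 = ν + 1 / 2 by ring] at h2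
  rw [show ν + 1 / 2 - 1 = ν - 1 / 2 by ring] at h3 h4 h5
  rw [show ν - 1 / 2 + 1 = ν + 1 / 2 by ring] at h5
  convert! h1 using 1
  rw [h5] at h3
  generalize tricomiInt (ν + 1 / 2 + 1) (ν - 1 / 2 - 1) z = a at *
  generalize tricomiInt (ν + 1 / 2 + 1) (ν - 1 / 2) z = b at *
  generalize tricomiInt (ν + 1 / 2) (ν + 1 / 2) z = c at *
  generalize tricomiInt (ν + 1 / 2) (ν - 1 / 2) z = d at *
  generalize tricomiInt (ν - 1 / 2) (ν - 1 / 2) z = e at *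
  have e0 : -(ν - 1 / 2) / z ^ 2 * a * z = -((ν - 1 / 2) / z * a) := by field_simp
  have e2 : b = z * (c - d) := by rw [h4]; field_simp; ring
  have e3 : z * c = (ν + 1 / 2) * (z * e + 2 * d) := by rw [h3]; field_simp; ring
  rw [div_eq_iff hz0, e0]
  linear_combination -h2 + e2 + e3

lemma hasDerivAt_besselW (hν : 0 ≤ ν.re) (hz : z ∈ Complex.slitPlane) :
    HasDerivAt (besselW ν) (besselV ν z / z) z := by
  have hz0 := Complex.slitPlane_ne_zero hz
  have h := (hasDerivAt_exp_neg_half z).mul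
    ((hasDerivAt_tricomiInt_diag hν hz).div_const (Complex.Gamma (ν + 1 / 2)))
  have e : besselW ν = fun z => Complex.exp (-z / 2) *
      (tricomiInt (ν - 1 / 2) (ν - 1 / 2) z / Complex.Gamma (ν + 1 / 2)) := by
    funext z
    rw [besselW, tricomiU_zero]
  rw [e]
  convert! h using 1
  rw [besselV]
  field_simp
  ring

/-- Whittaker's equation W'' = (1/4 + (ν² − 1/4)/z²) W, written as a first-order system for W and
zW'. -/
lemma hasDerivAt_besselV (hν : 0 ≤ ν.re) (hz : z ∈ Complex.slitPlane) :
    HasDerivAt (besselV ν) ((besselV ν z + (z ^ 2 / 4 + ν ^ 2 - 1 / 4) * besselW ν z) / z) z := by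
  have hz0 := Complex.slitPlane_ne_zero hz
  have h := (hasDerivAt_exp_neg_half z).mul ((((((hasDerivAt_id z).div_const 2).const_sub
    (ν + 1 / 2)).mul (hasDerivAt_tricomiInt_diag hν hz)).sub
    (hasDerivAt_tricomiInt_succ hν hz)).div_const (Complex.Gamma (ν + 1 / 2)))
  convert! h using 1
  simp only [id, Pi.mul_apply, Pi.sub_apply]
  rw [besselV, besselW, tricomiU_zero]
  field_simp
  ring

lemma conj_besselW (hν : RealOrImaginary ν) (hz : z ∈ Complex.slitPlane) :
    conj (besselW ν z) = besselW ν (conj z) := by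
  have hz' : conj z ∈ Complex.slitPlane := by
    rw [Complex.mem_slitPlane_iff] at hz ⊢
    simpa using hz
  rw [besselW, besselW, map_mul, conj_tricomiU _ _ hz, map_zero,
    tricomiU_conj_index (by simp) hν (Or.inl hz'), ← Complex.exp_conj, map_div₀, map_neg, map_ofNat]

/-- The functions W for ν and conj ν agree near z, so their derivatives agree. -/
lemma besselV_conj_index (hν : RealOrImaginary ν) (hz : z ∈ Complex.slitPlane) :
    besselV (conj ν) z = besselV ν z := by
  have hν' : 0 ≤ (conj ν).re := by simpa using hν.re_nonneg
  have h1 := hasDerivAt_besselW hν' hz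
  have h2 := hasDerivAt_besselW hν.re_nonneg hz
  have h3 : besselW (conj ν) =ᶠ[𝓝 z] besselW ν := by
    filter_upwards [Complex.isOpen_slitPlane.mem_nhds hz] with w hw
    rw [besselW, besselW, tricomiU_conj_index (by simp) hν (Or.inl hw)]
  have h4 := h1.unique (h2.congr_of_eventuallyEq h3)
  have hz0 := Complex.slitPlane_ne_zero hz
  field_simp at h4
  exact h4

lemma conj_besselV (hν : RealOrImaginary ν) (hz : z ∈ Complex.slitPlane) :
    conj (besselV ν z) = besselV ν (conj z) := by
  have hz' : conj z ∈ Complex.slitPlane := by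
    rw [Complex.mem_slitPlane_iff] at hz ⊢
    simpa using hz
  rw [← besselV_conj_index hν hz', besselV, besselV, map_mul, map_div₀, map_sub, map_mul,
    conj_tricomiInt _ _ hz, conj_tricomiInt _ _ hz, ← Complex.exp_conj, ← Complex.Gamma_conj]
  simp only [map_sub, map_add, map_div₀, map_neg, map_ofNat, map_one]

lemma tendsto_exp_cut (x : ℝ) :
    Tendsto (fun ε : ℝ => Complex.exp (-(-((x : ℂ) * Complex.exp (Complex.I * ε))) / 2))
      (𝓝[>] 0) (𝓝 (Complex.exp (-(-(x : ℂ)) / 2))) :=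
  (Complex.continuous_exp.tendsto _).comp ((tendsto_rotated_neg x).neg.div_const 2)

lemma tendsto_besselW_cut (hν : 0 ≤ ν.re) {x : ℝ} (hx : 0 < x) :
    Tendsto (fun ε : ℝ => besselW ν (-(x * Complex.exp (Complex.I * ε)))) (𝓝[>] 0)
      (𝓝 (besselW ν (-x))) :=
  (tendsto_exp_cut x).mul (tendsto_tricomiU_neg (by simp) hν hx)

lemma tendsto_besselV_cut (hν : 0 ≤ ν.re) {x : ℝ} (hx : 0 < x) :
    Tendsto (fun ε : ℝ => besselV ν (-(x * Complex.exp (Complex.I * ε)))) (𝓝[>] 0)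
      (𝓝 (besselV ν (-x))) := by
  have hq : -1 < (ν - 1 / 2).re := by simp; linarith
  have hq' : -1 < (ν + 1 / 2).re := by simp; linarith
  exact (tendsto_exp_cut x).mul ((((tendsto_rotated_neg x).div_const 2).const_sub _ |>.mul
    (tendsto_tricomiInt_neg hq hq hx)).sub (tendsto_tricomiInt_neg hq' hq hx) |>.div_const _)

lemma besselV_conj_index_neg (hν : RealOrImaginary ν) {x : ℝ} (hx : 0 < x) :
    besselV (conj ν) (-x) = besselV ν (-x) := by
  have hν' : 0 ≤ (conj ν).re := by simpa using hν.re_nonneg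
  refine tendsto_nhds_unique (tendsto_besselV_cut hν' hx)
    ((tendsto_besselV_cut hν.re_nonneg hx).congr' ?_)
  filter_upwards [neg_mul_exp_mem_slitPlane hx] with ε hε
  exact (besselV_conj_index hν hε).symm

/-- The factor in the discontinuity of `W_{0,ν}` across the cut. -/
noncomputable def cutFactor (ν : ℂ) : ℂ :=
  Complex.exp (-(Complex.I * Real.pi * (conj ν - 1 / 2))) -
    Complex.exp (Complex.I * Real.pi * (conj ν - 1 / 2))

lemma conj_besselW_neg (hν : RealOrImaginary ν) {x : ℝ} (hx : 0 < x) :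
    conj (besselW ν (-x)) = besselW ν (-x) + cutFactor ν * besselW ν x := by
  have hν0 := hν.re_nonneg
  have g : Complex.Gamma (1 / 2 + conj ν) ≠ 0 := Complex.Gamma_ne_zero_of_re_pos (by
    simp; linarith)
  have hE : Complex.exp (-(-(x : ℂ)) / 2) * Complex.exp (-(x : ℂ)) =
      Complex.exp (-(x : ℂ) / 2) := by
    rw [← Complex.exp_add]
    ring_nf
  simp only [besselW, map_mul, conj_tricomiU_neg (κ := 0) (by simp) hν hx, ← Complex.exp_conj,
    map_div₀, map_neg, map_ofNat, Complex.conj_ofReal, sub_zero, add_zero, neg_zero, mul_zero,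
    Complex.cpow_zero, div_self g, ← hE, cutFactor]
  ring

/-- The same jump factor as for W. Across the cut the second integral acquires the exponents conj ν
− 1/2 and conj ν + 1/2 in exchanged order, and contiguity rewrites it by the two integrals in
`besselV`. -/
lemma conj_besselV_neg (hν : RealOrImaginary ν) {x : ℝ} (hx : 0 < x) :
    conj (besselV ν (-x)) = besselV ν (-x) + cutFactor ν * besselV ν x := by
  have hν0 := hν.re_nonneg
  have hxs := Complex.ofReal_mem_slitPlane.2 hx
  have hq : -1 < (ν - 1 / 2).re := by simp; linarith
  have hq' : -1 < (ν + 1 / 2).re := by simp; linarith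
  have hE : Complex.exp (-(-(x : ℂ)) / 2) * Complex.exp (-(x : ℂ)) =
      Complex.exp (-(x : ℂ) / 2) := by
    rw [← Complex.exp_add]
    ring_nf
  have hx0 : (x : ℂ) ≠ 0 := by exact_mod_cast hx.ne'
  have e1 : conj (ν - 1 / 2) = conj ν - 1 / 2 := by rw [map_sub, conj_one_half]
  have e2 : conj (ν + 1 / 2) = conj ν + 1 / 2 := by rw [map_add, conj_one_half]
  have h5 := tricomiInt_eq_add (p := conj ν - 1 / 2) (by simp; linarith) (conj ν + 1 / 2) hxs
  rw [show conj ν + 1 / 2 - 1 = conj ν - 1 / 2 by ring,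
    show conj ν - 1 / 2 + 1 = conj ν + 1 / 2 by ring] at h5
  have hG : conj (Complex.Gamma (ν + 1 / 2)) = Complex.Gamma (conj ν + 1 / 2) := by
    rw [← Complex.Gamma_conj, e2]
  have key : conj (besselV ν (-x)) = besselV (conj ν) (-x) + cutFactor ν * besselV (conj ν) x := by
    rw [besselV, map_mul, map_div₀, map_sub, map_mul,
      conj_tricomiInt_neg hq hq hx, conj_tricomiInt_neg hq' hq hx,
      besselV, besselV, ← Complex.exp_conj, hG, map_sub, e2, e1,
      show conj ν + 1 / 2 - (conj ν - 1 / 2) = 1 by ring, Complex.cpow_one, sub_self,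
      Complex.cpow_zero, h5, ← hE, cutFactor]
    simp only [map_div₀, map_neg, map_ofNat, Complex.conj_ofReal]
    generalize Complex.Gamma (conj ν + 1 / 2) = G
    field_simp
    ring
  rw [key, besselV_conj_index_neg hν hx, besselV_conj_index hν hxs]

end Bessel

/-! ### Polynomial growth -/

/-- Polynomial growth on `[r₀, ∞)`. -/
def PolyGrowth (r₀ : ℝ) (f : ℝ → ℂ) : Prop :=
  ∃ (B : ℝ) (n : ℕ), 0 ≤ B ∧ ∀ r : ℝ, r₀ ≤ r → ‖f r‖ ≤ B * r ^ n

section PolyGrowth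

variable {r₀ : ℝ} {f g : ℝ → ℂ}

lemma polyGrowth_of_bounded (hf : ∃ B : ℝ, ∀ r : ℝ, r₀ ≤ r → ‖f r‖ ≤ B) : PolyGrowth r₀ f := by
  obtain ⟨B, hB⟩ := hf
  exact ⟨B, 0, (norm_nonneg _).trans (hB r₀ le_rfl), fun r hr => by simpa using hB r hr⟩

lemma polyGrowth_const (c : ℂ) : PolyGrowth r₀ fun _ => c :=
  polyGrowth_of_bounded ⟨‖c‖, fun _ _ => le_rfl⟩

lemma PolyGrowth.mul (hr₀ : 0 < r₀) (hf : PolyGrowth r₀ f) (hg : PolyGrowth r₀ g) :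
    PolyGrowth r₀ fun r => f r * g r := by
  obtain ⟨B, n, hB, h⟩ := hf
  obtain ⟨B', n', hB', h'⟩ := hg
  refine ⟨B * B', n + n', by positivity, fun r hr => ?_⟩
  have hr0 : 0 < r := hr₀.trans_le hr
  rw [norm_mul, pow_add]
  calc _ ≤ (B * r ^ n) * (B' * r ^ n') := by
        gcongr
        exacts [h r hr, h' r hr]
    _ = _ := by ring

lemma PolyGrowth.add (hr₀ : 0 < r₀) (hf : PolyGrowth r₀ f) (hg : PolyGrowth r₀ g) :
    PolyGrowth r₀ fun r => f r + g r := by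
  obtain ⟨B, n, hB, h⟩ := hf
  obtain ⟨B', n', hB', h'⟩ := hg
  refine ⟨B / r₀ ^ n' + B' / r₀ ^ n, n + n', by positivity, fun r hr => ?_⟩
  have hr0 : 0 < r := hr₀.trans_le hr
  have key : ∀ (E : ℝ) (a b : ℕ), 0 ≤ E → E * r ^ a ≤ E / r₀ ^ b * r ^ (a + b) := by
    intro E a b hE
    have h1 : 1 ≤ r ^ b / r₀ ^ b := by
      rw [one_le_div (by positivity)]
      gcongr
    calc E * r ^ a ≤ E * r ^ a * (r ^ b / r₀ ^ b) := le_mul_of_one_le_right (by positivity) h1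
      _ = _ := by rw [pow_add]; ring
  have k1 := key B n n' hB
  have k2 := key B' n' n hB'
  rw [add_comm n' n] at k2
  calc _ ≤ ‖f r‖ + ‖g r‖ := norm_add_le _ _
    _ ≤ _ := by
      rw [add_mul]
      linarith [h r hr, h' r hr]

lemma polyGrowth_ray (u : ℂ) (hr₀ : 0 < r₀) : PolyGrowth r₀ fun r => (r : ℂ) * u :=
  ⟨‖u‖, 1, norm_nonneg _, fun r hr => by
    rw [norm_mul, Complex.norm_real, Real.norm_of_nonneg (hr₀.le.trans hr), pow_one, mul_comm]⟩

lemma polyGrowth_ray_inv (u : ℂ) (hr₀ : 0 < r₀) : PolyGrowth r₀ fun r => ((r : ℂ) * u)⁻¹ :=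
  polyGrowth_of_bounded ⟨r₀⁻¹ * ‖u‖⁻¹, fun r hr => by
    rw [norm_inv, norm_mul, Complex.norm_real, Real.norm_of_nonneg (hr₀.le.trans hr), mul_inv]
    gcongr⟩

lemma PolyGrowth.pow (hr₀ : 0 < r₀) (hf : PolyGrowth r₀ f) (n : ℕ) :
    PolyGrowth r₀ fun r => f r ^ n := by
  induction n with
  | zero => simpa using polyGrowth_const 1
  | succ n ih => simpa only [pow_succ] using ih.mul hr₀ hf

lemma polyGrowth_ray_zpow (u : ℂ) (hr₀ : 0 < r₀) (e : ℤ) :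
    PolyGrowth r₀ fun r => ((r : ℂ) * u) ^ e := by
  rcases e with n | n
  · simpa only [Int.ofNat_eq_natCast, zpow_natCast] using (polyGrowth_ray u hr₀).pow hr₀ n
  · simpa only [zpow_negSucc, ← inv_pow] using (polyGrowth_ray_inv u hr₀).pow hr₀ (n + 1)

lemma PolyGrowth.aeval (hr₀ : 0 < r₀) (hf : PolyGrowth r₀ f) (P : ℝ[X]) :
    PolyGrowth r₀ fun r => aeval (f r) P := by
  induction P using Polynomial.induction_on' with
  | add P Q hP hQ => simpa only [map_add] using hP.add hr₀ hQ
  | monomial n a =>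
    simpa only [aeval_monomial] using (polyGrowth_const (algebraMap ℝ ℂ a)).mul hr₀ (hf.pow hr₀ n)

end PolyGrowth

/-! ### Mode functions built from `W_{0,ν}` and its derivative -/

/-- `z^e (P(z²) W_{0,ν}(z) + Q(z²) z W_{0,ν}'(z))`. -/
noncomputable def besselMode (P Q : ℝ[X]) (e : ℤ) (ν z : ℂ) : ℂ :=
  z ^ e * (aeval (z ^ 2) P * besselW ν z + aeval (z ^ 2) Q * besselV ν z)

section BesselMode

variable {P Q : ℝ[X]} {e : ℤ} {ν : ℂ}

lemma hasDerivAt_besselMode (hν : 0 ≤ ν.re) {z : ℂ} (hz : z ∈ Complex.slitPlane) :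
    HasDerivAt (besselMode P Q e ν)
      (z ^ (e - 1) * ((e * aeval (z ^ 2) P + 2 * z ^ 2 * aeval (z ^ 2) (derivative P) +
          (z ^ 2 / 4 + ν ^ 2 - 1 / 4) * aeval (z ^ 2) Q) * besselW ν z +
        (aeval (z ^ 2) P + (e + 1) * aeval (z ^ 2) Q +
          2 * z ^ 2 * aeval (z ^ 2) (derivative Q)) * besselV ν z)) z := by
  have hz0 := Complex.slitPlane_ne_zero hz
  have hpoly : ∀ R : ℝ[X], HasDerivAt (fun z : ℂ => aeval (z ^ 2) R)
      (aeval (z ^ 2) (derivative R) * (2 * z)) z := fun R => by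
    have h1 := Polynomial.hasDerivAt_aeval R (z ^ 2)
    have h2 := hasDerivAt_pow 2 z
    simpa [Function.comp_def] using h1.comp z h2
  have h := (hasDerivAt_zpow e z (Or.inl hz0)).mul
    (((hpoly P).mul (hasDerivAt_besselW hν hz)).add ((hpoly Q).mul (hasDerivAt_besselV hν hz)))
  convert! h using 1
  have he : z ^ e = z ^ (e - 1) * z := by rw [zpow_sub_one₀ hz0]; field_simp
  simp only [Pi.mul_apply, Pi.add_apply]
  rw [he]
  field_simp
  ring

lemma exists_norm_besselMode_ray_le (P Q : ℝ[X]) (e : ℤ) (hν : 0 ≤ ν.re) {u : ℂ} (hu : u.im ≠ 0)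
    {r₀ : ℝ} (hr₀ : 0 < r₀) :
    ∃ f : ℝ → ℂ, PolyGrowth r₀ f ∧ ∀ r : ℝ, r₀ ≤ r →
      ‖besselMode P Q e ν (r * u)‖ = ‖f r‖ * Real.exp (-(r * u.re / 2)) := by
  have hray := polyGrowth_ray u hr₀
  have hI := polyGrowth_of_bounded
    (exists_norm_tricomiInt_ray_le (p := ν - 1 / 2) (by simp; linarith) (ν - 1 / 2) hu hr₀)
  have hT := polyGrowth_of_bounded
    (exists_norm_tricomiInt_ray_le (p := ν + 1 / 2) (by simp; linarith) (ν - 1 / 2) hu hr₀)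
  have hG := polyGrowth_const (r₀ := r₀) (Complex.Gamma (ν + 1 / 2))⁻¹
  have hlin := (polyGrowth_const (r₀ := r₀) (ν + 1 / 2)).add hr₀
    ((polyGrowth_const (r₀ := r₀) (-(1 / 2))).mul hr₀ hray)
  have hV := ((hlin.mul hr₀ hI).add hr₀ ((polyGrowth_const (r₀ := r₀) (-1)).mul hr₀ hT)).mul hr₀ hG
  have hP := (hray.pow hr₀ 2).aeval hr₀ P
  have hQ := (hray.pow hr₀ 2).aeval hr₀ Q
  refine ⟨_, (polyGrowth_ray_zpow u hr₀ e).mul hr₀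
    ((hP.mul hr₀ (hI.mul hr₀ hG)).add hr₀ (hQ.mul hr₀ hV)), fun r hr => ?_⟩
  have hre : ((-((r : ℂ) * u)) / 2).re = -(r * u.re / 2) := by
    rw [show -((r : ℂ) * u) / 2 = ((-(r / 2) : ℝ) : ℂ) * u by push_cast; ring,
      Complex.re_ofReal_mul]
    ring
  rw [← hre, ← Complex.norm_exp, ← norm_mul]
  congr 1
  rw [besselMode, besselW, besselV, tricomiU_zero]
  ring

lemma conj_besselMode (hν : RealOrImaginary ν) {x : ℝ} (hx : 0 < x) :
    conj (besselMode P Q e ν x) = besselMode P Q e ν x := by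
  have hxs := Complex.ofReal_mem_slitPlane.2 hx
  simp only [besselMode, map_mul, map_add, map_zpow₀, Complex.conj_ofReal, conj_besselW hν hxs,
    conj_besselV hν hxs, ← Polynomial.aeval_conj, map_pow]

/-- The polynomials are real and even in z, so z^e alone distinguishes the two half-axes and
contributes (−1)^e. -/
lemma conj_besselMode_neg (hν : RealOrImaginary ν) {x : ℝ} (hx : 0 < x) :
    conj (besselMode P Q e ν (-x)) =
      besselMode P Q e ν (-x) + (-1) ^ e * cutFactor ν * besselMode P Q e ν x := by
  have h1 : (-(x : ℂ)) ^ e = (-1) ^ e * (x : ℂ) ^ e := by rw [← mul_zpow, neg_one_mul]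
  simp only [besselMode, map_mul, map_add, map_zpow₀, map_neg, Complex.conj_ofReal,
    conj_besselW_neg hν hx, conj_besselV_neg hν hx, ← Polynomial.aeval_conj, map_pow, neg_sq, h1,
    map_one]
  ring

lemma tendsto_besselMode_cut (hν : 0 ≤ ν.re) {x : ℝ} (hx : 0 < x) :
    Tendsto (fun ε : ℝ => besselMode P Q e ν (-(x * Complex.exp (Complex.I * ε)))) (𝓝[>] 0)
      (𝓝 (besselMode P Q e ν (-x))) := by
  have hx0 : -(x : ℂ) ≠ 0 := by simpa using hx.ne'
  have ht := tendsto_rotated_neg x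
  have hp : ∀ R : ℝ[X], Continuous fun z : ℂ => aeval (z ^ 2) R := fun R => by fun_prop
  exact (ht.zpow₀ e (Or.inl hx0)).mul
    (((((hp P).tendsto _).comp ht).mul (tendsto_besselW_cut hν hx)).add
      ((((hp Q).tendsto _).comp ht).mul (tendsto_besselV_cut hν hx)))

/-- `σ(η) = c i^m z^e (P(z²) W + Q(z²) z W')` with `z = 2ikη`, on the half-plane `Re η < 0`. -/
def IsBesselMode (σ : ℂ → ℂ) (c k : ℝ) (m e : ℤ) (ν : ℂ) (P Q : ℝ[X]) : Prop :=
  ∀ η : ℂ, η.re < 0 → σ η = c * Complex.I ^ m * besselMode P Q e ν (2 * Complex.I * k * η)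

variable {σ : ℂ → ℂ} {c k : ℝ} {m : ℤ}

lemma hasFarPastGrowth_of_isBesselMode (hσ : IsBesselMode σ c k m e ν P Q) (hk : 0 < k)
    (hν : 0 ≤ ν.re) : HasFarPastGrowth σ := by
  intro ε hε r₀ hr₀
  have him : ∀ s : ℝ, ((s : ℂ) + ((-(2 * k) : ℝ) : ℂ) * Complex.I).im ≠ 0 := fun s => by
    simp [hk.ne']
  have hre : ∀ s : ℝ, ((s : ℂ) + ((-(2 * k) : ℝ) : ℂ) * Complex.I).re = s := fun s => by simp
  obtain ⟨f₁, hf₁, h₁⟩ := exists_norm_besselMode_ray_le P Q e hν (him (-(2 * k * ε))) hr₀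
  obtain ⟨f₂, hf₂, h₂⟩ := exists_norm_besselMode_ray_le P Q e hν (him (2 * k * ε)) hr₀
  have hnorm : ∀ {f : ℝ → ℂ}, PolyGrowth r₀ f → PolyGrowth r₀ fun r => (‖f r‖ : ℂ) :=
    fun ⟨B, n, hB, h⟩ => ⟨B, n, hB, fun r hr => by simpa using h r hr⟩
  obtain ⟨B, n, hB, h⟩ := (hnorm hf₁).add hr₀ (hnorm hf₂)
  have hc : ‖(c : ℂ) * Complex.I ^ m‖ = |c| := by simp
  refine ⟨|c| * B, k * ε, n, by positivity, by positivity, fun r hr => ?_⟩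
  have hr0 : 0 < r := hr₀.trans_le hr
  have hb := h r hr
  beta_reduce at hb
  rw [← Complex.ofReal_add, Complex.norm_real, Real.norm_of_nonneg (by positivity)] at hb
  have e₁ := h₁ r hr
  have e₂ := h₂ r hr
  rw [hre] at e₁ e₂
  constructor
  · rw [hσ _ (by simpa using hr0), two_I_mul_neg_mul_one_sub, norm_mul, hc, e₁,
      show -(r * -(2 * k * ε) / 2) = k * ε * r by ring, mul_assoc |c| B, mul_assoc |c|]
    gcongr
    linarith [norm_nonneg (f₂ r)]
  · rw [hσ _ (by simpa using hr0), two_I_mul_neg_mul_one_add, norm_mul, hc, e₂,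
      show -(r * (2 * k * ε) / 2) = -(k * ε * r) by ring, mul_assoc |c| B, mul_assoc |c|]
    gcongr
    linarith [norm_nonneg (f₁ r)]

lemma eventually_re_wick_neg {χ : ℝ} (hχ : 0 < χ) :
    ∀ᶠ ε : ℝ in 𝓝[>] 0, (Complex.I * Complex.exp (Complex.I * ε) * χ).re < 0 := by
  filter_upwards [Ioo_mem_nhdsGT Real.pi_pos] with ε hε
  have := Real.sin_pos_of_mem_Ioo hε
  simp [Complex.exp_re, Complex.exp_im]
  positivity

lemma tendsto_wick_of_isBesselMode (hσ : IsBesselMode σ c k m e ν P Q) (hk : 0 < k)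
    (hν : 0 ≤ ν.re) {χ : ℝ} (hχ : 0 < χ) :
    Tendsto (fun ε : ℝ => σ (Complex.I * Complex.exp (Complex.I * ε) * χ)) (𝓝[>] 0)
      (𝓝 (c * Complex.I ^ m * besselMode P Q e ν (-((2 * k * χ : ℝ) : ℂ)))) := by
  refine ((tendsto_besselMode_cut hν (by positivity)).const_mul _).congr' ?_
  filter_upwards [eventually_re_wick_neg hχ] with ε hε
  rw [hσ _ hε, two_I_mul_wick]

lemma tendsto_conj_wick_of_isBesselMode (hσ : IsBesselMode σ c k m e ν P Q) (hk : 0 < k)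
    (hν : RealOrImaginary ν) {χ : ℝ} (hχ : 0 < χ) :
    Tendsto (fun ε : ℝ => conjMode σ (Complex.I * Complex.exp (Complex.I * ε) * χ)) (𝓝[>] 0)
      (𝓝 (c * (-Complex.I) ^ m * besselMode P Q e ν ((2 * k * χ : ℝ) : ℂ))) := by
  have hx : 0 < 2 * k * χ := by positivity
  have hc := (hasDerivAt_besselMode (P := P) (Q := Q) (e := e) hν.re_nonneg
    (Complex.ofReal_mem_slitPlane.2 hx)).continuousAt
  have h := (Complex.continuous_conj.tendsto _).comp
    ((hc.tendsto.comp (tendsto_conj_wick_arg k χ)).const_mul (c * Complex.I ^ m))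
  rw [map_mul, map_mul, map_zpow₀, conj_besselMode hν hx, Complex.conj_I, Complex.conj_ofReal] at h
  refine h.congr' ?_
  filter_upwards [eventually_re_wick_neg hχ] with ε hε
  rw [conjMode, hσ _ (by rwa [Complex.conj_re])]
  rfl

lemma I_zpow_mul_neg_I_zpow (m : ℤ) : Complex.I ^ m * (-Complex.I) ^ m = 1 := by
  rw [← mul_zpow]
  simp

lemma neg_I_zpow (m : ℤ) : (-Complex.I) ^ m = (-1) ^ m * Complex.I ^ m := by
  rw [← mul_zpow, neg_one_mul]

lemma isWickRotation_of_isBesselMode (hσ : IsBesselMode σ c k m e ν P Q) (hk : 0 < k)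
    (hν : RealOrImaginary ν) (A : ℂ) :
    IsWickRotation (connected σ A) (wickConnected
      (fun χ => c * Complex.I ^ m * besselMode P Q e ν (-((2 * k * χ : ℝ) : ℂ)))
      (fun χ => c * (-Complex.I) ^ m * besselMode P Q e ν ((2 * k * χ : ℝ) : ℂ)) A) :=
  isWickRotation_connected (fun _ hχ => tendsto_wick_of_isBesselMode hσ hk hν.re_nonneg hχ)
    (fun _ hχ => tendsto_conj_wick_of_isBesselMode hσ hk hν hχ) A

/-- The phases i^m and (−i)^m cancel in the Feynman part and leave (−1)^m in the homogeneous part.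
By `hA` the imaginary part of (−1)^m A compensates the jump of the mode on the cut. -/
lemma conj_wickConnected_bessel (P Q : ℝ[X]) (c : ℝ) (hk : 0 < k) (hν : RealOrImaginary ν) {A : ℂ}
    (hA : (-1) ^ e * cutFactor ν = (-1) ^ m * (A - conj A)) {χ₁ χ₂ : ℝ} (h₁ : 0 < χ₁)
    (h₂ : 0 < χ₂) :
    conj (wickConnected
      (fun χ => c * Complex.I ^ m * besselMode P Q e ν (-((2 * k * χ : ℝ) : ℂ)))
      (fun χ => c * (-Complex.I) ^ m * besselMode P Q e ν ((2 * k * χ : ℝ) : ℂ)) A χ₁ χ₂) =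
    wickConnected
      (fun χ => c * Complex.I ^ m * besselMode P Q e ν (-((2 * k * χ : ℝ) : ℂ)))
      (fun χ => c * (-Complex.I) ^ m * besselMode P Q e ν ((2 * k * χ : ℝ) : ℂ)) A χ₁ χ₂ := by
  refine conj_wickConnected (fun χ₁ χ₂ h₁ h₂ => ?_) h₁ h₂
  have hx₁ : 0 < 2 * k * χ₁ := by positivity
  have hx₂ : 0 < 2 * k * χ₂ := by positivity
  simp only [map_mul, map_add, map_zpow₀, map_neg, Complex.conj_I, Complex.conj_ofReal,
    conj_besselMode hν hx₁, conj_besselMode hν hx₂, conj_besselMode_neg hν hx₁, neg_neg]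
  have h3 := I_zpow_mul_neg_I_zpow m
  have h4 := neg_I_zpow m
  have h5 := neg_one_zpow_mul_self m
  rw [h4] at h3 ⊢
  linear_combination (c ^ 2 * besselMode P Q e ν ((2 * k * χ₁ : ℝ) : ℂ) *
    besselMode P Q e ν ((2 * k * χ₂ : ℝ) : ℂ)) * (Complex.I ^ m * Complex.I ^ m * (-1) ^ m) * hA +
    (c ^ 2 * besselMode P Q e ν ((2 * k * χ₁ : ℝ) : ℂ) *
    besselMode P Q e ν ((2 * k * χ₂ : ℝ) : ℂ)) * (Complex.I ^ m * Complex.I ^ m) * (-conj A) * h5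

/-- At the origin W behaves as z^{1/2−ν} and zW' as 1/2 − ν times it, so `hγ` says that the leading
coefficient is nonzero. The limit is the square of the phase of i^m (−i)^{e+1/2−ν}, the coefficient
being real. -/
lemma tendsto_late_of_isBesselMode (hσ : IsBesselMode σ c k m e ν P Q) (hc : c ≠ 0) (hk : 0 < k)
    (hν : 0 < ν.re) (hνr : conj ν = ν)
    (hγ : ((P.eval 0 : ℝ) : ℂ) + (1 / 2 - ν) * ((Q.eval 0 : ℝ) : ℂ) ≠ 0) :
    Tendsto (fun η₀ : ℝ => σ η₀ / conjMode σ η₀) (𝓝[<] 0)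
      (𝓝 (-((-1) ^ (m - e) * Complex.exp (Complex.I * Real.pi * (ν + 1 / 2))))) := by
  have h2k : 0 < 2 * k := by positivity
  have hνo : ((ν.re : ℝ) : ℂ) = ν := Complex.conj_eq_iff_re.1 hνr
  have g1 : Complex.Gamma (ν + 1 / 2) ≠ 0 := Complex.Gamma_ne_zero_of_re_pos (by simp; linarith)
  have g2 : Complex.Gamma (2 * ν) ≠ 0 := Complex.Gamma_ne_zero_of_re_pos (by simp; linarith)
  have harg := tendsto_late_arg h2k
  have harg0 := tendsto_nhds_of_tendsto_nhdsWithin harg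
  have hI := (tendsto_cpow_mul_tricomiInt (p := ν - 1 / 2) (q := ν - 1 / 2)
    (by simp; linarith) (by simp; linarith)).comp harg
  have hT := (tendsto_cpow_mul_tricomiInt (p := ν + 1 / 2) (q := ν - 1 / 2)
    (by simp; linarith) (by simp; linarith)).comp harg
  rw [show ν - 1 / 2 + (ν - 1 / 2) + 1 = 2 * ν by ring] at hI
  rw [show ν + 1 / 2 + (ν - 1 / 2) + 1 = 2 * ν + 1 by ring,
    Complex.Gamma_add_one _ (fun h => by rw [h] at g2; simp at g2)] at hT
  have hp : ∀ R : ℝ[X], Tendsto (fun y : ℝ => aeval ((((2 * k * y : ℝ) : ℂ) * -Complex.I) ^ 2) R)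
      (𝓝[>] 0) (𝓝 ((R.eval 0 : ℝ) : ℂ)) := fun R => by
    have hcont : Continuous fun z : ℂ => aeval (z ^ 2) R := by fun_prop
    have := (hcont.tendsto 0).comp harg0
    rw [zero_pow two_ne_zero] at this
    convert! this using 2
    rw [← Complex.ofReal_zero]
    exact (Polynomial.aeval_algebraMap_apply_eq_algebraMap_eval (0 : ℝ) R).symm
  have hexp : Tendsto (fun y : ℝ => Complex.exp (-(((2 * k * y : ℝ) : ℂ) * -Complex.I) / 2))
      (𝓝[>] 0) (𝓝 1) := by
    simpa [Function.comp_def] using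
      (Complex.continuous_exp.tendsto _).comp (harg0.neg.div_const 2)
  have hlin := (harg0.div_const 2).const_sub (ν + 1 / 2)
  rw [zero_div, sub_zero] at hlin
  have hg := (hexp.mul (((hp P).mul hI).add ((hp Q).mul ((hlin.mul hI).sub hT)))).const_mul
    (Complex.I ^ m * Complex.exp (-(Complex.I * (Real.pi / 2) * (e + (1 / 2 - ν)))) /
      Complex.Gamma (ν + 1 / 2))
  -- The second integral tends to Γ(2ν+1) = 2νΓ(2ν), which turns ν + 1/2 into 1/2 − ν.
  have hval : ((P.eval 0 : ℝ) : ℂ) * Complex.Gamma (2 * ν) + ((Q.eval 0 : ℝ) : ℂ) *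
      ((ν + 1 / 2) * Complex.Gamma (2 * ν) - 2 * ν * Complex.Gamma (2 * ν)) =
      (((P.eval 0 : ℝ) : ℂ) + (1 / 2 - ν) * ((Q.eval 0 : ℝ) : ℂ)) * Complex.Gamma (2 * ν) := by ring
  rw [hval, one_mul] at hg
  have key := tendsto_late_ratio hg (σ := σ)
    (mul_ne_zero (div_ne_zero (mul_ne_zero (zpow_ne_zero _ Complex.I_ne_zero)
      (Complex.exp_ne_zero _)) g1) (mul_ne_zero hγ g2))
    (fun y => c * (2 * k * y) ^ (e + (1 / 2 - ν.re))) (fun y hy => ?_)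
  · convert! key using 2
    rw [map_mul, map_div₀, map_mul, map_mul, ← Complex.Gamma_conj, ← Complex.Gamma_conj,
      ← Complex.exp_conj]
    simp only [map_mul, map_neg, map_sub, map_add, hνr, map_zpow₀, map_intCast,
      Complex.conj_I, map_div₀, map_one, map_ofNat, Complex.conj_ofReal]
    have e1 : Complex.exp (Complex.I * Real.pi * (ν + 1 / 2)) = -((-1) ^ e *
        (Complex.exp (-(Complex.I * (Real.pi / 2) * (e + (1 / 2 - ν)))) *
          Complex.exp (-(Complex.I * (Real.pi / 2) * (e + (1 / 2 - ν)))))) := by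
      have : ((-1 : ℂ)) ^ e = Complex.exp (Real.pi * Complex.I * e) := by
        rw [← Complex.exp_pi_mul_I, ← Complex.exp_int_mul]
        ring_nf
      rw [this, ← Complex.exp_add, ← Complex.exp_add, ← neg_one_mul, ← Complex.exp_pi_mul_I,
        ← Complex.exp_add]
      ring_nf
    have e2 : Complex.exp (-(-Complex.I * (Real.pi / 2) * (e + (1 / 2 - ν)))) =
        (Complex.exp (-(Complex.I * (Real.pi / 2) * (e + (1 / 2 - ν)))))⁻¹ := by
      rw [← Complex.exp_neg]
      ring_nf
    rw [e1, e2, neg_I_zpow, zpow_sub₀ (by norm_num)]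
    have n1 := Complex.exp_ne_zero (-(Complex.I * (Real.pi / 2) * (e + (1 / 2 - ν))))
    have n2 : Complex.I ^ m ≠ 0 := zpow_ne_zero _ Complex.I_ne_zero
    have n3 : ((-1 : ℂ)) ^ m ≠ 0 := zpow_ne_zero _ (by norm_num)
    have n4 : ((-1 : ℂ)) ^ e ≠ 0 := zpow_ne_zero _ (by norm_num)
    have n5 := neg_one_zpow_mul_self m
    generalize Complex.Gamma (2 * ν) = G₁ at *
    generalize Complex.Gamma (ν + 1 / 2) = G₂ at *
    generalize Complex.exp (-(Complex.I * (Real.pi / 2) * (e + (1 / 2 - ν)))) = E at *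
    generalize ((P.eval 0 : ℝ) : ℂ) + (1 / 2 - ν) * ((Q.eval 0 : ℝ) : ℂ) = γ at *
    generalize Complex.I ^ m = J at *
    generalize ((-1 : ℂ)) ^ m = s at *
    generalize ((-1 : ℂ)) ^ e = t at *
    field_simp
    linear_combination n5
  · have hy2 : 0 < 2 * k * y := by positivity
    refine ⟨mul_ne_zero hc (Real.rpow_pos_of_pos hy2 _).ne', ?_⟩
    have hz0 : ((2 * k * y : ℝ) : ℂ) * -Complex.I ≠ 0 :=
      mul_ne_zero (by exact_mod_cast hy2.ne') (by simp)
    have earg : 2 * Complex.I * k * (-(y : ℂ)) = ((2 * k * y : ℝ) : ℂ) * -Complex.I := by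
      push_cast; ring
    have epow : (((2 * k * y : ℝ) : ℂ) * -Complex.I) ^ e =
        (((2 * k * y) ^ (e + (1 / 2 - ν.re)) : ℝ) : ℂ) *
          Complex.exp (-(Complex.I * (Real.pi / 2) * (e + (1 / 2 - ν)))) *
          (((2 * k * y : ℝ) : ℂ) * -Complex.I) ^ (ν - 1 / 2) := by
      rw [Complex.ofReal_cpow hy2.le, ← Complex.cpow_intCast]
      push_cast [hνo]
      have := ofReal_mul_neg_I_cpow hy2 (e + (1 / 2 - ν))
      push_cast at this hz0
      rw [← this, ← Complex.cpow_add _ _ hz0]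
      ring_nf
    rw [hσ _ (by simpa using hy), earg, besselMode, besselW, besselV, tricomiU_zero, epow]
    simp only [Function.comp_apply]
    push_cast
    ring

end BesselMode

/-! ### The recursion in the number of spatial indices. -/

lemma ofReal_mul_cpow {x : ℝ} (hx : 0 < x) {w : ℂ} (hw : w ≠ 0) (a : ℂ) :
    ((x : ℂ) * w) ^ a = (x : ℂ) ^ a * w ^ a := by
  have hx0 : (x : ℂ) ≠ 0 := by exact_mod_cast hx.ne'
  rw [Complex.cpow_def_of_ne_zero (mul_ne_zero hx0 hw), Complex.cpow_def_of_ne_zero hx0,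
    Complex.cpow_def_of_ne_zero hw, Complex.log_ofReal_mul hx hw, ← Complex.exp_add,
    Complex.ofReal_log hx.le, add_mul]

lemma two_I_mul_mem_slitPlane {k : ℝ} (hk : 0 < k) {η : ℂ} (hη : η.re < 0) :
    2 * Complex.I * k * η ∈ Complex.slitPlane := by
  refine Or.inr ?_
  have : (2 * Complex.I * k * η).im = 2 * k * η.re := by simp
  rw [this]
  exact (mul_neg_of_pos_of_neg (by positivity) hη).ne

lemma deriv_of_isBesselMode {σ : ℂ → ℂ} {c k : ℝ} {m e : ℤ} {ν : ℂ} {P Q : ℝ[X]}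
    (hσ : IsBesselMode σ c k m e ν P Q) (hk : 0 < k) (hν : 0 ≤ ν.re) {η : ℂ} (hη : η.re < 0) :
    deriv σ η = c * Complex.I ^ m * (deriv (besselMode P Q e ν) (2 * Complex.I * k * η) *
      (2 * Complex.I * k)) := by
  have hev : σ =ᶠ[𝓝 η] fun η => c * Complex.I ^ m * besselMode P Q e ν (2 * Complex.I * k * η) := by
    filter_upwards [(isOpen_lt Complex.continuous_re continuous_const).mem_nhds hη] with w hw
    exact hσ w hw
  have hd := (hasDerivAt_besselMode (P := P) (Q := Q) (e := e) hν
    (two_I_mul_mem_slitPlane hk hη)).differentiableAt.hasDerivAt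
  have hl : HasDerivAt (fun η : ℂ => 2 * Complex.I * k * η) (2 * Complex.I * k) η := by
    simpa using (hasDerivAt_id η).const_mul (2 * Complex.I * k)
  rw [hev.deriv_eq]
  exact ((hd.comp η hl).const_mul _).deriv

/-- The polynomial coefficient of `W_{0,ν}` after one step of the recursion in the number of
spatial indices. -/
noncomputable def stepP (s : ℝ) (e : ℤ) (P Q : ℝ[X]) : ℝ[X] :=
  C (2 * (e : ℝ) - 4) * P + C 4 * X * derivative P + (C (1 / 2) * X + C (2 * s - 1 / 2)) * Q

/-- The polynomial coefficient of `z W_{0,ν}'` after one step of the recursion in the number of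
spatial indices. -/
noncomputable def stepQ (e : ℤ) (P Q : ℝ[X]) : ℝ[X] :=
  C 2 * P + C (2 * (e : ℝ) - 2) * Q + C 4 * X * derivative Q

/-- With z = 2ikη the operator −(i/k)(∂_η − 2/η) becomes 2∂_z − 4/z. No i is left and ν² is real, so
the polynomials stay real. -/
lemma besselMode_step {P Q : ℝ[X]} {e : ℤ} {ν z : ℂ} {s : ℝ} (hs : ν ^ 2 = s) (hν : 0 ≤ ν.re)
    (hz : z ∈ Complex.slitPlane) :
    2 * deriv (besselMode P Q e ν) z - 4 / z * besselMode P Q e ν z =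
      besselMode (stepP s e P Q) (stepQ e P Q) (e - 1) ν z := by
  have hz0 := Complex.slitPlane_ne_zero hz
  have he : z ^ e = z ^ (e - 1) * z := by rw [zpow_sub_one₀ hz0]; field_simp
  rw [(hasDerivAt_besselMode hν hz).deriv, besselMode, besselMode, he, hs]
  simp only [stepP, stepQ, map_add, map_mul, aeval_C, aeval_X, Complex.coe_algebraMap]
  push_cast
  field_simp
  ring

lemma besselMode_sum {ι : Type*} (t : Finset ι) (P Q : ι → ℝ[X]) (e : ℤ) (ν z : ℂ) :
    besselMode (∑ i ∈ t, P i) (∑ i ∈ t, Q i) e ν z = ∑ i ∈ t, besselMode (P i) (Q i) e ν z := by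
  simp only [besselMode, map_sum, Finset.sum_mul, ← Finset.sum_add_distrib, Finset.mul_sum]

lemma besselMode_add (P Q P' Q' : ℝ[X]) (e : ℤ) (ν z : ℂ) :
    besselMode (P + P') (Q + Q') e ν z = besselMode P Q e ν z + besselMode P' Q' e ν z := by
  simp only [besselMode, map_add]
  ring

lemma besselMode_monomial_mul (P Q : ℝ[X]) (b : ℝ) (j : ℕ) (e : ℤ) (ν : ℂ) {z : ℂ} (hz : z ≠ 0) :
    besselMode (C b * X ^ j * P) (C b * X ^ j * Q) e ν z =
      b * besselMode P Q (e + 2 * j) ν z := by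
  have h : z ^ (e + 2 * (j : ℤ)) = z ^ e * (z ^ 2) ^ j := by
    rw [zpow_add₀ hz, zpow_mul, zpow_natCast]
    norm_cast
  simp only [besselMode, map_mul, aeval_C, map_pow, aeval_X, h, Complex.coe_algebraMap]
  ring

/-! ### Collider modes as combinations of W and its derivative. -/

namespace CCField

variable (p : CCField) {k : ℝ} (h : ℤ)

lemma Z_neg (k : ℝ) : p.Z k (-h) = p.Z k h := by simp only [Z, Int.natAbs_neg]

lemma modeAux_neg (k : ℝ) (N : ℕ) : p.modeAux k (-h) N = p.modeAux k h N := by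
  induction N using Nat.strong_induction_on with
  | _ N ih =>
    rcases N with _ | N
    · simp only [modeAux, Z_neg, Int.natAbs_neg]
    · have h1 := ih N (Nat.lt_succ_self N)
      have h2 : ∀ m : Fin (N + 1), p.modeAux k (-h) m = p.modeAux k h m := fun m => ih m m.2
      simp only [modeAux, Int.natAbs_neg, h1, h2]

lemma mode_neg (k : ℝ) (r : ℕ) : p.mode k r (-h) = p.mode k r h := by
  rw [mode, mode, Int.natAbs_neg, modeAux_neg]

lemma B_eq_zero_of_odd {m r : ℕ} (hr : Odd (r - m)) : B m r = 0 := by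
  obtain ⟨j, hj⟩ := hr
  have hj' : (r : ℝ) = m + 2 * j + 1 := by
    have : r = m + 2 * j + 1 := by omega
    exact_mod_cast this
  have : Real.Gamma ((1 + m - r) / 2) = 0 := by
    rw [show ((1 + m - r : ℝ)) / 2 = -(j : ℝ) by rw [hj']; ring]
    exact Real.Gamma_neg_nat_eq_zero j
  rw [B, this, div_zero, mul_zero]

/-- The normalisation of the mode function as a Bessel mode. -/
noncomputable def modeNorm (p : CCField) (k : ℝ) (h : ℤ) : ℝ :=
  p.Z k h * (Real.sqrt (2 / Real.pi) * 2 ^ ((h.natAbs : ℤ) - 1))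

/-- The prefactor e^{iπ(ν+1/2)/2} cancels the constant phase in Hankel's integral, and z = −2i(−kη)
matches the integrands; the remaining powers of 2 and i form the normalisation. -/
lemma isBesselMode_modeAux_zero (hk : 0 < k) :
    IsBesselMode (p.modeAux k h 0) (p.modeNorm k h) k (1 - h.natAbs) (1 - h.natAbs) p.nu 1 0 := by
  intro η hη
  set d := h.natAbs
  set w : ℂ := -(k : ℂ) * η with hw
  have hwre : 0 < w.re := by
    have : w.re = -k * η.re := by simp [hw]
    rw [this]
    exact mul_pos_of_neg_of_neg (by linarith) hη
  have hw0 : w ≠ 0 := fun h0 => by simp [h0] at hwre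
  have hz : 2 * Complex.I * k * η = -2 * Complex.I * w := by rw [hw]; ring
  have harg : w.arg ≠ Real.pi := fun h0 => by
    have := (Complex.arg_eq_pi_iff.1 h0).1
    linarith
  have hpow : w ^ (3 / 2 - (d : ℂ)) * (2 / (Real.pi * w)) ^ (1 / 2 : ℂ) =
      (Real.sqrt (2 / Real.pi) : ℝ) * w ^ (1 - (d : ℤ)) := by
    have e1 : (2 / (Real.pi * w) : ℂ) = ((2 / Real.pi : ℝ) : ℂ) * w⁻¹ := by
      push_cast
      field_simp
    rw [e1, ofReal_mul_cpow (by positivity) (inv_ne_zero hw0), ofReal_cpow_half (by positivity),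
      Complex.inv_cpow _ _ harg, ← Complex.cpow_neg, mul_left_comm, ← Complex.cpow_add _ _ hw0,
      ← Complex.cpow_intCast]
    push_cast
    ring_nf
  have hzpow : Complex.I ^ (1 - (d : ℤ)) * (-2 * Complex.I * w) ^ (1 - (d : ℤ)) *
      2 ^ ((d : ℤ) - 1) = w ^ (1 - (d : ℤ)) := by
    rw [← mul_zpow, show Complex.I * (-2 * Complex.I * w) = 2 * w by
      linear_combination (-2 * w) * Complex.I_sq, mul_zpow,
      show (d : ℤ) - 1 = -(1 - d) by ring, zpow_neg]
    field_simp
  have hint : ∫ t in Set.Ioi (0 : ℝ), Complex.exp (-(t : ℂ)) * (t : ℂ) ^ (p.nu - 1 / 2) *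
        (1 + Complex.I * (t : ℂ) / (2 * w)) ^ (p.nu - 1 / 2) =
      tricomiInt (p.nu - 1 / 2) (p.nu - 1 / 2) (-2 * Complex.I * w) := by
    have : ∀ t : ℝ, Complex.I * (t : ℂ) / (2 * w) = t / (-2 * Complex.I * w) := fun t => by
      field_simp
      linear_combination (t : ℂ) * Complex.I_sq
    simp only [tricomiInt, tricomiKernel, this]
  have hexp : Complex.exp (Complex.I * Real.pi * (p.nu + 1 / 2) / 2) *
      Complex.exp (Complex.I * (w - p.nu * Real.pi / 2 - Real.pi / 4)) =
        Complex.exp (-(-2 * Complex.I * w) / 2) := by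
    rw [← Complex.exp_add]
    ring_nf
  rw [modeAux]
  beta_reduce
  rw [← hw, hankelOne, hint, hz, besselMode, besselW, tricomiU_zero, ← hexp, modeNorm,
    show h.natAbs = d from rfl]
  simp only [map_one, map_zero, zero_mul, add_zero, one_mul, Complex.ofReal_mul,
    Complex.ofReal_zpow, Complex.ofReal_ofNat]
  linear_combination (Complex.exp (Complex.I * Real.pi * (p.nu + 1 / 2) / 2) * p.Z k h *
    Complex.exp (Complex.I * (w - p.nu * Real.pi / 2 - Real.pi / 4)) *
    tricomiInt (p.nu - 1 / 2) (p.nu - 1 / 2) (-2 * Complex.I * w) /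
      Complex.Gamma (p.nu + 1 / 2)) * (hpow - (Real.sqrt (2 / Real.pi) : ℂ) * hzpow)

/-- Strong induction, since each mode involves all lower ones. The leading late-time coefficient is
carried along because its nonvanishing is what the limit of σ/σ* requires. -/
lemma exists_isBesselMode_modeAux (hk : 0 < k) (hν : 0 ≤ p.nu.re) {s : ℝ} (hs : p.nu ^ 2 = s)
    (N : ℕ) : ∃ P Q : ℝ[X], IsBesselMode (p.modeAux k h N) (p.modeNorm k h) k (1 - h.natAbs)
      (1 - h.natAbs - N) p.nu P Q ∧
      ((P.eval 0 : ℝ) : ℂ) + (1 / 2 - p.nu) * ((Q.eval 0 : ℝ) : ℂ) ≠ 0 := by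
  induction N using Nat.strong_induction_on with
  | _ N ih =>
    rcases N with _ | N
    · refine ⟨1, 0, by simpa using p.isBesselMode_modeAux_zero h hk, by simp⟩
    have ih' : ∀ m : Fin (N + 1), _ := fun m => ih m m.2
    choose P Q hσ hγ using ih'
    set d := h.natAbs
    set e : ℤ := 1 - d - N with he
    set b : Fin (N + 1) → ℝ := fun m => B (d + m) (d + N + 1)
    set j : Fin (N + 1) → ℕ := fun m => (N + 1 - m) / 2
    -- Lower modes of the wrong parity drop out. The others exceed the new exponent by 2j with j ≥
    -- 1, so they enter through polynomials divisible by X and leave the leading coefficient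
    -- unchanged.
    have hbj : ∀ m, b m = 0 ∨ (N : ℤ) + 1 - (m : ℕ) = 2 * j m ∧ j m ≠ 0 := fun m => by
      rcases Nat.even_or_odd (N + 1 - m) with hm | hm
      · have := m.2
        obtain ⟨a, ha⟩ := hm
        have hj : j m = (N + 1 - m) / 2 := rfl
        exact Or.inr ⟨by omega, by omega⟩
      · refine Or.inl (B_eq_zero_of_odd ?_)
        rwa [show d + N + 1 - (d + m) = N + 1 - m by omega]
    set P₀ := P (Fin.last N)
    set Q₀ := Q (Fin.last N)
    have hσ₀ : IsBesselMode (p.modeAux k h N) (p.modeNorm k h) k (1 - d) e p.nu P₀ Q₀ := by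
      simpa using hσ (Fin.last N)
    have hγ₀ : ((P₀.eval 0 : ℝ) : ℂ) + (1 / 2 - p.nu) * ((Q₀.eval 0 : ℝ) : ℂ) ≠ 0 :=
      hγ (Fin.last N)
    refine ⟨stepP s e P₀ Q₀ + ∑ m, C (b m) * X ^ j m * P m,
      stepQ e P₀ Q₀ + ∑ m, C (b m) * X ^ j m * Q m, fun η hη => ?_, ?_⟩
    · have hz := two_I_mul_mem_slitPlane hk hη
      have hz0 := Complex.slitPlane_ne_zero hz
      have hη0 : η ≠ 0 := fun h0 => by simp [h0] at hη
      have hk0 : (k : ℂ) ≠ 0 := by exact_mod_cast hk.ne'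
      have hsum : ∀ m : Fin (N + 1), (b m : ℂ) * p.modeAux k h m η =
          p.modeNorm k h * Complex.I ^ (1 - (d : ℤ)) *
            besselMode (C (b m) * X ^ j m * P m) (C (b m) * X ^ j m * Q m) (e - 1) p.nu
              (2 * Complex.I * k * η) := fun m => by
        rw [besselMode_monomial_mul _ _ _ _ _ _ hz0, hσ m η hη]
        rcases hbj m with h0 | ⟨h0, -⟩
        · simp [h0]
        · rw [show e - 1 + 2 * (j m : ℤ) = 1 - d - (m : ℕ) by omega]
          ring
      have hder : -(Complex.I / k) * (deriv (p.modeAux k h N) η - 2 / η * p.modeAux k h N η) =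
          p.modeNorm k h * Complex.I ^ (1 - (d : ℤ)) *
            besselMode (stepP s e P₀ Q₀) (stepQ e P₀ Q₀) (e - 1) p.nu
              (2 * Complex.I * k * η) := by
        rw [deriv_of_isBesselMode hσ₀ hk hν hη, hσ₀ η hη, ← besselMode_step hs hν hz]
        generalize besselMode P₀ Q₀ e p.nu (2 * Complex.I * k * η) = F
        generalize deriv (besselMode P₀ Q₀ e p.nu) (2 * Complex.I * k * η) = F'
        field_simp
        linear_combination (p.modeNorm k h * (-4 * k * η * Complex.I * F' + 4 * F)) * Complex.I_sq
      rw [modeAux]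
      beta_reduce
      rw [hder, besselMode_add, besselMode_sum, mul_add, Finset.mul_sum]
      rw [show (1 - (d : ℤ) - ((N + 1 : ℕ) : ℤ)) = e - 1 by push_cast; omega]
      congr 1
      exact Finset.sum_congr rfl fun m _ => hsum m
    · have hvan : ∀ (R : Fin (N + 1) → ℝ[X]),
          (∑ m, C (b m) * X ^ j m * R m).eval 0 = 0 := fun R => by
        rw [eval_finsetSum]
        refine Finset.sum_eq_zero fun m _ => ?_
        rcases hbj m with h0 | ⟨-, h0⟩
        · simp [h0]
        · simp [h0]
      -- The factor by which one step multiplies the leading coefficient; e ≤ 1 and Re ν ≥ 0 make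
      -- its real part at most −1.
      have hfac : (2 * (e : ℂ) - 3 - 2 * p.nu) ≠ 0 := fun h0 => by
        have := congrArg Complex.re h0
        simp [he] at this
        linarith
      have : (((stepP s e P₀ Q₀ + ∑ m, C (b m) * X ^ j m * P m).eval 0 : ℝ) : ℂ) +
          (1 / 2 - p.nu) * (((stepQ e P₀ Q₀ + ∑ m, C (b m) * X ^ j m * Q m).eval 0 : ℝ) : ℂ) =
          (2 * (e : ℂ) - 3 - 2 * p.nu) *
            (((P₀.eval 0 : ℝ) : ℂ) + (1 / 2 - p.nu) * ((Q₀.eval 0 : ℝ) : ℂ)) := by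
        rw [eval_add, hvan, eval_add, hvan]
        simp only [stepP, stepQ, eval_add, eval_mul, eval_C, eval_X, mul_zero, zero_mul, zero_add,
          add_zero]
        push_cast
        rw [← hs]
        ring
      rw [this]
      exact mul_ne_zero hfac hγ₀

end CCField

/-! ### Collider fields: reality, late-time limits and indexed components. -/

lemma IsWickRotation.unique {C : ℂ → ℂ → ℂ} {Ct Ct' : ℝ → ℝ → ℂ} (h : IsWickRotation C Ct)
    (h' : IsWickRotation C Ct') {χ₁ χ₂ : ℝ} (h₁ : 0 < χ₁) (h₂ : 0 < χ₂) : Ct χ₁ χ₂ = Ct' χ₁ χ₂ :=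
  tendsto_nhds_unique (h χ₁ χ₂ h₁ h₂) (h' χ₁ χ₂ h₁ h₂)

lemma cutFactor_eq (ν : ℂ) :
    cutFactor ν = Complex.I * (Complex.exp (Complex.I * Real.pi * conj ν) +
      Complex.exp (-(Complex.I * Real.pi * conj ν))) := by
  rw [cutFactor, CCMField.exp_I_pi_half_shift, CCMField.exp_neg_I_pi_half_shift]
  ring

namespace CCField

variable {p : CCField} {k : ℝ} {r : ℕ} {h : ℤ}

lemma nu_of_isHeavy (hH : 0 < p.hubble) (hp : p.IsHeavy) : p.nu = Complex.I * p.mu := by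
  have : ((p.spin : ℝ) - 1 / 2) ^ 2 - p.mass ^ 2 / p.hubble ^ 2 ≤ 0 := by
    rw [sub_nonpos, le_div_iff₀ (by positivity), mul_comm]
    exact hp
  rw [nu, ofReal_cpow_half_of_nonpos this, mu, neg_sub]

lemma nu_of_isLight (hp : p.IsLight) : ∃ x : ℝ, 0 < x ∧ p.nu = x := by
  have : 0 < ((p.spin : ℝ) - 1 / 2) ^ 2 - p.mass ^ 2 / p.hubble ^ 2 := by
    rcases hp with ⟨-, hp⟩ | ⟨T, hT, -, hp⟩
    · exact sub_pos.2 hp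
    · have : (1 : ℝ) ≤ T := by exact_mod_cast hT
      rw [hp]
      nlinarith
  exact ⟨_, Real.sqrt_pos.2 this, ofReal_cpow_half this.le⟩

lemma nu_sq (p : CCField) :
    p.nu ^ 2 = ((((p.spin : ℝ) - 1 / 2) ^ 2 - p.mass ^ 2 / p.hubble ^ 2 : ℝ) : ℂ) := by
  rw [nu, ← Complex.cpow_nat_mul]
  simp

lemma mem_helicities : h ∈ p.helicities r ↔ |h| ≤ (r : ℤ) ∧ p.nu.re < (h.natAbs : ℝ) + 1 / 2 := by
  rw [helicities, Finset.mem_filter, Finset.mem_Icc, abs_le]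

lemma neg_mem_helicities (hh : h ∈ p.helicities r) : -h ∈ p.helicities r := by
  rwa [mem_helicities, abs_neg, Int.natAbs_neg, ← mem_helicities]

lemma exists_isBesselMode_mode (p : CCField) (hk : 0 < k) (hν : 0 ≤ p.nu.re) (r : ℕ) (h : ℤ) :
    ∃ P Q : ℝ[X], IsBesselMode (p.mode k r h) (p.modeNorm k h) k (1 - h.natAbs)
      (1 - h.natAbs - (r - h.natAbs : ℕ)) p.nu P Q ∧
      ((P.eval 0 : ℝ) : ℂ) + (1 / 2 - p.nu) * ((Q.eval 0 : ℝ) : ℂ) ≠ 0 :=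
  p.exists_isBesselMode_modeAux h hk hν p.nu_sq _

lemma vanishesInFarPast_mode (hk : 0 < k) (hν : 0 ≤ p.nu.re) (A : ℂ) :
    VanishesInFarPast (connected (p.mode k r h) A) := by
  obtain ⟨P, Q, hσ, -⟩ := p.exists_isBesselMode_mode hk hν r h
  exact vanishesInFarPast_connected (hasFarPastGrowth_of_isBesselMode hσ hk hν) A

/-- The exponents of i and of z differ by r − |h|, so the sign in front of A is exactly the one that
reduces reality to a condition independent of h and r. -/
lemma realAfterWick_mode (hk : 0 < k) (hν : RealOrImaginary p.nu) {A : ℂ}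
    (hA : cutFactor p.nu = A - conj A) :
    RealAfterWick (connected (p.mode k r h) ((-1) ^ (r - h.natAbs) * A)) := by
  obtain ⟨P, Q, hσ, -⟩ := p.exists_isBesselMode_mode hk hν.re_nonneg r h
  refine ⟨_, isWickRotation_of_isBesselMode hσ hk hν _, fun χ₁ χ₂ h₁ h₂ =>
    conj_wickConnected_bessel P Q _ hk hν ?_ h₁ h₂⟩
  rw [zpow_sub₀ (by norm_num), zpow_natCast, hA, map_mul, map_pow, map_neg, map_one,
    div_mul_eq_mul_div, div_eq_iff (pow_ne_zero _ (by norm_num))]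
  have : ((-1 : ℂ) ^ (r - h.natAbs)) * (-1) ^ (r - h.natAbs) = 1 := by
    rw [← mul_pow]
    simp
  linear_combination (-(-1 : ℂ) ^ (1 - (h.natAbs : ℤ)) * (A - conj A)) * this

lemma cutFactor_of_isHeavy (hH : 0 < p.hubble) (hp : p.IsHeavy) :
    cutFactor p.nu = Complex.I * ((Real.cosh (Real.pi * p.mu) : ℝ) : ℂ) -
      conj (Complex.I * ((Real.cosh (Real.pi * p.mu) : ℝ) : ℂ)) := by
  have hc : conj p.nu = -(Complex.I * p.mu) := by rw [nu_of_isHeavy hH hp]; simp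
  rw [cutFactor_eq, hc, mul_neg, neg_neg, CCMField.exp_neg_I_pi_mul, CCMField.exp_I_pi_mul,
    map_mul, Complex.conj_I, Complex.conj_ofReal, Real.cosh_eq]
  push_cast
  ring

lemma cutFactor_of_isLight (hp : p.IsLight) :
    cutFactor p.nu = Complex.exp (Complex.I * Real.pi * (p.nu + 1 / 2)) -
      conj (Complex.exp (Complex.I * Real.pi * (p.nu + 1 / 2))) := by
  obtain ⟨x, -, hν⟩ := nu_of_isLight hp
  have e1 : Complex.exp (Complex.I * Real.pi * (x + 1 / 2)) =
      Complex.I * Complex.exp (Complex.I * Real.pi * x) := by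
    rw [show Complex.I * Real.pi * (x + 1 / 2 : ℂ) =
      Real.pi / 2 * Complex.I + Complex.I * Real.pi * x by ring, Complex.exp_add,
      Complex.exp_pi_div_two_mul_I]
  rw [cutFactor_eq, hν, e1, map_mul, ← Complex.exp_conj]
  simp only [map_mul, Complex.conj_I, Complex.conj_ofReal]
  ring_nf

/-- For propagating helicities ν < |h| + 1/2 ≤ S + 1/2, so all four Gamma arguments are positive.
Without this σ could vanish identically and σ/σ* would carry no information. -/
lemma Z_pos_of_isLight (hH : 0 < p.hubble) (hk : 0 < k) (hr : r ≤ p.spin) (hp : p.IsLight)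
    (hh : h ∈ p.helicities r) : 0 < p.Z k h := by
  obtain ⟨x, hx, hν⟩ := nu_of_isLight hp
  obtain ⟨h1, h2⟩ := mem_helicities.1 hh
  rw [hν, Complex.ofReal_re] at h2
  have hS : (h.natAbs : ℝ) ≤ p.spin := by
    have : h.natAbs ≤ p.spin := by have := Int.natCast_natAbs h; omega
    exact_mod_cast this
  set d := h.natAbs
  have hG : (Complex.Gamma (1 / 2 + d + p.nu) * Complex.Gamma (1 / 2 + d - p.nu) /
      (Complex.Gamma (1 / 2 + p.spin + p.nu) * Complex.Gamma (1 / 2 + p.spin - p.nu))) =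
      ((Real.Gamma (1 / 2 + d + x) * Real.Gamma (1 / 2 + d - x) /
        (Real.Gamma (1 / 2 + p.spin + x) * Real.Gamma (1 / 2 + p.spin - x)) : ℝ) : ℂ) := by
    rw [hν]
    push_cast [← Complex.Gamma_ofReal]
    rfl
  have g2 := Real.Gamma_pos_of_pos (s := 1 / 2 + d - x) (by linarith)
  have g4 := Real.Gamma_pos_of_pos (s := 1 / 2 + p.spin - x) (by linarith)
  rw [Z, Real.sqrt_pos, hG, Complex.ofReal_re]
  have := Real.pi_pos
  positivity

lemma tendsto_mode_late (hH : 0 < p.hubble) (hk : 0 < k) (hr : r ≤ p.spin) (hp : p.IsLight)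
    (hh : h ∈ p.helicities r) :
    Tendsto (fun η₀ : ℝ => p.mode k r h η₀ / conjMode (p.mode k r h) η₀) (𝓝[<] 0)
      (𝓝 (-p.lightCoeff r h)) := by
  obtain ⟨x, hx, hν⟩ := nu_of_isLight hp
  have hν0 : 0 < p.nu.re := by simpa [hν] using hx
  obtain ⟨P, Q, hσ, hγ⟩ := p.exists_isBesselMode_mode hk hν0.le r h
  have hc : p.modeNorm k h ≠ 0 :=
    mul_ne_zero (Z_pos_of_isLight hH hk hr hp hh).ne' (by positivity)
  have := tendsto_late_of_isBesselMode hσ hc hk hν0 (by simp [hν]) hγ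
  rwa [sub_sub_cancel, zpow_natCast] at this

lemma vanishesInFarPast_indexed (n k : Vec3) {C : ℤ → ℂ → ℂ → ℂ}
    (hC : ∀ h ∈ p.helicities r, VanishesInFarPast (C h)) (i j : Fin r → Fin 3) :
    VanishesInFarPast (p.indexed n k r C i j) :=
  vanishesInFarPast_sum _ _ _ hC

/-- The Wick rotations are chosen separately for each helicity; uniqueness of limits identifies
those of h and −h, after which conjugation only flips h in the tensors. -/
lemma realAfterWick_indexed (n k : Vec3) {C : ℤ → ℂ → ℂ → ℂ}
    (hC : ∀ h ∈ p.helicities r, RealAfterWick (C h)) (hneg : ∀ h, C (-h) = C h)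
    (i j : Fin r → Fin 3) : RealAfterWick (p.indexed n k r C i j) := by
  choose! Ct hCt using hC
  refine ⟨_, isWickRotation_sum _ _ fun h hh => (hCt h hh).1, fun χ₁ χ₂ h₁ h₂ => ?_⟩
  rw [map_sum]
  refine Finset.sum_bij' (fun h _ => -h) (fun h _ => -h) (fun _ => neg_mem_helicities)
    (fun _ => neg_mem_helicities) (by simp) (by simp) fun h hh => ?_
  have hr := (mem_helicities.1 hh).1
  have e : Ct h χ₁ χ₂ = Ct (-h) χ₁ χ₂ :=
    (hCt h hh).1.unique (hneg h ▸ (hCt (-h) (neg_mem_helicities hh)).1) h₁ h₂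
  rw [map_mul, map_mul, (hCt h hh).2 _ _ h₁ h₂, conj_ccPol n k r hr i, conj_ccPol n k r hr j, e]

lemma heavyC_neg (k : ℝ) (r : ℕ) (h : ℤ) : p.heavyC k r (-h) = p.heavyC k r h := by
  simp only [heavyC, heavyCoeff, mode_neg, Int.natAbs_neg]

lemma lightC_neg (k : ℝ) (r : ℕ) (h : ℤ) : p.lightC k r (-h) = p.lightC k r h := by
  simp only [lightC, lightCoeff, mode_neg, Int.natAbs_neg]

end CCField

end DeSitterPropagators

theorem mainTheorem4
    -- the momentum, and the reference direction of the polarisation vectors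
    (n k : Vec3) (hn : ‖n‖ = 1) (hnk : LinearIndependent ℝ ![n, k]) :
    -- CCM
    (∀ p : CCMField, 0 < p.hubble → (∀ h : ℤ, |h| ≤ (p.spin : ℤ) → 0 < p.cSq h) →
      -- heavy fields
      (p.IsHeavy →
        (∀ h : ℤ, |h| ≤ (p.spin : ℤ) → VanishesInFarPast (p.heavyC ‖k‖ h)) ∧
        HelicallyReal p.spin (p.heavyC ‖k‖) ∧
        ∀ i j : Fin p.spin → Fin 3,
          VanishesInFarPast (p.indexed n k (p.heavyC ‖k‖) i j) ∧
          RealAfterWick (p.indexed n k (p.heavyC ‖k‖) i j)) ∧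
      -- light fields
      (p.IsLight →
        (∀ h : ℤ, |h| ≤ (p.spin : ℤ) →
          HasLateLimit (fun η₀ => p.G ‖k‖ η₀ h) (p.lightC ‖k‖ h) ∧
          HasLateLimit (fun η₀ => p.lightF ‖k‖ η₀ h) 0 ∧
          VanishesInFarPast (p.lightC ‖k‖ h)) ∧
        HelicallyReal p.spin (p.lightC ‖k‖) ∧
        ∀ i j : Fin p.spin → Fin 3,
          HasLateLimit (fun η₀ => p.indexed n k (p.G ‖k‖ η₀) i j)
            (p.indexed n k (p.lightC ‖k‖) i j) ∧
          VanishesInFarPast (p.indexed n k (p.lightC ‖k‖) i j) ∧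
          RealAfterWick (p.indexed n k (p.lightC ‖k‖) i j))) ∧
    -- CC, components with r spatial indices
    (∀ p : CCField, 0 < p.hubble → ∀ r : ℕ, r ≤ p.spin →
      -- heavy fields
      (p.IsHeavy →
        (∀ h ∈ p.helicities r,
          VanishesInFarPast (p.heavyC ‖k‖ r h) ∧ RealAfterWick (p.heavyC ‖k‖ r h)) ∧
        ∀ i j : Fin r → Fin 3,
          VanishesInFarPast (p.indexed n k r (p.heavyC ‖k‖ r) i j) ∧
          RealAfterWick (p.indexed n k r (p.heavyC ‖k‖ r) i j)) ∧
      -- light fields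
      (p.IsLight →
        (∀ h ∈ p.helicities r,
          HasLateLimit (fun η₀ => p.G ‖k‖ r η₀ h) (p.lightC ‖k‖ r h) ∧
          HasLateLimit (fun η₀ => p.lightF ‖k‖ r η₀ h) 0 ∧
          VanishesInFarPast (p.lightC ‖k‖ r h) ∧ RealAfterWick (p.lightC ‖k‖ r h)) ∧
        ∀ i j : Fin r → Fin 3,
          HasLateLimit (fun η₀ => p.indexed n k r (p.G ‖k‖ r η₀) i j)
            (p.indexed n k r (p.lightC ‖k‖ r) i j) ∧
          VanishesInFarPast (p.indexed n k r (p.lightC ‖k‖ r) i j) ∧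
          RealAfterWick (p.indexed n k r (p.lightC ‖k‖ r) i j))) := by
  have hk : 0 < ‖k‖ := norm_pos_iff.2 (by simpa using hnk.ne_zero 1)
  refine ⟨fun p hH hc => ⟨fun hp => ?_, fun hp => ?_⟩,
    fun p hH r hr => ⟨fun hp => ?_, fun hp => ?_⟩⟩
  · have hν : RealOrImaginary p.nu := by
      rw [CCMField.nu_of_isHeavy hH hp]
      exact realOrImaginary_I_mul _
    have hfar : ∀ h : ℤ, |h| ≤ (p.spin : ℤ) → VanishesInFarPast (p.heavyC ‖k‖ h) := fun h hh =>
      CCMField.vanishesInFarPast_mode hc hk hν p.heavyCoeff hh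
    have hreal : HelicallyReal p.spin (p.heavyC ‖k‖) :=
      CCMField.helicallyReal_mode hc hk hν (CCMField.isWickReal_heavyCoeff hH hp)
    exact ⟨hfar, hreal, fun i j => ⟨p.vanishesInFarPast_indexed n k hfar i j,
      p.realAfterWick_indexed n k hreal i j⟩⟩
  · have hν : RealOrImaginary p.nu := by
      obtain ⟨x, hx, hν⟩ := CCMField.nu_of_isLight hH hp
      rw [hν]
      exact realOrImaginary_ofReal hx.le
    have hfar : ∀ h : ℤ, |h| ≤ (p.spin : ℤ) → VanishesInFarPast (p.lightC ‖k‖ h) := fun h hh =>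
      CCMField.vanishesInFarPast_mode hc hk hν p.lightCoeff hh
    have hreal : HelicallyReal p.spin (p.lightC ‖k‖) :=
      CCMField.helicallyReal_mode hc hk hν (CCMField.isWickReal_lightCoeff hH hp)
    have hlate := fun (h : ℤ) (hh : |h| ≤ (p.spin : ℤ)) =>
      CCMField.tendsto_mode_late hH hp hk (hc h hh)
    exact ⟨fun h hh => ⟨hasLateLimit_bulkBulk (hlate h hh), hasLateLimit_factorised (hlate h hh),
      hfar h hh⟩, hreal, fun i j => ⟨hasLateLimit_sum _ _ fun h hh =>
        hasLateLimit_bulkBulk (hlate h (abs_le.2 (Finset.mem_Icc.1 hh))),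
        p.vanishesInFarPast_indexed n k hfar i j, p.realAfterWick_indexed n k hreal i j⟩⟩
  · have hν : RealOrImaginary p.nu := by
      rw [CCField.nu_of_isHeavy hH hp]
      exact realOrImaginary_I_mul _
    have hfar : ∀ h ∈ p.helicities r, VanishesInFarPast (p.heavyC ‖k‖ r h) := fun h _ =>
      CCField.vanishesInFarPast_mode hk hν.re_nonneg _
    have hreal : ∀ h ∈ p.helicities r, RealAfterWick (p.heavyC ‖k‖ r h) := fun h _ => by
      rw [CCField.heavyC, CCField.heavyCoeff, mul_assoc]
      exact CCField.realAfterWick_mode hk hν (CCField.cutFactor_of_isHeavy hH hp)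
    exact ⟨fun h hh => ⟨hfar h hh, hreal h hh⟩, fun i j =>
      ⟨CCField.vanishesInFarPast_indexed n k hfar i j,
        CCField.realAfterWick_indexed n k hreal (CCField.heavyC_neg _ _) i j⟩⟩
  · have hν : RealOrImaginary p.nu := by
      obtain ⟨x, hx, hν⟩ := CCField.nu_of_isLight hp
      rw [hν]
      exact realOrImaginary_ofReal hx.le
    have hfar : ∀ h ∈ p.helicities r, VanishesInFarPast (p.lightC ‖k‖ r h) := fun h _ =>
      CCField.vanishesInFarPast_mode hk hν.re_nonneg _
    have hreal : ∀ h ∈ p.helicities r, RealAfterWick (p.lightC ‖k‖ r h) := fun h _ =>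
      CCField.realAfterWick_mode hk hν (CCField.cutFactor_of_isLight hp)
    have hlate := fun (h : ℤ) (hh : h ∈ p.helicities r) =>
      CCField.tendsto_mode_late hH hk hr hp hh
    exact ⟨fun h hh => ⟨hasLateLimit_bulkBulk (hlate h hh), hasLateLimit_factorised (hlate h hh),
      hfar h hh, hreal h hh⟩, fun i j => ⟨hasLateLimit_sum _ _ fun h hh =>
        hasLateLimit_bulkBulk (hlate h hh), CCField.vanishesInFarPast_indexed n k hfar i j,
        CCField.realAfterWick_indexed n k hreal (CCField.lightC_neg _ _) i j⟩⟩
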